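/- Let $N\ge 2$, let $\Delta=q\prod_{n\ge1}(1-q^n)^{24}$, let $E_4=1+240\sum_{n\ge 1}\sigma_3(n)q^n$, let $j=E_4^3/\Delta$, and let $X_0(N)$ be the compact modular curve of $\Gamma_0(N)$, with field of meromorphic functions $\mathbb{C}(X_0(N))$. Let $\psi(N)=N\prod_{p\mid N}(1+1/p)$ be the Dedekind psi function. Let $$X_0(N)\to\mathbb{P}^2,\qquad z\mapsto(\Delta(z):E_4^3(z):\Delta(Nz)),$$ where at a cusp $\gamma\infty$, $\gamma\in SL_2(\mathbb{Z})$, the coordinates are the values at $\infty$ of the weight-$12$ translates by $\gamma$ of the three forms, and let $\mathcal{C}_N$ be the image of this map. (1) The map is a birational equivalence of $X_0(N)$ onto $\mathcal{C}_N$: pullback of rational functions is an isomorphism $\mathbb{C}(\mathcal{C}_N)\cong\mathbb{C}(X_0(N))$. In particular the degree of the map, that is $[\mathbb{C}(X_0(N)):\mathbb{C}(j,\Delta(N\cdot)/\Delta)]$, is $1$. (2) $\mathcal{C}_N$ is an irreducible plane projective curve of degree $\psi(N)$: there is an irreducible homogeneous polynomial $F\in\mathbb{C}[X_0,X_1,X_2]$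 of degree $\psi(N)$ such that $\mathcal{C}_N$ is the zero locus of $F$ and $F$ generates the homogeneous ideal of $\mathcal{C}_N$. Its affine equation is the minimal polynomial of $\Delta(N\cdot)/\Delta$ over $\mathbb{C}(j)$: $F(1,j,Y)$ is this (monic) minimal polynomial in $\mathbb{C}(j)[Y]$. (3) On $X_0(N)$, the divisor of poles of $j$ has degree $\psi(N)$, and the divisor of poles of $f_2=j^{N-2}+(\Delta(N\cdot)/\Delta)^{N-1}$ has degree $(N-2)\psi(N)+1$; these two numbers are coprime. -/

import Mathlib

open scoped MatrixGroups ModularForm LinearAlgebra.Projectivization IntermediateField Manifold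
open Filter UpperHalfPlane CongruenceSubgroup

noncomputable section

namespace X0Model

/-! ### The modular forms -/

/-- The point `N z` of the upper half-plane. -/
def scale (N : ℕ) [NeZero N] (z : ℍ) : ℍ :=
  ⟨(N : ℂ) * z, by
    have : (0 : ℝ) < N := Nat.cast_pos.mpr (NeZero.pos N)
    simpa using mul_pos this z.im_pos⟩

/-- `Δ`. -/
def delta (z : ℍ) : ℂ := ModularForm.discriminant z

/-- `E₄³`. -/
def eisCube (z : ℍ) : ℂ := ModularForm.E₄ z ^ 3

/-- `Δ(N·)`. -/
def deltaN (N : ℕ) [NeZero N] (z : ℍ) : ℂ := ModularForm.discriminant (scale N z)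

/-- The modular function `j = E₄³ / Δ`. -/
def jFun (z : ℍ) : ℂ := eisCube z / delta z

/-- The function `Δ(N·) / Δ`. -/
def tFun (N : ℕ) [NeZero N] (z : ℍ) : ℂ := deltaN N z / delta z

/-- The Dedekind psi function `ψ(N) = N ∏_{p ∣ N} (1 + 1 / p)`. -/
def dedekindPsi (N : ℕ) : ℕ := N.factorization.prod fun p k => p ^ (k - 1) * (p + 1)

/-! ### Points of `X₀(N)` -/

/-- `Γ₀(N)` as a subgroup of `GL(2, ℝ)`. -/
abbrev Gam0 (N : ℕ) : Subgroup (GL (Fin 2) ℝ) := (Gamma0 N : Subgroup (GL (Fin 2) ℝ))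

/-- The points of `X₀(N)`: the `Γ₀(N)`-orbits on the upper half-plane, together with the
`Γ₀(N)`-orbits of cusps. -/
abbrev X0 (N : ℕ) : Type :=
  MulAction.orbitRel.Quotient (Gamma0 N) ℍ ⊕ CuspOrbits (Gam0 N)

lemma exists_cuspMatrix (N : ℕ) [NeZero N] (o : CuspOrbits (Gam0 N)) :
    ∃ (γ : SL(2, ℤ)) (h : IsCusp (Matrix.SpecialLinearGroup.mapGL ℝ γ • OnePoint.infty) (Gam0 N)),
      o = Quotient.mk _ ⟨Matrix.SpecialLinearGroup.mapGL ℝ γ • OnePoint.infty, h⟩ := by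
  induction o using Quotient.inductionOn with
  | h c =>
    obtain ⟨c, hc⟩ := c
    have hc' : IsCusp c (Gam0 N) := hc
    rw [Subgroup.IsArithmetic.isCusp_iff_isCusp_SL2Z, isCusp_SL2Z_iff'] at hc'
    obtain ⟨γ, rfl⟩ := hc'
    exact ⟨γ, hc, rfl⟩

/-- A matrix `γ` in `SL(2, ℤ)` such that the cusp `γ ∞` represents the given orbit. -/
def cuspMatrix (N : ℕ) [NeZero N] (o : CuspOrbits (Gam0 N)) : SL(2, ℤ) :=
  (exists_cuspMatrix N o).choose

/-- The width of the cusp `γ ∞` for `Γ₀(N)`. -/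
def cuspWidth (N : ℕ) (γ : SL(2, ℤ)) : ℕ :=
  sInf {h : ℕ | 0 < h ∧ γ * ModularGroup.T ^ h * γ⁻¹ ∈ Gamma0 N}

/-! ### Meromorphic functions on `X₀(N)` -/

/-- A representative on the upper half-plane of a meromorphic function on `X₀(N)`: a
`Γ₀(N)`-invariant function that is meromorphic on the upper half-plane and at all cusps.
(At the cusp `γ ∞`, the function `z ↦ f (γ z)` has period `N`, so that it is a function of
`q_N = exp (2 π i z / N)`.) -/
structure IsModularFunction (N : ℕ) (f : ℍ → ℂ) : Prop where
  invariant : ∀ γ ∈ Gamma0 N, ∀ z : ℍ, f (γ • z) = f z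
  meromorphic : ∀ z : ℍ, MeromorphicAt (f ∘ ofComplex) (z : ℂ)
  meromorphic_cusp : ∀ γ : SL(2, ℤ), MeromorphicAt (cuspFunction N fun z => f (γ • z)) 0

lemma cuspFunction_eventuallyEq (h : ℝ) (f : ℍ → ℂ) :
    cuspFunction h f =ᶠ[nhdsWithin 0 {0}ᶜ]
      fun q => f (ofComplex (Function.Periodic.invQParam h q)) := by
  filter_upwards [self_mem_nhdsWithin] with q hq
  exact Function.Periodic.cuspFunction_eq_of_nonzero h _ hq

lemma IsModularFunction.const (N : ℕ) (c : ℂ) : IsModularFunction N fun _ => c where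
  invariant _ _ _ := rfl
  meromorphic _ := MeromorphicAt.const c _
  meromorphic_cusp _ := 
    (MeromorphicAt.const c _).congr (cuspFunction_eventuallyEq N fun _ => c).symm

lemma IsModularFunction.add {N : ℕ} {f g : ℍ → ℂ} (hf : IsModularFunction N f)
    (hg : IsModularFunction N g) : IsModularFunction N (f + g) where
  invariant γ hγ z := congrArg₂ (· + ·) (hf.invariant γ hγ z) (hg.invariant γ hγ z)
  meromorphic z := (hf.meromorphic z).add (hg.meromorphic z)
  meromorphic_cusp γ := by
    refine ((hf.meromorphic_cusp γ).add (hg.meromorphic_cusp γ)).congr ?_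
    filter_upwards [cuspFunction_eventuallyEq N fun z => f (γ • z),
      cuspFunction_eventuallyEq N fun z => g (γ • z),
      cuspFunction_eventuallyEq N fun z => (f + g) (γ • z)] with q h1 h2 h3
    rw [Pi.add_apply, h1, h2, h3, Pi.add_apply]

lemma IsModularFunction.mul {N : ℕ} {f g : ℍ → ℂ} (hf : IsModularFunction N f)
    (hg : IsModularFunction N g) : IsModularFunction N (f * g) where
  invariant γ hγ z := congrArg₂ (· * ·) (hf.invariant γ hγ z) (hg.invariant γ hγ z)
  meromorphic z := (hf.meromorphic z).mul (hg.meromorphic z)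
  meromorphic_cusp γ := by
    refine ((hf.meromorphic_cusp γ).mul (hg.meromorphic_cusp γ)).congr ?_
    filter_upwards [cuspFunction_eventuallyEq N fun z => f (γ • z),
      cuspFunction_eventuallyEq N fun z => g (γ • z),
      cuspFunction_eventuallyEq N fun z => (f * g) (γ • z)] with q h1 h2 h3
    rw [Pi.mul_apply, h1, h2, h3, Pi.mul_apply]

lemma IsModularFunction.inv {N : ℕ} {f : ℍ → ℂ} (hf : IsModularFunction N f) :
    IsModularFunction N f⁻¹ where
  invariant γ hγ z := congrArg (·⁻¹) (hf.invariant γ hγ z)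
  meromorphic z := (hf.meromorphic z).inv
  meromorphic_cusp γ := by
    refine (hf.meromorphic_cusp γ).inv.congr ?_
    filter_upwards [cuspFunction_eventuallyEq N fun z => f (γ • z),
      cuspFunction_eventuallyEq N fun z => f⁻¹ (γ • z)] with q h1 h2
    rw [Pi.inv_apply, h1, h2, Pi.inv_apply]

/-- The algebra of representatives of meromorphic functions on `X₀(N)`. -/
def modularFunctions (N : ℕ) : Subalgebra ℂ (ℍ → ℂ) where
  carrier := {f | IsModularFunction N f}
  mul_mem' hf hg := hf.mul hg
  add_mem' hf hg := hf.add hg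
  algebraMap_mem' c := IsModularFunction.const N c

/-- Two representatives give the same meromorphic function if they agree outside a closed
discrete subset of the upper half-plane: the ideal of representatives of zero. -/
def nullFunctions (N : ℕ) : Ideal (modularFunctions N) where
  carrier := {f | ∀ᶠ z in codiscrete ℍ, (f : ℍ → ℂ) z = 0}
  zero_mem' := by simp
  add_mem' {f g} hf hg := by
    change ∀ᶠ z in codiscrete ℍ, _
    filter_upwards [hf, hg] with z h1 h2
    simp [h1, h2]
  smul_mem' c f hf := by
    change ∀ᶠ z in codiscrete ℍ, _
    filter_upwards [hf] with z h1
    simp [h1]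

lemma eventually_codiscrete_iff {p : ℂ → Prop} :
    (∀ᶠ z : ℍ in codiscrete ℍ, p z) ↔ ∀ z : ℍ, ∀ᶠ w in nhdsWithin (z : ℂ) {(z : ℂ)}ᶜ, p w := by
  have key : ∀ z : ℍ, map ((↑) : ℍ → ℂ) (nhdsWithin z {z}ᶜ) = nhdsWithin (z : ℂ) {(z : ℂ)}ᶜ := by
    intro z
    have h := isOpenEmbedding_coe.isEmbedding.map_nhdsWithin_eq ({z}ᶜ) z
    rw [h]
    have h2 : ((↑) : ℍ → ℂ) '' {z}ᶜ = {(z : ℂ)}ᶜ ∩ Set.range ((↑) : ℍ → ℂ) := by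
      rw [Set.image_compl_eq_range_sdiff_image isOpenEmbedding_coe.injective, Set.image_singleton,
        Set.sdiff_eq, Set.inter_comm]
    rw [h2]
    exact nhdsWithin_inter_of_mem' (mem_nhdsWithin_of_mem_nhds
      (isOpenEmbedding_coe.isOpen_range.mem_nhds ⟨z, rfl⟩))
  simp only [codiscrete, Filter.codiscreteWithin, eventually_iSup, Set.mem_univ, true_imp_iff,
    ← Set.compl_eq_univ_sdiff]
  refine forall_congr' fun z => ?_
  rw [← key z, eventually_map]

/-- A meromorphic function on the upper half-plane that is not almost everywhere zero is
almost everywhere nonzero. -/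
lemma eventually_ne_zero {f : ℍ → ℂ} (hf : ∀ z : ℍ, MeromorphicAt (f ∘ ofComplex) (z : ℂ))
    (h0 : ¬ ∀ᶠ z in codiscrete ℍ, f z = 0) : ∀ᶠ z in codiscrete ℍ, f z ≠ 0 := by
  have h0' : ¬ ∀ᶠ z : ℍ in codiscrete ℍ, (f ∘ ofComplex) (z : ℂ) = 0 := by simpa using h0
  suffices h : ∀ᶠ z : ℍ in codiscrete ℍ, (f ∘ ofComplex) (z : ℂ) ≠ 0 by simpa using h
  rw [eventually_codiscrete_iff (p := fun z => (f ∘ ofComplex) z = 0)] at h0'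
  rw [eventually_codiscrete_iff (p := fun z => (f ∘ ofComplex) z ≠ 0)]
  push Not at h0'
  obtain ⟨z₀, hz₀⟩ := h0'
  have hU : IsPreconnected upperHalfPlaneSet := (convex_halfSpace_im_gt 0).isPreconnected
  have hM : MeromorphicOn (f ∘ ofComplex) upperHalfPlaneSet := fun w hw => hf ⟨w, hw⟩
  have h1 : meromorphicOrderAt (f ∘ ofComplex) (z₀ : ℂ) ≠ ⊤ := by
    rw [Ne, meromorphicOrderAt_eq_top_iff]
    exact fun h => hz₀ (by simpa using h)
  intro z
  exact (meromorphicOrderAt_ne_top_iff_eventually_ne_zero (hf z)).mp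
    (hM.meromorphicOrderAt_ne_top_of_isPreconnected hU z₀.2 z.2 h1)

instance (N : ℕ) : (nullFunctions N).IsMaximal := by
  rw [Ideal.isMaximal_iff]
  constructor
  · intro h
    have h' : ∀ᶠ z in codiscrete ℍ, (1 : ℂ) = 0 := h
    rw [eventually_codiscrete_iff (p := fun _ => (1 : ℂ) = 0)] at h'
    simpa using (h' UpperHalfPlane.I).exists
  · intro J f hJ hf hfJ
    have h := eventually_ne_zero f.2.meromorphic hf
    have h1 : (1 - f * ⟨_, f.2.inv⟩ : modularFunctions N) ∈ nullFunctions N := by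
      change ∀ᶠ z in codiscrete ℍ, _
      filter_upwards [h] with z hz
      simp [hz]
    have := J.add_mem (hJ h1) (J.mul_mem_right ⟨_, f.2.inv⟩ hfJ)
    simpa using this

/-- The field `ℂ(X₀(N))` of meromorphic functions on `X₀(N)`. -/
abbrev FunctionField (N : ℕ) : Type := modularFunctions N ⧸ nullFunctions N

instance (N : ℕ) : Field (FunctionField N) := Ideal.Quotient.field _

/-- The element of `ℂ(X₀(N))` that a modular function represents. -/
def toFunctionField {N : ℕ} {f : ℍ → ℂ} (hf : IsModularFunction N f) : FunctionField N :=
  Ideal.Quotient.mk _ ⟨f, hf⟩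

/-! ### `j` and `Δ(N·)/Δ` as elements of `ℂ(X₀(N))` -/

/-- The matrix `diag(N, 1)`. -/
def scaleMat (N : ℕ) [NeZero N] : GL (Fin 2) ℝ :=
  Matrix.GeneralLinearGroup.mkOfDetNeZero !![(N : ℝ), 0; 0, 1] (by simp [NeZero.ne N])

lemma scaleMat_smul (N : ℕ) [NeZero N] (z : ℍ) : scaleMat N • z = scale N z := by
  have hdet : 0 < (scaleMat N).det.val := by
    simpa [scaleMat, Matrix.GeneralLinearGroup.mkOfDetNeZero] using NeZero.pos N
  ext1
  rw [coe_smul_of_det_pos hdet]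
  simp [scaleMat, Matrix.GeneralLinearGroup.mkOfDetNeZero, num, denom, scale]

lemma slash_smul {k : ℕ} (f : ℍ → ℂ) (γ : SL(2, ℤ)) (z : ℍ) :
    f (γ • z) = denom γ z ^ k * (f ∣[(k : ℤ)] γ) z := by
  rw [ModularForm.SL_slash_apply, zpow_neg, zpow_natCast]
  field_simp [denom_ne_zero (γ : GL (Fin 2) ℝ) z]

lemma scaleMat_det (N : ℕ) [NeZero N] : (scaleMat N).det.val = N := by
  simp [scaleMat, Matrix.GeneralLinearGroup.mkOfDetNeZero]

/-- `Δ(N·)`, up to a constant, as a slash translate of `Δ`. -/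
lemma deltaN_eq (N : ℕ) [NeZero N] :
    ∃ c : ℂ, ∀ z, deltaN N z = c * (ModularForm.discriminant ∣[(12 : ℤ)] scaleMat N) z := by
  have hN : (N : ℂ) ≠ 0 := NeZero.ne _
  have hdet : 0 < (scaleMat N).det.val := by
    rw [scaleMat_det]
    exact Nat.cast_pos.mpr (NeZero.pos N)
  refine ⟨((N : ℂ) ^ 11)⁻¹, fun z => ?_⟩
  have h1 : denom (scaleMat N) z = 1 := by
    simp [scaleMat, Matrix.GeneralLinearGroup.mkOfDetNeZero, denom]
  have h2 : σ (scaleMat N) = ContinuousAlgEquiv.refl ℝ ℂ := if_pos hdet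
  rw [ModularForm.slash_apply, scaleMat_smul, deltaN, h1, scaleMat_det, h2]
  have h3 : ((12 : ℤ) - 1) = ((11 : ℕ) : ℤ) := by norm_num
  rw [h3, zpow_natCast]
  simp
  field_simp

lemma discriminant_slash (γ : SL(2, ℤ)) :
    ModularForm.discriminant ∣[(12 : ℤ)] γ = ModularForm.discriminant :=
  SlashInvariantForm.slash_action_eqn CuspForm.discriminant _ ⟨γ, rfl⟩

lemma delta_smul (γ : SL(2, ℤ)) (z : ℍ) : delta (γ • z) = denom γ z ^ 12 * delta z := by
  have h := slash_smul (k := 12) ModularForm.discriminant γ z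
  rwa [show ((12 : ℕ) : ℤ) = 12 from rfl, discriminant_slash] at h

lemma delta_ne_zero (z : ℍ) : delta z ≠ 0 := ModularForm.discriminant_ne_zero z

lemma mapGL_entry (γ : SL(2, ℤ)) (i j : Fin 2) :
    (Matrix.SpecialLinearGroup.mapGL ℝ γ : GL (Fin 2) ℝ) i j = ((γ i j : ℤ) : ℝ) := rfl

lemma scaleMat_slash (N : ℕ) [NeZero N] {γ : SL(2, ℤ)} (hγ : γ ∈ Gamma0 N) :
    (ModularForm.discriminant ∣[(12 : ℤ)] scaleMat N) ∣[(12 : ℤ)] γ =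
      ModularForm.discriminant ∣[(12 : ℤ)] scaleMat N := by
  rw [Gamma0_mem, ZMod.intCast_zmod_eq_zero_iff_dvd] at hγ
  obtain ⟨c, hc⟩ := hγ
  have hdet := γ.det_coe
  rw [Matrix.det_fin_two, hc] at hdet
  obtain ⟨γ', h00, h01, h10, h11⟩ : ∃ γ' : SL(2, ℤ), γ' 0 0 = γ 0 0 ∧ γ' 0 1 = N * γ 0 1 ∧
      γ' 1 0 = c ∧ γ' 1 1 = γ 1 1 :=
    ⟨⟨!![γ 0 0, N * γ 0 1; c, γ 1 1], by rw [Matrix.det_fin_two_of]; linarith⟩,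
      rfl, rfl, rfl, rfl⟩
  have hN : (N : ℝ) ≠ 0 := NeZero.ne _
  have hcr : ((γ 1 0 : ℤ) : ℝ) = N * c := by rw [hc]; push_cast; ring
  have key : scaleMat N * (Matrix.SpecialLinearGroup.mapGL ℝ γ) =
      (Matrix.SpecialLinearGroup.mapGL ℝ γ') * scaleMat N := by
    ext i j
    fin_cases i <;> fin_cases j <;>
      simp [scaleMat, Matrix.GeneralLinearGroup.mkOfDetNeZero, Matrix.mul_apply, h00, h01, h10,
        h11, hcr, mul_comm]
  rw [ModularForm.SL_slash, ← SlashAction.slash_mul]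
  erw [key]
  rw [SlashAction.slash_mul]
  congr 1
  exact discriminant_slash γ'

lemma deltaN_smul (N : ℕ) [NeZero N] {γ : SL(2, ℤ)} (hγ : γ ∈ Gamma0 N) (z : ℍ) :
    deltaN N (γ • z) = denom γ z ^ 12 * deltaN N z := by
  obtain ⟨c, hc⟩ := deltaN_eq N
  have h := slash_smul (k := 12) (ModularForm.discriminant ∣[(12 : ℤ)] scaleMat N) γ z
  rw [show ((12 : ℕ) : ℤ) = 12 from rfl, scaleMat_slash N hγ] at h
  rw [hc, hc, h]
  ring

open ConjAct Pointwise in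
lemma analyticAt_scaleMat_slash (N : ℕ) [NeZero N] (γ : SL(2, ℤ)) :
    AnalyticAt ℂ (cuspFunction N
      ((ModularForm.discriminant ∣[(12 : ℤ)] scaleMat N) ∣[(12 : ℤ)] γ)) 0 := by
  have hN : (0 : ℝ) < N := Nat.cast_pos.mpr (NeZero.pos N)
  have h := ModularFormClass.analyticAt_cuspFunction_zero
    (CuspForm.translate CuspForm.discriminant
      (scaleMat N * Matrix.SpecialLinearGroup.mapGL ℝ γ)) hN ?_
  · rw [ModularForm.SL_slash, ← SlashAction.slash_mul]
    exact h
  · rw [Subgroup.mem_strictPeriods_iff, map_inv, Subgroup.mem_inv_pointwise_smul_iff,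
      toConjAct_smul]
    have hdet := γ.det_coe
    rw [Matrix.det_fin_two] at hdet
    obtain ⟨γ', h00, h01, h10, h11⟩ : ∃ γ' : SL(2, ℤ), γ' 0 0 = 1 - γ 0 0 * γ 1 0 * N ∧
        γ' 0 1 = γ 0 0 ^ 2 * N ^ 2 ∧ γ' 1 0 = - γ 1 0 ^ 2 ∧ γ' 1 1 = 1 + γ 0 0 * γ 1 0 * N :=
      ⟨⟨!![1 - γ 0 0 * γ 1 0 * N, γ 0 0 ^ 2 * N ^ 2; - γ 1 0 ^ 2, 1 + γ 0 0 * γ 1 0 * N], by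
        rw [Matrix.det_fin_two_of]; ring⟩, rfl, rfl, rfl, rfl⟩
    refine ⟨γ', ?_⟩
    rw [eq_mul_inv_iff_mul_eq]
    have hdet' : ((γ 0 0 : ℤ) : ℝ) * (γ 1 1 : ℤ) - (γ 0 1 : ℤ) * (γ 1 0 : ℤ) = 1 := by
      exact_mod_cast hdet
    ext i j
    fin_cases i <;> fin_cases j <;>
      simp [scaleMat, Matrix.GeneralLinearGroup.mkOfDetNeZero, Matrix.mul_apply,
        Matrix.GeneralLinearGroup.upperRightHom, h00, h01, h10, h11,
        Matrix.vecMul, dotProduct, Fin.sum_univ_two]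
    · ring
    · linear_combination ((γ 0 0 : ℤ) : ℝ) * N ^ 2 * hdet'
    · ring
    · linear_combination ((γ 1 0 : ℤ) : ℝ) * N * hdet'

/-- Quotients of modular forms of weight 12 are modular functions. -/
lemma isModularFunction_div {N : ℕ} [NeZero N] {f g : ℍ → ℂ}
    (hfd : MDiff f) (hgd : MDiff g)
    (hf : ∀ γ ∈ Gamma0 N, ∀ z, f (γ • z) = denom γ z ^ 12 * f z)
    (hg' : ∀ γ ∈ Gamma0 N, ∀ z, g (γ • z) = denom γ z ^ 12 * g z)
    (hfc : ∀ γ : SL(2, ℤ), AnalyticAt ℂ (cuspFunction N (f ∣[(12 : ℤ)] γ)) 0)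
    (hgc : ∀ γ : SL(2, ℤ), AnalyticAt ℂ (cuspFunction N (g ∣[(12 : ℤ)] γ)) 0) :
    IsModularFunction N fun z => f z / g z where
  invariant γ hγ z := by
    have := denom_ne_zero (γ : GL (Fin 2) ℝ) z
    rw [hf γ hγ, hg' γ hγ, mul_div_mul_left _ _ (pow_ne_zero _ this)]
  meromorphic z := by
    have h1 := (UpperHalfPlane.mdifferentiable_iff.mp hfd).analyticOnNhd isOpen_upperHalfPlaneSet _ z.2
    have h2 := (UpperHalfPlane.mdifferentiable_iff.mp hgd).analyticOnNhd isOpen_upperHalfPlaneSet _ z.2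
    exact h1.meromorphicAt.div h2.meromorphicAt
  meromorphic_cusp γ := by
    refine ((hfc γ).meromorphicAt.div (hgc γ).meromorphicAt).congr ?_
    filter_upwards [cuspFunction_eventuallyEq N (f ∣[(12 : ℤ)] γ),
      cuspFunction_eventuallyEq N (g ∣[(12 : ℤ)] γ),
      cuspFunction_eventuallyEq N fun z => f (γ • z) / g (γ • z)] with q h1 h2 h3
    rw [Pi.div_apply, h1, h2, h3]
    set z := ofComplex (Function.Periodic.invQParam N q)
    have := denom_ne_zero (γ : GL (Fin 2) ℝ) z
    rw [slash_smul (k := 12) f, slash_smul (k := 12) g,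
      mul_div_mul_left _ _ (pow_ne_zero _ this)]
    rfl

lemma mem_strictPeriods_SL (N : ℕ) : (N : ℝ) ∈ (𝒮ℒ : Subgroup (GL (Fin 2) ℝ)).strictPeriods := by
  rw [Subgroup.strictPeriods_SL2Z]
  exact ⟨N, by simp⟩

/-- `E₄³` as a modular form of weight 12. -/
def eisCubeForm : ModularForm 𝒮ℒ 12 := ModularForm.mcast (by decide) (ModularForm.E₄.pow 3)

lemma coe_eisCubeForm : (eisCubeForm : ℍ → ℂ) = eisCube := by
  funext z
  exact congrFun (ModularForm.coe_pow ModularForm.E₄ 3) z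

lemma eisCube_slash (γ : SL(2, ℤ)) : eisCube ∣[(12 : ℤ)] γ = eisCube := by
  rw [← coe_eisCubeForm]
  exact SlashInvariantForm.slash_action_eqn eisCubeForm _ ⟨γ, rfl⟩

lemma eisCube_smul (γ : SL(2, ℤ)) (z : ℍ) : eisCube (γ • z) = denom γ z ^ 12 * eisCube z := by
  have h := slash_smul (k := 12) eisCube γ z
  rwa [show ((12 : ℕ) : ℤ) = 12 from rfl, eisCube_slash] at h

lemma analyticAt_eisCube (N : ℕ) [NeZero N] : AnalyticAt ℂ (cuspFunction N eisCube) 0 := by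
  rw [← coe_eisCubeForm]
  exact ModularFormClass.analyticAt_cuspFunction_zero eisCubeForm
    (Nat.cast_pos.mpr (NeZero.pos N)) (mem_strictPeriods_SL N)

lemma analyticAt_delta (N : ℕ) [NeZero N] : AnalyticAt ℂ (cuspFunction N delta) 0 :=
  ModularFormClass.analyticAt_cuspFunction_zero CuspForm.discriminant
    (Nat.cast_pos.mpr (NeZero.pos N)) (mem_strictPeriods_SL N)

lemma isModularFunction_jFun (N : ℕ) [NeZero N] : IsModularFunction N jFun :=
  isModularFunction_div
    (coe_eisCubeForm ▸ ModularFormClass.holo eisCubeForm)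
    (ModularFormClass.holo CuspForm.discriminant)
    (fun γ _ => eisCube_smul γ) (fun γ _ => delta_smul γ)
    (fun γ => by rw [eisCube_slash]; exact analyticAt_eisCube N)
    (fun γ => by erw [discriminant_slash]; exact analyticAt_delta N)

lemma isModularFunction_tFun (N : ℕ) [NeZero N] : IsModularFunction N (tFun N) := by
  obtain ⟨c, hc⟩ := deltaN_eq N
  have h : IsModularFunction N
      fun z => (ModularForm.discriminant ∣[(12 : ℤ)] scaleMat N) z / delta z :=
    isModularFunction_div
      (ModularFormClass.holo (CuspForm.translate CuspForm.discriminant (scaleMat N)))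
      (ModularFormClass.holo CuspForm.discriminant)
      (fun γ hγ z => by
        have h := slash_smul (k := 12) (ModularForm.discriminant ∣[(12 : ℤ)] scaleMat N) γ z
        rwa [show ((12 : ℕ) : ℤ) = 12 from rfl, scaleMat_slash N hγ] at h)
      (fun γ _ => delta_smul γ) (analyticAt_scaleMat_slash N)
      (fun γ => by erw [discriminant_slash]; exact analyticAt_delta N)
  have h2 := (IsModularFunction.const N c).mul h
  have h3 : tFun N = (fun _ => c) *
      fun z => (ModularForm.discriminant ∣[(12 : ℤ)] scaleMat N) z / delta z := by
    funext z
    rw [tFun, hc, Pi.mul_apply, mul_div_assoc]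
  rwa [h3]

/-- `j` as an element of `ℂ(X₀(N))`. -/
def jElt (N : ℕ) [NeZero N] : FunctionField N := toFunctionField (isModularFunction_jFun N)

/-- `Δ(N·)/Δ` as an element of `ℂ(X₀(N))`. -/
def tElt (N : ℕ) [NeZero N] : FunctionField N := toFunctionField (isModularFunction_tFun N)

/-! ### The map `X₀(N) → ℙ²` -/

/-- The vector `(Δ(z), E₄³(z), Δ(Nz))`. -/
def formVec (N : ℕ) [NeZero N] (z : ℍ) : Fin 3 → ℂ := ![delta z, eisCube z, deltaN N z]

lemma formVec_ne_zero (N : ℕ) [NeZero N] (z : ℍ) : formVec N z ≠ 0 :=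
  fun h => delta_ne_zero z (congrFun h 0)

lemma formVec_smul (N : ℕ) [NeZero N] {γ : SL(2, ℤ)} (hγ : γ ∈ Gamma0 N) (z : ℍ) :
    formVec N (γ • z) = (denom γ z ^ 12 : ℂ) • formVec N z := by
  simp only [formVec, delta_smul, eisCube_smul, deltaN_smul N hγ]
  ext i
  fin_cases i <;> rfl

/-- The values at the cusp `γ ∞` of the three modular forms, that is, the values at `∞` of their
translates `f ∣ γ` of weight 12. -/
def cuspVec (N : ℕ) [NeZero N] (γ : SL(2, ℤ)) : Fin 3 → ℂ :=
  ![valueAtInfty (delta ∣[(12 : ℤ)] γ), valueAtInfty (eisCube ∣[(12 : ℤ)] γ),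
    valueAtInfty (deltaN N ∣[(12 : ℤ)] γ)]

lemma cuspVec_ne_zero (N : ℕ) [NeZero N] (γ : SL(2, ℤ)) : cuspVec N γ ≠ 0 := by
  intro h
  have h1 : valueAtInfty (eisCube ∣[(12 : ℤ)] γ) = 0 := congrFun h 1
  rw [eisCube_slash, ← coe_eisCubeForm, ← qExpansion_coeff_zero one_pos
    (ModularFormClass.analyticAt_cuspFunction_zero eisCubeForm one_pos one_mem_strictPeriods_SL)
    (SlashInvariantFormClass.periodic_comp_ofComplex eisCubeForm one_mem_strictPeriods_SL),
    eisCubeForm, ModularForm.coe_mcast,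
    ModularForm.qExpansion_pow one_pos one_mem_strictPeriods_SL] at h1
  have h4 := EisensteinSeries.E_qExpansion_coeff_zero (by norm_num : 3 ≤ 4) ⟨2, rfl⟩
  simp only [PowerSeries.coeff_zero_eq_constantCoeff, map_pow] at h1 h4
  rw [h4] at h1
  simp at h1

/-- The map `X₀(N) → ℙ²`, `z ↦ (Δ(z) : E₄³(z) : Δ(Nz))`; the three forms have no common zero,
neither in the upper half-plane nor at a cusp. -/
def planeMap (N : ℕ) [NeZero N] : X0 N → ℙ ℂ (Fin 3 → ℂ) :=
  Sum.elim
    (Quotient.lift (fun z => Projectivization.mk ℂ (formVec N z) (formVec_ne_zero N z)) (by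
      rintro _ z ⟨γ, rfl⟩
      rw [Projectivization.mk_eq_mk_iff']
      exact ⟨denom (γ : SL(2, ℤ)) z ^ 12, (formVec_smul N γ.2 z).symm⟩))
    (fun o => Projectivization.mk ℂ (cuspVec N (cuspMatrix N o)) (cuspVec_ne_zero N _))

/-- The image curve `C_N`. -/
def imageCurve (N : ℕ) [NeZero N] : Set (ℙ ℂ (Fin 3 → ℂ)) := Set.range (planeMap N)

/-! ### Plane projective curves -/

/-- The zero locus in `ℙ²` of a homogeneous polynomial. -/
def projZeroLocus (F : MvPolynomial (Fin 3) ℂ) : Set (ℙ ℂ (Fin 3 → ℂ)) :=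
  {x | MvPolynomial.eval x.rep F = 0}

/-- The homogeneous ideal of a subset of `ℙ²`: the polynomials that vanish at all homogeneous
coordinates of all its points. -/
def projIdeal (S : Set (ℙ ℂ (Fin 3 → ℂ))) : Ideal (MvPolynomial (Fin 3) ℂ) where
  carrier := {p | ∀ (v : Fin 3 → ℂ) (hv : v ≠ 0), Projectivization.mk ℂ v hv ∈ S →
    MvPolynomial.eval v p = 0}
  zero_mem' _ _ _ := map_zero _
  add_mem' hp hq v hv h := by rw [map_add, hp v hv h, hq v hv h, add_zero]
  smul_mem' c p hp v hv h := by rw [smul_eq_mul, map_mul, hp v hv h, mul_zero]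

/-- The homogeneous coordinate ring of a subset of `ℙ²`. -/
abbrev CoordRing (S : Set (ℙ ℂ (Fin 3 → ℂ))) : Type := MvPolynomial (Fin 3) ℂ ⧸ projIdeal S

/-- `r` is the rational function `p / q` on `S`, where `p` and `q` are homogeneous of the same
degree and `q` is not a zero divisor in the homogeneous coordinate ring of `S`. -/
def IsQuotient (S : Set (ℙ ℂ (Fin 3 → ℂ))) (r : FractionRing (CoordRing S))
    (p q : MvPolynomial (Fin 3) ℂ) : Prop :=
  (∃ n : ℕ, p.IsHomogeneous n ∧ q.IsHomogeneous n) ∧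
    Ideal.Quotient.mk (projIdeal S) q ∈ nonZeroDivisors (CoordRing S) ∧
    r * algebraMap (CoordRing S) _ (Ideal.Quotient.mk _ q) =
      algebraMap (CoordRing S) _ (Ideal.Quotient.mk _ p)

/-- The ring of rational functions on a subset `S` of `ℙ²`: the homogeneous fractions of degree
zero over the homogeneous coordinate ring. For an irreducible curve `S` this is its function
field `ℂ(S)`. -/
def rationalFunctions (S : Set (ℙ ℂ (Fin 3 → ℂ))) :
    Subalgebra ℂ (FractionRing (CoordRing S)) where
  carrier := {r | ∃ p q, IsQuotient S r p q}
  mul_mem' := by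
    rintro a b ⟨p, q, ⟨n, hp, hq⟩, h1, h2⟩ ⟨p', q', ⟨n', hp', hq'⟩, h1', h2'⟩
    refine ⟨p * p', q * q', ⟨n + n', hp.mul hp', hq.mul hq'⟩, ?_, ?_⟩
    · rw [map_mul]
      exact mul_mem h1 h1'
    · simp only [map_mul]
      rw [← h2, ← h2']
      ring
  add_mem' := by
    rintro a b ⟨p, q, ⟨n, hp, hq⟩, h1, h2⟩ ⟨p', q', ⟨n', hp', hq'⟩, h1', h2'⟩
    refine ⟨p * q' + q * p', q * q', ⟨n + n', (hp.mul hq').add (hq.mul hp'), hq.mul hq'⟩, ?_, ?_⟩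
    · rw [map_mul]
      exact mul_mem h1 h1'
    · simp only [map_mul, map_add]
      rw [← h2, ← h2']
      ring
  algebraMap_mem' c := by
    refine ⟨MvPolynomial.C c, 1, ⟨0, MvPolynomial.isHomogeneous_C _ _,
      MvPolynomial.isHomogeneous_one _ _⟩, ?_, ?_⟩
    · rw [map_one]
      exact one_mem _
    · rw [map_one, map_one, mul_one]
      rfl

/-- `e` is the pullback of rational functions along the map `z ↦ (Δ(z) : E₄³(z) : Δ(Nz))`: it
sends `p / q` to the modular function `z ↦ p(Δ(z), E₄³(z), Δ(Nz)) / q(Δ(z), E₄³(z), Δ(Nz))`. -/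
def IsPullback (N : ℕ) [NeZero N]
    (e : rationalFunctions (imageCurve N) →ₐ[ℂ] FunctionField N) : Prop :=
  ∀ (r : rationalFunctions (imageCurve N)) (p q : MvPolynomial (Fin 3) ℂ),
    IsQuotient (imageCurve N) r p q →
      ∃ hf : IsModularFunction N fun z =>
          MvPolynomial.eval (formVec N z) p / MvPolynomial.eval (formVec N z) q,
        e r = toFunctionField hf

/-- The map `z ↦ (Δ(z) : E₄³(z) : Δ(Nz))` is a birational equivalence of `X₀(N)` and the image
curve: the pullback of rational functions is an isomorphism of the function fields. -/
def IsBirationalOntoImage (N : ℕ) [NeZero N] : Prop :=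
  ∃ e : rationalFunctions (imageCurve N) ≃ₐ[ℂ] FunctionField N, IsPullback N e.toAlgHom

/-- The degree of the map `z ↦ (Δ(z) : E₄³(z) : Δ(Nz))`, that is, the degree of `ℂ(X₀(N))` over
its subfield generated by `E₄³/Δ` and `Δ(N·)/Δ`. -/
def mapDegree (N : ℕ) [NeZero N] : ℕ :=
  Module.finrank (IntermediateField.adjoin ℂ {jElt N, tElt N}) (FunctionField N)

/-! ### Divisors of poles -/

/-- The order of the pole of `g` at `x` (zero if there is no pole). -/
def poleOrderAt (g : ℂ → ℂ) (x : ℂ) : ℕ := (-(meromorphicOrderAt g x).untop₀).toNat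

/-- The order of the pole of a modular function at a point of `X₀(N)`. At the orbit of a point `z`
of the upper half-plane, the order at `z` is divided by the order of the stabilizer of `z` in
`Γ₀(N) / {±1}`; at a cusp `γ ∞` of width `h`, the order is taken in the local parameter
`exp (2 π i z / h)` of `f ∘ γ`. -/
def poleOrder (N : ℕ) [NeZero N] (f : ℍ → ℂ) : X0 N → ℕ :=
  Sum.elim
    (fun o => poleOrderAt (f ∘ ofComplex) (o.out : ℍ) /
      (Nat.card (MulAction.stabilizer (Gamma0 N) (o.out : ℍ)) / 2))
    (fun o => poleOrderAt
      (cuspFunction (cuspWidth N (cuspMatrix N o)) fun z => f (cuspMatrix N o • z)) 0)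

/-- The degree of the divisor of poles of a modular function on `X₀(N)`. -/
def poleDegree (N : ℕ) [NeZero N] (f : ℍ → ℂ) : ℕ := ∑ᶠ x : X0 N, poleOrder N f x

/-- `f₂ = j^(N-2) + (Δ(N·)/Δ)^(N-1)`. -/
def f2Fun (N : ℕ) [NeZero N] (z : ℍ) : ℂ := jFun z ^ (N - 2) + tFun N z ^ (N - 1)

end X0Model

end

/-!
Write `t = Δ(N·)/Δ`, so that the map is `z ↦ (1 : j : t)` on the upper half-plane.

The stabilizer of `t` in `SL(2, ℤ)` is `Γ₀(N)`: the translates of `t` are, up to constants, the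
functions `Δ((a z + b) / d) / Δ(z)` with `a d = N`, whose leading exponent `a² / N - 1` at `i ∞`
determines `a`, and `a = N` for `γ ∈ Γ₀(N)` only (`mem_Gamma0_of_tFun_smul_eq`). Hence `t` has
`[SL(2, ℤ) : Γ₀(N)] = ψ(N)` distinct conjugates `t_c`. The coefficients of `∏ (Y - t_c)` are
holomorphic functions of level one; since each `t_c` is `o(q⁻¹)`, the coefficient of `Y ^ k` is a
polynomial in `j` of degree less than `ψ(N) - k` (`conjPoly_eq`, `degree_coeffPoly_lt`). As the
conjugates are distinct, `1, t, …, t ^ (ψ(N) - 1)` are linearly independent over `ℂ(j)`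
(`linearIndependent_tElt_pow`), so this product is the minimal polynomial of `t`. Lagrange
interpolation at the `t_c` writes every modular function for `Γ₀(N)` as a polynomial in `t` whose
coefficients are meromorphic functions of level one, that is, rational functions of `j`
(`exists_polynomials_of_invariant`); so `j` and `t` generate the function field
(`adjoin_jElt_tElt`).

By the degree bound on the coefficients, the homogenization `F` of the minimal polynomial is `Y ^ ψ`
on the line at infinity `X₀ = 0`, so `F` has only the zero `(0 : 1 : 0)` there, which is the image
of all cusps. Off this line, the zeros of `F` are the points `(1 : j(z) : t(γ z))`, because `j` is
surjective onto `ℂ` (`imageCurve_eq`). The ideal of the curve is prime, since its forms are the ones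
that vanish at the generic point `(1 : j : t)`, and it is generated by `F`, since division by the
monic polynomial `F` leaves a remainder of degree less than `ψ(N)` in the last variable
(`projIdeal_imageCurve`). Evaluation of fractions of forms at the generic point is then the
isomorphism of function fields (`isBirationalOntoImage`).

For the poles, which lie at the cusps only: at a cusp `γ ∞` of width `h`, `j` has a pole of order
`h`, and the widths add up to the index `ψ(N)` because the cusps correspond to the orbits of
`T = (1, 1; 0, 1)` on the cosets (`sum_cuspWidth`). The pole of `f₂` at `γ ∞` is that of
`j ^ (N - 2)`, of order `(N - 2) h`, except at the cusp `0` of width `N`, where `t ^ (N - 1)`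
dominates with a pole of order `(N - 1) ^ 2 = (N - 2) N + 1` (`exists_hasLeading_f2Fun_smul`).
-/

noncomputable section

namespace X0Model

/-! ### The index of `Γ₀(N)` -/

lemma dedekindPsi_mul_of_not_dvd {p a : ℕ} (hp : p.Prime) (h : ¬ p ∣ a) (k : ℕ)
    (hk : k ≠ 0) : dedekindPsi (p ^ k * a) = p ^ (k - 1) * (p + 1) * dedekindPsi a := by
  have hc : Nat.Coprime (p ^ k) a :=
    (Nat.Coprime.pow_left k) ((Nat.Prime.coprime_iff_not_dvd hp).2 h)
  rw [dedekindPsi, Nat.factorization_mul_of_coprime hc,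
    Finsupp.prod_add_index_of_disjoint hc.disjoint_primeFactors, hp.factorization_pow,
    Finsupp.prod]
  have : (Finsupp.single p k).support = {p} := by simp [Finsupp.support_single, hk]
  rw [this]
  simp [dedekindPsi]

lemma dedekindPsi_prime_mul {p a : ℕ} (hp : p.Prime) (ha : a ≠ 0) :
    dedekindPsi (p * a) = (if p ∣ a then p else p + 1) * dedekindPsi a := by
  obtain ⟨k, m, hm, rfl⟩ := Nat.exists_eq_pow_mul_and_not_dvd ha p hp.ne_one
  rcases Nat.eq_zero_or_pos k with rfl | hk
  · have := dedekindPsi_mul_of_not_dvd hp hm 1 one_ne_zero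
    simp only [pow_one] at this
    simp [hm, this]
  · rw [if_pos (dvd_mul_of_dvd_left (dvd_pow_self p hk.ne') m), ← mul_assoc, ← pow_succ',
      dedekindPsi_mul_of_not_dvd hp hm _ (Nat.succ_ne_zero k),
      dedekindPsi_mul_of_not_dvd hp hm _ hk.ne']
    obtain ⟨l, rfl⟩ := Nat.exists_eq_succ_of_ne_zero hk.ne'
    simp [pow_succ]
    ring

lemma mem_Gamma0_iff_dvd {N : ℕ} {γ : SL(2, ℤ)} : γ ∈ Gamma0 N ↔ (N : ℤ) ∣ γ 1 0 := by
  rw [Gamma0_mem, ZMod.intCast_zmod_eq_zero_iff_dvd]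

lemma inv_mul_apply_one_zero (γ δ : SL(2, ℤ)) :
    (γ⁻¹ * δ) 1 0 = γ 0 0 * δ 1 0 - γ 1 0 * δ 0 0 := by
  rw [Matrix.SpecialLinearGroup.coe_mul, Matrix.SpecialLinearGroup.coe_inv,
    Matrix.adjugate_fin_two]
  simp [Matrix.mul_apply, Fin.sum_univ_two]
  ring

lemma Gamma0_mul_le (M p : ℕ) : Gamma0 (M * p) ≤ Gamma0 M := fun γ hγ => by
  rw [mem_Gamma0_iff_dvd] at *
  exact (Int.natCast_dvd_natCast.2 (dvd_mul_right M p)).trans hγ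

/-- For `γ = (a, b; M c, d)` in `Γ₀(M)`, the point `(a : c)` of the projective line over `𝔽_p`,
written as `c / a` or `none`. -/
def colPoint (M p : ℕ) [Fact p.Prime] (γ : SL(2, ℤ)) : Option (ZMod p) :=
  if ((γ 0 0 : ℤ) : ZMod p) = 0 then none
  else some (((γ 1 0 / M : ℤ) : ZMod p) / ((γ 0 0 : ℤ) : ZMod p))

lemma colPoint_eq_iff {M p : ℕ} [NeZero M] [Fact p.Prime] {γ δ : SL(2, ℤ)} (hγ : γ ∈ Gamma0 M)
    (hδ : δ ∈ Gamma0 M) : colPoint M p γ = colPoint M p δ ↔ γ⁻¹ * δ ∈ Gamma0 (M * p) := by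
  have hM : (M : ℤ) ≠ 0 := by exact_mod_cast NeZero.ne M
  have h1 := γ.det_coe
  have h2 := δ.det_coe
  rw [mem_Gamma0_iff_dvd] at hγ hδ
  obtain ⟨c, hc⟩ := hγ
  obtain ⟨c', hc'⟩ := hδ
  rw [mem_Gamma0_iff_dvd, inv_mul_apply_one_zero, hc, hc', colPoint, colPoint, hc, hc',
    Int.mul_ediv_cancel_left _ hM, Int.mul_ediv_cancel_left _ hM]
  rw [Matrix.det_fin_two] at h1 h2
  rw [hc] at h1
  rw [hc'] at h2
  have h3 : γ 0 0 * (M * c') - M * c * δ 0 0 = M * (γ 0 0 * c' - c * δ 0 0) := by ring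
  push_cast
  rw [h3, mul_dvd_mul_iff_left hM, ← ZMod.intCast_zmod_eq_zero_iff_dvd]
  have h1' := congrArg (Int.cast : ℤ → ZMod p) h1
  have h2' := congrArg (Int.cast : ℤ → ZMod p) h2
  push_cast at h1' h2' ⊢
  by_cases ha : ((γ 0 0 : ℤ) : ZMod p) = 0 <;> by_cases hb : ((δ 0 0 : ℤ) : ZMod p) = 0
  · simp [ha, hb]
  · simp only [ha, hb, if_true, if_false]
    rw [ha] at h1'
    have : ((c : ℤ) : ZMod p) ≠ 0 := by rintro h; rw [h] at h1'; simp at h1'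
    simp [this, hb]
  · simp only [ha, hb, if_true, if_false]
    rw [hb] at h2'
    have : ((c' : ℤ) : ZMod p) ≠ 0 := by rintro h; rw [h] at h2'; simp at h2'
    simp [this, ha]
  · simp only [ha, hb, if_false, Option.some.injEq]
    rw [div_eq_div_iff ha hb, sub_eq_zero, eq_comm, mul_comm ((γ 0 0 : ℤ) : ZMod p)]

lemma exists_colPoint_eq_some (M p : ℕ) [NeZero M] [Fact p.Prime] (x : ZMod p) :
    ∃ γ ∈ Gamma0 M, colPoint M p γ = some x := by
  have hM : (M : ℤ) ≠ 0 := by exact_mod_cast NeZero.ne M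
  obtain ⟨γ, h0, h1⟩ := (isCoprime_one_left (x := (M : ℤ) * x.val)).exists_SL2_col 0
  refine ⟨γ, by rw [mem_Gamma0_iff_dvd, h1]; exact dvd_mul_right _ _, ?_⟩
  simp [colPoint, h0, h1, Int.mul_ediv_cancel_left _ hM]

lemma exists_colPoint_eq_none {M p : ℕ} [NeZero M] [Fact p.Prime] :
    (∃ γ ∈ Gamma0 M, colPoint M p γ = none) ↔ ¬ p ∣ M := by
  constructor
  · rintro ⟨γ, hγ, h⟩ hp
    have h1 := γ.det_coe
    rw [mem_Gamma0_iff_dvd] at hγ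
    have h2 : ((γ 1 0 : ℤ) : ZMod p) = 0 :=
      (ZMod.intCast_zmod_eq_zero_iff_dvd _ _).2 ((Int.natCast_dvd_natCast.2 hp).trans hγ)
    have h3 : ((γ 0 0 : ℤ) : ZMod p) = 0 := by
      by_contra h3
      simp [colPoint, h3] at h
    rw [Matrix.det_fin_two] at h1
    have := congrArg (Int.cast : ℤ → ZMod p) h1
    push_cast at this
    simp [h2, h3] at this
  · intro h
    have hc : IsCoprime (p : ℤ) M :=
      Nat.isCoprime_iff_coprime.2 ((Nat.Prime.coprime_iff_not_dvd Fact.out).2 h)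
    obtain ⟨γ, h0, h1⟩ := hc.exists_SL2_col 0
    exact ⟨γ, by rw [mem_Gamma0_iff_dvd, h1], by simp [colPoint, h0]⟩

/-- The cosets of `Γ₀(M p)` in `Γ₀(M)` are classified by points of the projective line over `𝔽_p`;
the point `none` is missed if `p` divides `M`. -/
lemma relIndex_Gamma0_mul (M p : ℕ) [NeZero M] [Fact p.Prime] :
    (Gamma0 (M * p)).relIndex (Gamma0 M) = if p ∣ M then p else p + 1 := by
  have e : (Gamma0 M ⧸ (Gamma0 (M * p)).subgroupOf (Gamma0 M)) ≃
      Set.range fun γ : Gamma0 M => colPoint M p γ := by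
    refine Equiv.trans (Quotient.congrRight fun γ δ => ?_) (Setoid.quotientKerEquivRange _)
    rw [QuotientGroup.leftRel_apply, Subgroup.mem_subgroupOf]
    exact (colPoint_eq_iff γ.2 δ.2).symm
  rw [Subgroup.relIndex, Subgroup.index, Nat.card_congr e]
  have hp0 : p ≠ 0 := (Fact.out : p.Prime).ne_zero
  have : NeZero p := ⟨hp0⟩
  split_ifs with h
  · have : (Set.range fun γ : Gamma0 M => colPoint M p γ) = Set.range (some : ZMod p → _) := by
      ext x
      constructor
      · rintro ⟨γ, rfl⟩
        by_contra hx
        refine exists_colPoint_eq_none.1 ⟨γ, γ.2, ?_⟩ h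
        exact Option.eq_none_iff_forall_ne_some.2 fun a ha => hx ⟨a, ha.symm⟩
      · rintro ⟨x, rfl⟩
        obtain ⟨γ, hγ, h⟩ := exists_colPoint_eq_some M p x
        exact ⟨⟨γ, hγ⟩, h⟩
    rw [this, Nat.card_range_of_injective (Option.some_injective _), Nat.card_zmod]
  · have : (Set.range fun γ : Gamma0 M => colPoint M p γ) = Set.univ := by
      rw [Set.eq_univ_iff_forall]
      rintro (_ | x)
      · obtain ⟨γ, hγ, h⟩ := exists_colPoint_eq_none.2 h
        exact ⟨⟨γ, hγ⟩, h⟩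
      · obtain ⟨γ, hγ, h⟩ := exists_colPoint_eq_some M p x
        exact ⟨⟨γ, hγ⟩, h⟩
    rw [this, Nat.card_univ, Finite.card_option, Nat.card_zmod]

theorem index_Gamma0 (N : ℕ) (hN : N ≠ 0) : (Gamma0 N).index = dedekindPsi N := by
  induction N using induction_on_primes with
  | zero => simp at hN
  | one =>
    have : Gamma0 1 = ⊤ := by
      ext γ
      rw [mem_Gamma0_iff_dvd]
      simp
    simp [this, dedekindPsi]
  | prime_mul p a hp ih =>
    have ha : a ≠ 0 := right_ne_zero_of_mul hN
    have : NeZero a := ⟨ha⟩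
    have : Fact p.Prime := ⟨hp⟩
    rw [dedekindPsi_prime_mul hp ha, ← ih ha, ← relIndex_Gamma0_mul, mul_comm p a,
      Subgroup.relIndex_mul_index (Gamma0_mul_le a p)]

/-! ### Cusps and their widths -/

lemma T_zpow_smul_mk_eq_iff {N : ℕ} {g g' : SL(2, ℤ)} (k : ℤ) :
    ModularGroup.T ^ k • (g : SL(2, ℤ) ⧸ Gamma0 N) = (g' : SL(2, ℤ) ⧸ Gamma0 N) ↔
      g⁻¹ * ModularGroup.T ^ (-k) * g' ∈ Gamma0 N := by
  have h : ModularGroup.T ^ k • (g : SL(2, ℤ) ⧸ Gamma0 N) =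
    ((ModularGroup.T ^ k * g : SL(2, ℤ)) : SL(2, ℤ) ⧸ Gamma0 N) := rfl
  rw [h, QuotientGroup.eq, mul_inv_rev, zpow_neg]

lemma mul_T_zpow_mul_mem_iff {N : ℕ} {γ γ' : SL(2, ℤ)} (k : ℤ) :
    γ * ModularGroup.T ^ k * γ'⁻¹ ∈ Gamma0 N ↔
      ModularGroup.T ^ k • ((γ'⁻¹ : SL(2, ℤ)) : SL(2, ℤ) ⧸ Gamma0 N) = (γ⁻¹ : SL(2, ℤ)) := by
  rw [T_zpow_smul_mk_eq_iff, ← inv_mem_iff]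
  simp [mul_assoc]

lemma isPeriodicPt_T_smul_iff {N : ℕ} {γ : SL(2, ℤ)} (n : ℕ) :
    Function.IsPeriodicPt (ModularGroup.T • ·) n ((γ⁻¹ : SL(2, ℤ)) : SL(2, ℤ) ⧸ Gamma0 N) ↔
      γ * ModularGroup.T ^ n * γ⁻¹ ∈ Gamma0 N := by
  rw [Function.IsPeriodicPt, Function.IsFixedPt, smul_iterate, ← zpow_natCast,
    mul_T_zpow_mul_mem_iff]

lemma minimalPeriod_T_smul_pos {N : ℕ} [NeZero N] (x : SL(2, ℤ) ⧸ Gamma0 N) :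
    0 < Function.minimalPeriod (ModularGroup.T • ·) x :=
  Function.minimalPeriod_pos_of_mem_periodicPts
    ((MulAction.injective ModularGroup.T).mem_periodicPts x)

/-- The width of the cusp `γ ∞` is the length of the cycle of `T` through the coset of `γ⁻¹`. -/
lemma cuspWidth_eq_minimalPeriod (N : ℕ) [NeZero N] (γ : SL(2, ℤ)) :
    cuspWidth N γ =
      Function.minimalPeriod (ModularGroup.T • ·) ((γ⁻¹ : SL(2, ℤ)) : SL(2, ℤ) ⧸ Gamma0 N) := by
  have hmem : Function.minimalPeriod (ModularGroup.T • ·)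
      ((γ⁻¹ : SL(2, ℤ)) : SL(2, ℤ) ⧸ Gamma0 N) ∈
        {h : ℕ | 0 < h ∧ γ * ModularGroup.T ^ h * γ⁻¹ ∈ Gamma0 N} :=
    ⟨minimalPeriod_T_smul_pos _,
      (isPeriodicPt_T_smul_iff _).1 (Function.isPeriodicPt_minimalPeriod _ _)⟩
  obtain ⟨h0, h1⟩ := Nat.sInf_mem ⟨_, hmem⟩
  exact le_antisymm (Nat.sInf_le hmem)
    (((isPeriodicPt_T_smul_iff _).2 h1).minimalPeriod_le h0)

lemma cuspWidth_pos (N : ℕ) [NeZero N] (γ : SL(2, ℤ)) : 0 < cuspWidth N γ := by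
  rw [cuspWidth_eq_minimalPeriod]
  exact minimalPeriod_T_smul_pos _

lemma mul_T_cuspWidth_mem (N : ℕ) [NeZero N] (γ : SL(2, ℤ)) :
    γ * ModularGroup.T ^ cuspWidth N γ * γ⁻¹ ∈ Gamma0 N := by
  rw [cuspWidth_eq_minimalPeriod, ← isPeriodicPt_T_smul_iff]
  exact Function.isPeriodicPt_minimalPeriod _ _

lemma mapGL_smul_infty_eq_iff (γ γ' : SL(2, ℤ)) :
    Matrix.SpecialLinearGroup.mapGL ℝ γ • (OnePoint.infty : OnePoint ℝ) =
      Matrix.SpecialLinearGroup.mapGL ℝ γ' • OnePoint.infty ↔ (γ⁻¹ * γ') 1 0 = 0 := by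
  rw [eq_comm, ← inv_smul_eq_iff, ← map_inv, smul_smul, ← map_mul,
    OnePoint.smul_infty_eq_self_iff, mapGL_entry, Int.cast_eq_zero]

lemma eq_T_zpow_or_eq_neg {γ : SL(2, ℤ)} (h : γ 1 0 = 0) :
    ∃ k : ℤ, γ = ModularGroup.T ^ k ∨ γ = -ModularGroup.T ^ k := by
  have hd := γ.det_coe
  rw [Matrix.det_fin_two, h, mul_zero, sub_zero] at hd
  rcases Int.mul_eq_one_iff_eq_one_or_neg_one.1 hd with ⟨h0, h1⟩ | ⟨h0, h1⟩
  · refine ⟨γ 0 1, Or.inl ?_⟩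
    ext i j
    fin_cases i <;> fin_cases j <;> simp [ModularGroup.coe_T_zpow, h, h0, h1]
  · refine ⟨-γ 0 1, Or.inr ?_⟩
    ext i j
    fin_cases i <;> fin_cases j <;> simp [ModularGroup.coe_T_zpow, h, h0, h1]

lemma neg_mem_Gamma0_iff {N : ℕ} {γ : SL(2, ℤ)} : -γ ∈ Gamma0 N ↔ γ ∈ Gamma0 N := by
  rw [mem_Gamma0_iff_dvd, mem_Gamma0_iff_dvd]
  simp

/-- Two cusps are equivalent if and only if the corresponding cosets are in the same orbit of `T`;
the elements `±T ^ k` form the stabilizer of `∞`. -/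
lemma mk_cusp_eq_iff {N : ℕ} [NeZero N] {γ γ' : SL(2, ℤ)}
    (h : IsCusp (Matrix.SpecialLinearGroup.mapGL ℝ γ • OnePoint.infty) (Gam0 N))
    (h' : IsCusp (Matrix.SpecialLinearGroup.mapGL ℝ γ' • OnePoint.infty) (Gam0 N)) :
    (Quotient.mk _ ⟨_, h⟩ : CuspOrbits (Gam0 N)) = Quotient.mk _ ⟨_, h'⟩ ↔
      ∃ k : ℤ, γ * ModularGroup.T ^ k * γ'⁻¹ ∈ Gamma0 N := by
  rw [Quotient.eq]
  constructor
  · rintro ⟨⟨_, δ, (hδ : δ ∈ Gamma0 N), rfl⟩, e⟩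
    have e' : Matrix.SpecialLinearGroup.mapGL ℝ δ •
        (Matrix.SpecialLinearGroup.mapGL ℝ γ' • (OnePoint.infty : OnePoint ℝ)) =
        Matrix.SpecialLinearGroup.mapGL ℝ γ • OnePoint.infty := congrArg Subtype.val e
    rw [smul_smul, ← map_mul, eq_comm, mapGL_smul_infty_eq_iff] at e'
    obtain ⟨k, hk | hk⟩ := eq_T_zpow_or_eq_neg e'
    · refine ⟨k, ?_⟩
      rw [← hk]
      have : γ * (γ⁻¹ * (δ * γ')) * γ'⁻¹ = δ := by group
      rwa [this]
    · refine ⟨k, ?_⟩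
      have : γ * (γ⁻¹ * (δ * γ')) * γ'⁻¹ = δ := by group
      rwa [← neg_mem_Gamma0_iff, ← neg_mul, ← mul_neg, ← hk, this]
  · rintro ⟨k, hk⟩
    refine ⟨⟨Matrix.SpecialLinearGroup.mapGL ℝ _, _, hk, rfl⟩, Subtype.ext ?_⟩
    change Matrix.SpecialLinearGroup.mapGL ℝ (γ * ModularGroup.T ^ k * γ'⁻¹) •
        (Matrix.SpecialLinearGroup.mapGL ℝ γ' • (OnePoint.infty : OnePoint ℝ)) =
        Matrix.SpecialLinearGroup.mapGL ℝ γ • OnePoint.infty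
    rw [smul_smul, ← map_mul, eq_comm, mapGL_smul_infty_eq_iff]
    simp [mul_assoc, ModularGroup.coe_T_zpow]

lemma isCusp_mapGL_smul (N : ℕ) [NeZero N] (γ : SL(2, ℤ)) :
    IsCusp (Matrix.SpecialLinearGroup.mapGL ℝ γ • OnePoint.infty) (Gam0 N) := by
  rw [Subgroup.IsArithmetic.isCusp_iff_isCusp_SL2Z, isCusp_SL2Z_iff']
  exact ⟨γ, rfl⟩

lemma eq_of_mul_T_zpow_mul_mem {N : ℕ} [NeZero N] {o o' : CuspOrbits (Gam0 N)} {k : ℤ}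
    (h : cuspMatrix N o * ModularGroup.T ^ k * (cuspMatrix N o')⁻¹ ∈ Gamma0 N) : o = o' := by
  obtain ⟨h1, e1⟩ := (exists_cuspMatrix N o).choose_spec
  obtain ⟨h2, e2⟩ := (exists_cuspMatrix N o').choose_spec
  rw [e1, e2]
  exact (mk_cusp_eq_iff h1 h2).2 ⟨k, h⟩

lemma exists_cuspMatrix_mul_T_zpow_mul_mem (N : ℕ) [NeZero N] (γ : SL(2, ℤ)) :
    ∃ (o : CuspOrbits (Gam0 N)) (k : ℤ),
      cuspMatrix N o * ModularGroup.T ^ k * γ⁻¹ ∈ Gamma0 N := by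
  let o : CuspOrbits (Gam0 N) := Quotient.mk _ ⟨_, isCusp_mapGL_smul N γ⟩
  obtain ⟨h1, e1⟩ := (exists_cuspMatrix N o).choose_spec
  exact ⟨o, (mk_cusp_eq_iff h1 (isCusp_mapGL_smul N γ)).1 e1.symm⟩

/-- The orbits of `T` on `SL(2, ℤ) / Γ₀(N)` correspond to the cusps, and the length of an orbit is
the width of the cusp. -/
theorem sum_cuspWidth (N : ℕ) [NeZero N] [Fintype (CuspOrbits (Gam0 N))] :
    ∑ o : CuspOrbits (Gam0 N), cuspWidth N (cuspMatrix N o) = dedekindPsi N := by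
  let x (o : CuspOrbits (Gam0 N)) : SL(2, ℤ) ⧸ Gamma0 N := ((cuspMatrix N o)⁻¹ : SL(2, ℤ))
  let Φ : (Σ o, MulAction.orbit (Subgroup.zpowers ModularGroup.T) (x o)) → SL(2, ℤ) ⧸ Gamma0 N :=
    fun y => y.2
  have hΦ : Function.Bijective Φ := by
    constructor
    · rintro ⟨o, y, ⟨⟨_, k, rfl⟩, hk⟩⟩ ⟨o', y', ⟨⟨_, k', rfl⟩, hk'⟩⟩ (h : y = y')
      subst h
      have hk1 : ModularGroup.T ^ k • x o = y := hk
      have hk1' : ModularGroup.T ^ k' • x o' = y := hk'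
      have : o = o' := by
        refine eq_of_mul_T_zpow_mul_mem (k := -k + k') ?_
        rw [mul_T_zpow_mul_mem_iff, zpow_add, mul_smul, hk1', ← hk1, smul_smul, ← zpow_add]
        simp [x]
      subst this
      rfl
    · intro y
      induction y using QuotientGroup.induction_on with
      | H g =>
        obtain ⟨o, k, h⟩ := exists_cuspMatrix_mul_T_zpow_mul_mem N g⁻¹
        rw [mul_T_zpow_mul_mem_iff, inv_inv] at h
        refine ⟨⟨o, g, ⟨⟨_, -k, rfl⟩, ?_⟩⟩, rfl⟩
        change ModularGroup.T ^ (-k) • x o = _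
        change ModularGroup.T ^ (-k) • (((cuspMatrix N o)⁻¹ : SL(2, ℤ)) : SL(2, ℤ) ⧸ Gamma0 N) = _
        rw [← h, smul_smul, ← zpow_add]
        simp
  have hfin (o : CuspOrbits (Gam0 N)) :
      Fintype (MulAction.orbit (Subgroup.zpowers ModularGroup.T) (x o)) := Fintype.ofFinite _
  rw [← index_Gamma0 N (NeZero.ne N), Subgroup.index, ← Nat.card_congr (Equiv.ofBijective Φ hΦ),
    Nat.card_eq_fintype_card, Fintype.card_sigma]
  exact Finset.sum_congr rfl fun o _ => by
    rw [cuspWidth_eq_minimalPeriod]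
    exact @MulAction.minimalPeriod_eq_card _ _ _ ModularGroup.T _ (x o) (hfin o)

/-! ### The cusp `0` -/

lemma mul_T_zpow_mul_S_inv (γ : SL(2, ℤ)) (k : ℤ) :
    (γ * ModularGroup.T ^ k * ModularGroup.S⁻¹) 1 0 = -(γ 1 0 * k + γ 1 1) := by
  rw [Matrix.SpecialLinearGroup.coe_mul, Matrix.SpecialLinearGroup.coe_mul,
    ModularGroup.coe_T_zpow, Matrix.SpecialLinearGroup.coe_inv, Matrix.adjugate_fin_two,
    ModularGroup.coe_S]
  simp [Matrix.mul_apply, Fin.sum_univ_two]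

lemma isCoprime_bottom (γ : SL(2, ℤ)) : IsCoprime (γ 1 0) (γ 1 1) := by
  have h := γ.det_coe
  rw [Matrix.det_fin_two] at h
  exact ⟨-γ 0 1, γ 0 0, by linarith⟩

lemma isCoprime_col (γ : SL(2, ℤ)) : IsCoprime (γ 0 0) (γ 1 0) := by
  have h := γ.det_coe
  rw [Matrix.det_fin_two] at h
  exact ⟨γ 1 1, -γ 0 1, by linarith⟩

/-- The cusps `γ ∞` with `γ 1 0` coprime to `N` are the ones equivalent to `0 = S ∞`. -/
lemma exists_mul_T_zpow_mul_S_inv_mem_iff {N : ℕ} [NeZero N] {γ : SL(2, ℤ)} :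
    (∃ k : ℤ, γ * ModularGroup.T ^ k * ModularGroup.S⁻¹ ∈ Gamma0 N) ↔
      IsCoprime (γ 1 0) (N : ℤ) := by
  simp only [mem_Gamma0_iff_dvd, mul_T_zpow_mul_S_inv, dvd_neg]
  constructor
  · rintro ⟨k, m, hm⟩
    obtain ⟨u, v, h⟩ := isCoprime_bottom γ
    exact ⟨u - v * k, v * m, by linear_combination h - v * hm⟩
  · rintro ⟨u, v, h⟩
    exact ⟨-u * γ 1 1, v * γ 1 1, by linear_combination -(γ 1 1) * h⟩

/-- Exactly one of the chosen representatives belongs to the cusp `0`. -/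
lemma existsUnique_isCoprime_cuspMatrix (N : ℕ) [NeZero N] :
    ∃! o : CuspOrbits (Gam0 N), IsCoprime (cuspMatrix N o 1 0) (N : ℤ) := by
  simp only [← exists_mul_T_zpow_mul_S_inv_mem_iff]
  obtain ⟨o, ho⟩ := exists_cuspMatrix_mul_T_zpow_mul_mem N ModularGroup.S
  refine ⟨o, ho, fun o' ho' => ?_⟩
  obtain ⟨k, hk⟩ := ho
  obtain ⟨k', hk'⟩ := ho'
  refine eq_of_mul_T_zpow_mul_mem (k := k' - k) ?_
  convert mul_mem hk' (inv_mem hk) using 1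
  rw [zpow_sub]
  group

lemma cuspWidth_of_isCoprime {N : ℕ} [NeZero N] {γ : SL(2, ℤ)}
    (h : IsCoprime (γ 1 0) (N : ℤ)) : cuspWidth N γ = N := by
  have key (n : ℕ) : γ * ModularGroup.T ^ n * γ⁻¹ ∈ Gamma0 N ↔ N ∣ n := by
    have : (γ * ModularGroup.T ^ n * γ⁻¹) 1 0 = - ((γ 1 0) ^ 2 * n) := by
      rw [← zpow_natCast, Matrix.SpecialLinearGroup.coe_mul, Matrix.SpecialLinearGroup.coe_mul,
        ModularGroup.coe_T_zpow, Matrix.SpecialLinearGroup.coe_inv, Matrix.adjugate_fin_two]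
      simp [Matrix.mul_apply, Fin.sum_univ_two]
      ring
    rw [mem_Gamma0_iff_dvd, this, dvd_neg, ← Int.natCast_dvd_natCast]
    exact ⟨h.symm.pow_right.dvd_of_dvd_mul_left, fun h => dvd_mul_of_dvd_right h _⟩
  have h1 := (key _).1 (mul_T_cuspWidth_mem N γ)
  exact le_antisymm (Nat.sInf_le ⟨NeZero.pos N, (key N).2 dvd_rfl⟩)
    (Nat.le_of_dvd (cuspWidth_pos N γ) h1)

/-! ### Leading terms at `i ∞` -/

/-- `exp (2 π i α z)`, that is, `q ^ α`. -/
def qPow (α : ℝ) (z : ℍ) : ℂ := Complex.exp (2 * Real.pi * Complex.I * α * z)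

lemma qPow_add (α β : ℝ) (z : ℍ) : qPow (α + β) z = qPow α z * qPow β z := by
  rw [qPow, qPow, qPow, ← Complex.exp_add]
  push_cast
  ring_nf

@[simp] lemma qPow_zero (z : ℍ) : qPow 0 z = 1 := by simp [qPow]

lemma qPow_ne_zero (α : ℝ) (z : ℍ) : qPow α z ≠ 0 := Complex.exp_ne_zero _

lemma qPow_neg (α : ℝ) (z : ℍ) : qPow (-α) z = (qPow α z)⁻¹ := by
  rw [← one_div, eq_div_iff (qPow_ne_zero _ _), ← qPow_add, neg_add_cancel, qPow_zero]

lemma qPow_nsmul (α : ℝ) (n : ℕ) (z : ℍ) : qPow (n * α) z = qPow α z ^ n := by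
  rw [qPow, qPow, ← Complex.exp_nat_mul]
  push_cast
  ring_nf

lemma qPow_div_eq_qParam_zpow {h : ℝ} (n : ℤ) (z : ℍ) :
    qPow (n / h) z = Function.Periodic.qParam h z ^ n := by
  rw [qPow, Function.Periodic.qParam, ← Complex.exp_int_mul]
  push_cast
  ring_nf

lemma qParam_add_period {h : ℝ} (hh : h ≠ 0) (x : ℂ) :
    Function.Periodic.qParam h (x + h) = Function.Periodic.qParam h x := by
  have hh' : (h : ℂ) ≠ 0 := Complex.ofReal_ne_zero.2 hh
  rw [Function.Periodic.qParam, Function.Periodic.qParam, mul_add, add_div,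
    mul_div_cancel_right₀ _ hh', Complex.exp_periodic]

lemma mdifferentiable_qPow (α : ℝ) : MDiff (qPow α) := by
  rw [UpperHalfPlane.mdifferentiable_iff]
  have h : DifferentiableOn ℂ (fun z : ℂ => Complex.exp (2 * Real.pi * Complex.I * α * z))
      {z | 0 < z.im} := by fun_prop
  refine h.congr fun z hz => ?_
  simp [qPow, ofComplex_apply_of_im_pos hz]

lemma tendsto_qPow_atImInfty {α : ℝ} (hα : 0 < α) :
    Tendsto (qPow α) atImInfty (nhds 0) := by
  have h := qParam_tendsto_atImInfty (inv_pos.2 hα)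
  refine h.congr fun z => ?_
  have := qPow_div_eq_qParam_zpow (h := α⁻¹) 1 z
  simpa using this.symm

/-- `f` has leading term `c q ^ α` at `i ∞`; the coefficient `c` may be zero. -/
def HasLeading (f : ℍ → ℂ) (α : ℝ) (c : ℂ) : Prop :=
  Tendsto (fun z => f z * qPow (-α) z) atImInfty (nhds c)

lemma hasLeading_zero_iff {f : ℍ → ℂ} {c : ℂ} :
    HasLeading f 0 c ↔ Tendsto f atImInfty (nhds c) := by
  simp [HasLeading]

lemma hasLeading_const (c : ℂ) : HasLeading (fun _ => c) 0 c :=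
  hasLeading_zero_iff.2 tendsto_const_nhds

namespace HasLeading

variable {f g : ℍ → ℂ} {α β : ℝ} {c d : ℂ}

lemma mul (hf : HasLeading f α c) (hg : HasLeading g β d) :
    HasLeading (fun z => f z * g z) (α + β) (c * d) :=
  (Tendsto.mul hf hg).congr fun z => by rw [neg_add, qPow_add]; ring

lemma pow (hf : HasLeading f α c) (n : ℕ) : HasLeading (fun z => f z ^ n) (n * α) (c ^ n) :=
  (Tendsto.pow hf n).congr fun z => by rw [mul_pow, ← qPow_nsmul]; ring_nf

lemma inv (hf : HasLeading f α c) (hc : c ≠ 0) : HasLeading (fun z => (f z)⁻¹) (-α) c⁻¹ :=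
  (Tendsto.inv₀ hf hc).congr fun z => by rw [mul_inv, qPow_neg, qPow_neg, qPow_neg]

lemma add (hf : HasLeading f α c) (hg : HasLeading g α d) :
    HasLeading (fun z => f z + g z) α (c + d) :=
  (Tendsto.add hf hg).congr fun z => by ring

lemma of_lt (hf : HasLeading f α c) (h : β < α) : HasLeading f β 0 := by
  have := Tendsto.mul hf (tendsto_qPow_atImInfty (sub_pos.2 h))
  rw [mul_zero] at this
  refine this.congr fun z => ?_
  rw [mul_assoc, ← qPow_add]
  ring_nf

lemma unique (hf : HasLeading f α c) (hg : HasLeading f β d) (hc : c ≠ 0) (hd : d ≠ 0) :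
    α = β := by
  rcases lt_trichotomy α β with h | h | h
  · exact absurd (tendsto_nhds_unique hf (hg.of_lt h)) hc
  · exact h
  · exact absurd (tendsto_nhds_unique hg (hf.of_lt h)) hd

lemma smul_const (hf : HasLeading f α c) (a : ℂ) : HasLeading (fun z => a * f z) α (a * c) := by
  simpa using (hasLeading_const a).mul hf

end HasLeading

/-- The order of a function at a cusp is read off from its leading term. -/
lemma meromorphicOrderAt_cuspFunction {f : ℍ → ℂ} {h : ℝ} (hh : 0 < h)
    (hper : Function.Periodic (f ∘ ofComplex) h) (hf : MDiff f) {n : ℤ} {c : ℂ} (hc : c ≠ 0)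
    (hl : HasLeading f (n / h) c) : meromorphicOrderAt (cuspFunction h f) 0 = n := by
  set g : ℍ → ℂ := fun z => f z * qPow (-(n / h)) z with hg
  have hq (z : ℍ) : qPow (-(n / h)) z = Function.Periodic.qParam h z ^ (-n) := by
    rw [← qPow_div_eq_qParam_zpow]
    push_cast
    ring_nf
  have hgd : MDiff g := hf.mul (mdifferentiable_qPow _)
  have hgper : Function.Periodic (g ∘ ofComplex) h := by
    intro x
    have h1 := hper x
    simp only [Function.comp_apply] at h1
    simp only [Function.comp_apply, hg, hq, h1]
    rcases le_or_gt x.im 0 with hx | hx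
    · rw [ofComplex_apply_of_im_nonpos hx, ofComplex_apply_of_im_nonpos (by simpa using hx)]
    · rw [ofComplex_apply_of_im_pos hx, ofComplex_apply_of_im_pos (by simpa using hx),
        coe_mk, coe_mk, qParam_add_period hh.ne']
  have hgb : IsBoundedAtImInfty g := Tendsto.isBigO_one ℝ hl
  have hga : AnalyticAt ℂ (cuspFunction h g) 0 := analyticAt_cuspFunction_zero hh hgper hgd hgb
  have hg0 : cuspFunction h g 0 = c := by
    rw [cuspFunction_apply_zero hh hga hgper]
    exact Tendsto.limUnder_eq hl
  have key : ∀ᶠ q in nhdsWithin (0 : ℂ) {0}ᶜ,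
      cuspFunction h f q = (q - 0) ^ n • cuspFunction h g q := by
    have hlt : ∀ᶠ q in nhdsWithin (0 : ℂ) {0}ᶜ, ‖q‖ < 1 := by
      refine mem_nhdsWithin_of_mem_nhds ?_
      simpa [Metric.ball, dist_zero_right] using Metric.ball_mem_nhds (0 : ℂ) one_pos
    filter_upwards [cuspFunction_eventuallyEq h f, cuspFunction_eventuallyEq h g, hlt,
      self_mem_nhdsWithin] with q h1 h2 h3 h4
    have him := Function.Periodic.im_invQParam_pos_of_norm_lt_one hh h3 h4
    rw [h1, h2, hg]
    simp only [sub_zero, smul_eq_mul]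
    rw [hq, ofComplex_apply_of_im_pos him]
    rw [Function.Periodic.qParam_right_inv hh.ne' h4, mul_left_comm, ← zpow_add₀ h4]
    simp
  have hm : MeromorphicAt (cuspFunction h f) 0 := by
    refine MeromorphicAt.congr ?_ (key.mono fun _ h => h.symm)
    fun_prop
  exact (meromorphicOrderAt_eq_int_iff hm).2 ⟨_, hga, hg0 ▸ hc, key⟩

lemma poleOrderAt_cuspFunction {f : ℍ → ℂ} {h : ℝ} (hh : 0 < h)
    (hper : Function.Periodic (f ∘ ofComplex) h) (hf : MDiff f) {n : ℕ} {c : ℂ} (hc : c ≠ 0)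
    (hl : HasLeading f (-(n / h)) c) : poleOrderAt (cuspFunction h f) 0 = n := by
  rw [poleOrderAt, meromorphicOrderAt_cuspFunction (n := -n) hh hper hf hc]
  · simp
  · convert hl using 1
    push_cast
    ring

/-! ### Leading terms of `j` and of the translates of `Δ(N·)/Δ` -/

lemma hasLeading_delta : HasLeading delta 1 1 := by
  refine ModularForm.tendsto_atImInfty_tprod_one_sub_eta_q_pow.congr fun z => ?_
  have h := qPow_div_eq_qParam_zpow (h := 1) 1 z
  rw [delta, ModularForm.discriminant_eq_q_prod, qPow_neg, mul_comm, ← mul_assoc]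
  simp at h
  rw [← h, inv_mul_cancel₀ (qPow_ne_zero _ _), one_mul]

lemma hasLeading_eisCube : HasLeading eisCube 0 1 := by
  have ha := ModularFormClass.analyticAt_cuspFunction_zero eisCubeForm one_pos
    one_mem_strictPeriods_SL
  have hp := SlashInvariantFormClass.periodic_comp_ofComplex eisCubeForm one_mem_strictPeriods_SL
  have h4 := EisensteinSeries.E_qExpansion_coeff_zero (by norm_num : 3 ≤ 4) ⟨2, rfl⟩
  have h0 : cuspFunction 1 eisCubeForm 0 = 1 := by
    rw [cuspFunction_apply_zero one_pos ha hp, ← qExpansion_coeff_zero one_pos ha hp,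
      eisCubeForm, ModularForm.coe_mcast, ModularForm.qExpansion_pow one_pos
        one_mem_strictPeriods_SL]
    simp only [PowerSeries.coeff_zero_eq_constantCoeff, map_pow] at h4 ⊢
    rw [h4, one_pow]
  rw [hasLeading_zero_iff, ← coe_eisCubeForm, ← h0]
  refine (ha.continuousAt.tendsto.comp (qParam_tendsto_atImInfty one_pos)).congr fun z => ?_
  exact eq_cuspFunction z one_ne_zero hp

/-- A function that is invariant under a translation of the upper half-plane is periodic. -/
lemma periodic_comp_ofComplex {f : ℍ → ℂ} (n : ℕ)
    (hf : ∀ z, f (ModularGroup.T ^ n • z) = f z) :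
    Function.Periodic (f ∘ ofComplex) (n : ℝ) := by
  intro x
  simp only [Function.comp_apply]
  rcases le_or_gt x.im 0 with hx | hx
  · rw [ofComplex_apply_of_im_nonpos hx, ofComplex_apply_of_im_nonpos (by simpa using hx)]
  · rw [← hf (ofComplex x), ofComplex_apply_of_im_pos hx,
      ofComplex_apply_of_im_pos (by simpa using hx)]
    congr 1
    ext1
    rw [← zpow_natCast, ModularGroup.coe_T_zpow_smul_eq]
    simp

lemma hasLeading_jFun : HasLeading jFun (-1) 1 := by
  have := hasLeading_eisCube.mul (hasLeading_delta.inv one_ne_zero)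
  rw [zero_add, inv_one, mul_one] at this
  exact this

/-- The point `(a z + b) / d`. -/
def affinePoint (a d : ℕ) [NeZero a] [NeZero d] (b : ℤ) (z : ℍ) : ℍ :=
  ⟨(a * z + b) / d, by
    have ha : (0 : ℝ) < a := Nat.cast_pos.mpr (NeZero.pos a)
    have hd : (0 : ℝ) < d := Nat.cast_pos.mpr (NeZero.pos d)
    have : ((a * z + b : ℂ) / d).im = a * z.im / d := by
      rw [Complex.div_natCast_im]; simp
    rw [this]
    positivity⟩

lemma hasLeading_delta_affinePoint (a d : ℕ) [NeZero a] [NeZero d] (b : ℤ) :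
    ∃ c ≠ 0, HasLeading (fun z => delta (affinePoint a d b z)) (a / d) c := by
  have ha : (0 : ℝ) < a := Nat.cast_pos.mpr (NeZero.pos a)
  have hd : (0 : ℝ) < d := Nat.cast_pos.mpr (NeZero.pos d)
  refine ⟨Complex.exp (2 * Real.pi * Complex.I * (b / d)), Complex.exp_ne_zero _, ?_⟩
  have him (z : ℍ) : (affinePoint a d b z).im = a / d * z.im := by
    change ((a * z + b : ℂ) / d).im = _
    rw [Complex.div_natCast_im]; simp; ring
  have ht : Tendsto (affinePoint a d b) atImInfty atImInfty := by
    rw [atImInfty, tendsto_comap_iff]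
    have : Tendsto (fun z : ℍ => a / d * z.im) (comap im atTop) atTop :=
      Tendsto.const_mul_atTop (by positivity) tendsto_comap
    exact this.congr fun z => (him z).symm
  have h := (Tendsto.comp hasLeading_delta ht).const_mul
    (Complex.exp (2 * Real.pi * Complex.I * (b / d)))
  rw [mul_one] at h
  refine h.congr fun z => ?_
  have hd' : (d : ℂ) ≠ 0 := NeZero.ne _
  have : qPow (-1) (affinePoint a d b z) =
      (Complex.exp (2 * Real.pi * Complex.I * (b / d)))⁻¹ * qPow (-(a / d)) z := by
    rw [qPow, qPow, ← Complex.exp_neg, ← Complex.exp_add]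
    congr 1
    simp only [affinePoint, coe_mk]
    push_cast
    field_simp
    ring
  simp only [Function.comp_apply]
  rw [this]
  field_simp [Complex.exp_ne_zero]

/-- The translates of `Δ(N z) / Δ(z)` are the functions `d⁻¹² Δ((a z + b) / d) / Δ(z)`, where
`a d = N`. -/
lemma exists_tFun_smul_eq (N : ℕ) [NeZero N] (γ : SL(2, ℤ)) :
    ∃ (a d : ℕ) (_ : NeZero a) (_ : NeZero d) (b : ℤ), a * d = N ∧ a = Int.gcd (γ 1 0) N ∧
      ∀ z : ℍ, tFun N (γ • z) = ((d : ℂ) ^ 12)⁻¹ * (delta (affinePoint a d b z) / delta z) := by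
  have hN : N ≠ 0 := NeZero.ne N
  set a := Int.gcd (γ 1 0) N with ha
  have ha0 : a ≠ 0 := by simp [ha, Int.gcd_eq_zero_iff, hN]
  obtain ⟨d, hd⟩ : a ∣ N := by
    have := Int.gcd_dvd_right (γ 1 0) N
    exact_mod_cast this
  obtain ⟨c', hc'⟩ : (a : ℤ) ∣ γ 1 0 := Int.gcd_dvd_left _ _
  have hd0 : d ≠ 0 := by rintro rfl; simp at hd; exact hN hd
  have haz : (a : ℤ) ≠ 0 := by exact_mod_cast ha0
  have hdN : (N : ℤ) = a * d := by exact_mod_cast hd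
  have hcop : IsCoprime (γ 0 0 * d) c' := by
    have h1 : IsCoprime (γ 0 0) c' := by
      have := isCoprime_col γ
      rw [hc'] at this
      exact this.of_mul_right_right
    have h2 : IsCoprime (d : ℤ) c' := by
      obtain ⟨x, y, hxy⟩ : ∃ x y, (a : ℤ) = x * γ 1 0 + y * N := by
        have := Int.gcd_eq_gcd_ab (γ 1 0) N
        exact ⟨(γ 1 0).gcdA N, (γ 1 0).gcdB N, by rw [ha, this]; ring⟩
      refine ⟨y, x, mul_left_cancel₀ haz ?_⟩
      rw [hc', hdN] at hxy
      linear_combination -hxy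
    exact h1.mul_left h2
  -- The factorization `diag(N, 1) γ = γ' (a, b; 0, d)` determines the first column of `γ'`.
  obtain ⟨γ', h0, h1⟩ := hcop.exists_SL2_col 0
  have hdet := γ.det_coe
  have hdet' := γ'.det_coe
  rw [Matrix.det_fin_two] at hdet hdet'
  rw [hc'] at hdet
  rw [h0, h1] at hdet'
  set b : ℤ := γ' 1 1 * N * γ 0 1 - γ' 0 1 * γ 1 1 with hb
  have e1 : γ 0 0 * d * b + γ' 0 1 * d = N * γ 0 1 := by
    rw [hb]
    linear_combination (N * γ 0 1) * hdet' - γ' 0 1 * d * hdet + γ' 0 1 * c' * γ 0 1 * hdN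
  have e2 : c' * b + γ' 1 1 * d = γ 1 1 := by
    rw [hb]
    linear_combination γ 1 1 * hdet' - γ' 1 1 * d * hdet + γ' 1 1 * c' * γ 0 1 * hdN
  have : NeZero a := ⟨ha0⟩
  have : NeZero d := ⟨hd0⟩
  refine ⟨a, d, ‹_›, ‹_›, b, hd.symm, rfl, fun z => ?_⟩
  set w := affinePoint a d b z with hw
  have hdC : (d : ℂ) ≠ 0 := NeZero.ne _
  have hwz : (w : ℂ) * d = a * z + b := by
    rw [hw]
    simp only [affinePoint, coe_mk]
    field_simp
  have e1C := congrArg (Int.cast : ℤ → ℂ) e1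
  have e2C := congrArg (Int.cast : ℤ → ℂ) e2
  have hNC := congrArg (Int.cast : ℤ → ℂ) hdN
  have hcC := congrArg (Int.cast : ℤ → ℂ) hc'
  push_cast at e1C e2C hNC hcC
  have hden : denom γ' w * d = denom γ z := by
    rw [ModularGroup.denom_apply, ModularGroup.denom_apply, h1, hcC]
    linear_combination (c' : ℂ) * hwz + e2C
  have hsc : scale N (γ • z) = γ' • w := by
    have hne := denom_ne_zero (γ : GL (Fin 2) ℝ) z
    have hne' := denom_ne_zero (γ' : GL (Fin 2) ℝ) w
    rw [ModularGroup.denom_apply] at hne hne'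
    rw [ModularGroup.denom_apply, ModularGroup.denom_apply] at hden
    ext1
    rw [coe_specialLinearGroup_apply]
    simp only [scale, coe_mk]
    rw [coe_specialLinearGroup_apply]
    simp only [algebraMap_int_eq, eq_intCast, Complex.ofReal_intCast]
    rw [← mul_div_assoc, div_eq_div_iff hne hne', ← hden, h0]
    push_cast
    have : (N : ℂ) * (γ 0 0 * z + γ 0 1) = (γ 0 0 * d * w + γ' 0 1) * d := by
      linear_combination (γ 0 0 : ℂ) * z * hNC - (γ 0 0 * d : ℂ) * hwz - e1C
    rw [this]
    ring
  rw [tFun, deltaN, ← delta, hsc, delta_smul, delta_smul, ← hden]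
  have hne' := denom_ne_zero (γ' : GL (Fin 2) ℝ) w
  field_simp [delta_ne_zero z]

/-- With `a d = N`, the exponent is `a / d - 1 = a ^ 2 / N - 1`. -/
lemma hasLeading_tFun_smul (N : ℕ) [NeZero N] (γ : SL(2, ℤ)) :
    ∃ c ≠ 0, HasLeading (fun z => tFun N (γ • z)) ((Int.gcd (γ 1 0) N : ℝ) ^ 2 / N - 1) c := by
  obtain ⟨a, d, _, _, b, had, ha, h⟩ := exists_tFun_smul_eq N γ
  obtain ⟨c, hc, hl⟩ := hasLeading_delta_affinePoint a d b
  have hd : (d : ℂ) ≠ 0 := NeZero.ne _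
  have hd' : (d : ℝ) ≠ 0 := NeZero.ne _
  have ha' : (a : ℝ) ≠ 0 := NeZero.ne _
  refine ⟨((d : ℂ) ^ 12)⁻¹ * (c * 1⁻¹), by simp [hc, hd], ?_⟩
  have := (hl.mul (hasLeading_delta.inv one_ne_zero)).smul_const ((d : ℂ) ^ 12)⁻¹
  convert this using 1
  · funext z
    rw [h, div_eq_mul_inv]
  · rw [← ha, ← had]
    push_cast
    field_simp
    ring

/-! ### Modular functions of level one -/

lemma mdifferentiable_jFun : MDiff jFun := by
  have h1 : MDiff eisCube := coe_eisCubeForm ▸ ModularFormClass.holo eisCubeForm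
  have h2 : MDiff delta := ModularFormClass.holo CuspForm.discriminant
  exact h1.div h2 delta_ne_zero

lemma jFun_smul (γ : SL(2, ℤ)) (z : ℍ) : jFun (γ • z) = jFun z := by
  have := denom_ne_zero (γ : GL (Fin 2) ℝ) z
  rw [jFun, jFun, eisCube_smul, delta_smul, mul_div_mul_left _ _ (pow_ne_zero _ this)]

/-- A holomorphic function of level one that is bounded at the cusp is a modular form of weight
zero, hence constant. -/
lemma exists_eq_const_of_invariant {g : ℍ → ℂ} (hg : MDiff g)
    (hinv : ∀ (γ : SL(2, ℤ)) (z : ℍ), g (γ • z) = g z) (hb : IsBoundedAtImInfty g) :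
    ∃ c, ∀ z, g z = c := by
  have hs (γ : SL(2, ℤ)) : g ∣[(0 : ℤ)] γ = g := by
    funext z
    rw [ModularForm.SL_slash_apply, neg_zero, zpow_zero, mul_one, hinv]
  let f : ModularForm 𝒮ℒ 0 :=
    { toFun := g
      slash_action_eq' := fun _ ⟨γ, hγ⟩ => hγ ▸ hs γ
      holo' := hg
      bdd_at_cusps' := fun {c} hc => by
        rw [OnePoint.isBoundedAt_iff_forall_SL2Z hc]
        intro γ _
        rwa [hs] }
  obtain ⟨c, hc⟩ := ModularFormClass.levelOne_weight_zero_const f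
  exact ⟨c, fun z => congrFun hc z⟩

lemma exists_tendsto_of_isBoundedAtImInfty {h : ℝ} (hh : 0 < h) {f : ℍ → ℂ}
    (hper : Function.Periodic (f ∘ ofComplex) h) (hf : MDiff f) (hb : IsBoundedAtImInfty f) :
    ∃ c, Tendsto f atImInfty (nhds c) := by
  have ha := analyticAt_cuspFunction_zero hh hper hf hb
  refine ⟨_, (ha.continuousAt.tendsto.comp (qParam_tendsto_atImInfty hh)).congr fun z => ?_⟩
  exact eq_cuspFunction z hh.ne' hper

lemma periodic_mul_qPow {f : ℍ → ℂ} (hper : Function.Periodic (f ∘ ofComplex) (1 : ℝ)) (m : ℤ) :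
    Function.Periodic ((fun z => f z * qPow m z) ∘ ofComplex) (1 : ℝ) := by
  intro x
  have h1 := hper x
  have hq (z : ℍ) : qPow m z = Function.Periodic.qParam 1 z ^ m := by
    rw [← qPow_div_eq_qParam_zpow, div_one]
  simp only [Function.comp_apply] at h1
  simp only [Function.comp_apply, hq, h1]
  rcases le_or_gt x.im 0 with hx | hx
  · rw [ofComplex_apply_of_im_nonpos hx, ofComplex_apply_of_im_nonpos (by simpa using hx)]
  · rw [ofComplex_apply_of_im_pos hx, ofComplex_apply_of_im_pos (by simpa using hx),
      coe_mk, coe_mk, qParam_add_period one_ne_zero]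

lemma periodic_one_of_invariant {g : ℍ → ℂ}
    (hinv : ∀ (γ : SL(2, ℤ)) (z : ℍ), g (γ • z) = g z) :
    Function.Periodic (g ∘ ofComplex) (1 : ℝ) := by
  have := periodic_comp_ofComplex (f := g) 1 fun z => hinv _ z
  simpa using this

lemma norm_qPow (α : ℝ) (z : ℍ) : ‖qPow α z‖ = Real.exp (-2 * Real.pi * α * z.im) := by
  rw [qPow, Complex.norm_exp]
  simp

/-- A holomorphic function of period one that is `o(q⁻¹ ^ (m + 1))` has a term in `q ^ (-m)`. -/
lemma exists_hasLeading_of_hasLeading_succ {g : ℍ → ℂ} (hg : MDiff g)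
    (hper : Function.Periodic (g ∘ ofComplex) (1 : ℝ)) {m : ℕ}
    (hl : HasLeading g (-(m + 1 : ℕ)) 0) : ∃ c, HasLeading g (-m) c := by
  have hper1 := periodic_mul_qPow hper (m + 1 : ℕ)
  have hper2 := periodic_mul_qPow hper m
  have hd (n : ℤ) : MDiff fun z => g z * qPow n z := hg.mul (mdifferentiable_qPow _)
  have hz : IsZeroAtImInfty fun z => g z * qPow (m + 1 : ℕ) z := by
    have := hl
    rw [HasLeading, neg_neg] at this
    exact this
  have h1 := hz.exp_decay_atImInfty one_pos (by simpa using hper1)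
    (by exact_mod_cast hd (m + 1 : ℕ)) hz.isBoundedAtImInfty
  have hb : IsBoundedAtImInfty fun z => g z * qPow m z := by
    refine ((h1.mul (Asymptotics.isBigO_refl (qPow (-1)) atImInfty).norm_right).congr_left
      fun z => ?_).trans ?_
    · rw [mul_assoc, ← qPow_add]
      push_cast
      ring_nf
    · refine Asymptotics.IsBigO.of_bound 1 (Eventually.of_forall fun z => ?_)
      rw [norm_qPow, ← Real.exp_add]
      simp
  obtain ⟨c, hc⟩ := exists_tendsto_of_isBoundedAtImInfty one_pos (by simpa using hper2)
    (by exact_mod_cast hd m) hb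
  exact ⟨c, by simpa [HasLeading] using hc⟩

/-- A holomorphic function of level one with a pole of order less than `m` at `i ∞` is a
polynomial in `j` of degree less than `m`. -/
lemma exists_polynomial_of_invariant (m : ℕ) {g : ℍ → ℂ} (hg : MDiff g)
    (hinv : ∀ (γ : SL(2, ℤ)) (z : ℍ), g (γ • z) = g z) (hl : HasLeading g (-m) 0) :
    ∃ A : Polynomial ℂ, A.degree < m ∧ ∀ z, g z = A.eval (jFun z) := by
  induction m generalizing g with
  | zero =>
    rw [Nat.cast_zero, neg_zero, hasLeading_zero_iff] at hl
    obtain ⟨c, hc⟩ := exists_eq_const_of_invariant hg hinv (Tendsto.isBigO_one ℝ hl)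
    have : c = 0 := tendsto_nhds_unique (tendsto_const_nhds.congr fun z => (hc z).symm) hl
    exact ⟨0, by simp, by simp [hc, this]⟩
  | succ m ih =>
    obtain ⟨c, hc⟩ := exists_hasLeading_of_hasLeading_succ hg (periodic_one_of_invariant hinv) hl
    have hj : MDiff fun z => jFun z ^ m := mdifferentiable_jFun.pow m
    have hj1 : HasLeading (fun z => jFun z ^ m) (-m) 1 := by
      simpa using hasLeading_jFun.pow m
    have h1 : HasLeading (fun z => g z + -c * jFun z ^ m) (-m) 0 := by
      have := hc.add (hj1.smul_const (-c))
      simpa using this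
    obtain ⟨A, hA, hA'⟩ := ih (hg.add (hj.const_smul (-c))) (fun γ z => by
      change g (γ • z) + -c * jFun (γ • z) ^ m = g z + -c * jFun z ^ m
      rw [hinv, jFun_smul]) h1
    refine ⟨A + Polynomial.C c * Polynomial.X ^ m, ?_, fun z => ?_⟩
    · refine (Polynomial.degree_add_le _ _).trans_lt (max_lt (hA.trans ?_) ?_)
      · exact_mod_cast Nat.lt_succ_self m
      · exact (Polynomial.degree_C_mul_X_pow_le m c).trans_lt (by exact_mod_cast Nat.lt_succ_self m)
    · have : g z + -c * jFun z ^ m = A.eval (jFun z) := hA' z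
      simp only [Polynomial.eval_add, Polynomial.eval_mul, Polynomial.eval_C, Polynomial.eval_pow,
        Polynomial.eval_X, ← this]
      ring

theorem jFun_surjective : Function.Surjective jFun := by
  intro c
  by_contra! h
  have h0 (z : ℍ) : jFun z + -c ≠ 0 := fun h' => h z (by linear_combination h')
  have hd : MDiff fun z => (jFun z + -c) := mdifferentiable_jFun.add mdifferentiable_const
  have hd' : MDiff fun z => (jFun z + -c)⁻¹ := hd.inv h0
  have hl : HasLeading (fun z => (jFun z + -c)⁻¹) 0 0 := by
    have := hasLeading_jFun.add ((hasLeading_const (-c)).of_lt (β := -1) (by norm_num))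
    rw [add_zero] at this
    exact (this.inv one_ne_zero).of_lt (by norm_num)
  -- `1 / (j - c)` is holomorphic of level one and tends to zero at the cusp, hence is zero.
  obtain ⟨k, hk⟩ := exists_eq_const_of_invariant hd' (fun γ z => by rw [jFun_smul])
    (Tendsto.isBigO_one ℝ (hasLeading_zero_iff.1 hl))
  have : k = 0 := tendsto_nhds_unique (tendsto_const_nhds.congr fun z => (hk z).symm)
    (hasLeading_zero_iff.1 hl)
  exact inv_ne_zero (h0 I) (by rw [hk, this])

/-! ### Meromorphic functions of level one -/

lemma T_pow_mem_Gamma0 (N n : ℕ) : ModularGroup.T ^ n ∈ Gamma0 N := by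
  rw [mem_Gamma0_iff_dvd, ← zpow_natCast, ModularGroup.coe_T_zpow]
  simp

lemma analyticAt_jFun (z : ℍ) : AnalyticAt ℂ (jFun ∘ ofComplex) z :=
  (UpperHalfPlane.mdifferentiable_iff.mp mdifferentiable_jFun).analyticOnNhd
    isOpen_upperHalfPlaneSet _ z.2

lemma mdifferentiable_polynomial_comp (B : Polynomial ℂ) {f : ℍ → ℂ} (hf : MDiff f) :
    MDiff fun z => B.eval (f z) := by
  rw [UpperHalfPlane.mdifferentiable_iff] at hf ⊢
  exact B.differentiable.comp_differentiableOn hf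

lemma IsModularFunction.polynomial_comp {N : ℕ} {f : ℍ → ℂ} (hf : IsModularFunction N f)
    (B : Polynomial ℂ) : IsModularFunction N fun z => B.eval (f z) := by
  induction B using Polynomial.induction_on' with
  | add p q hp hq => simpa [Pi.add_def] using hp.add hq
  | monomial n a =>
    have hpow : IsModularFunction N fun z => f z ^ n := by
      induction n with
      | zero => simpa using IsModularFunction.const N 1
      | succ n ih => simpa [Pi.mul_def, pow_succ] using ih.mul hf
    simpa [Pi.mul_def] using (IsModularFunction.const N a).mul hpow

namespace IsModularFunction

variable {N : ℕ} {g : ℍ → ℂ}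

lemma periodic (hg : IsModularFunction N g) : Function.Periodic (g ∘ ofComplex) (N : ℝ) :=
  periodic_comp_ofComplex N fun z => hg.invariant _ (T_pow_mem_Gamma0 N N) z

lemma meromorphicAt_cuspFunction (hg : IsModularFunction N g) :
    MeromorphicAt (cuspFunction N g) 0 := by
  simpa using hg.meromorphic_cusp 1

/-- A modular function has no poles near the cusp `∞`. -/
lemma exists_analyticAt_of_lt_im [NeZero N] (hg : IsModularFunction N g) :
    ∃ Y : ℝ, ∀ z : ℍ, Y < z.im → AnalyticAt ℂ (g ∘ ofComplex) z := by
  have hN : (0 : ℝ) < N := Nat.cast_pos.mpr (NeZero.pos N)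
  have h := (Function.Periodic.qParam_tendsto hN).eventually
    hg.meromorphicAt_cuspFunction.eventually_analyticAt
  rw [eventually_comap] at h
  obtain ⟨Y, hY⟩ := eventually_atTop.1 h
  refine ⟨Y, fun z hz => ?_⟩
  have h1 : g ∘ ofComplex = cuspFunction N g ∘ Function.Periodic.qParam N := by
    funext x
    exact (Function.Periodic.eq_cuspFunction hN.ne' hg.periodic x).symm
  rw [h1]
  exact (hY _ hz.le z rfl).comp (Function.Periodic.differentiable_qParam.analyticAt _)

/-- A modular function has moderate growth at the cusp `∞`. -/
lemma exists_hasLeading_zero [NeZero N] (hg : IsModularFunction N g) :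
    ∃ m : ℕ, HasLeading g (-m) 0 := by
  have hN : (0 : ℝ) < N := Nat.cast_pos.mpr (NeZero.pos N)
  have hC := hg.meromorphicAt_cuspFunction
  obtain ⟨m, hm⟩ : ∃ m : ℕ, 0 < meromorphicOrderAt (fun q => q ^ m * cuspFunction N g q) 0 := by
    have hid (m : ℕ) : meromorphicOrderAt (fun q : ℂ => q ^ m) 0 = m := by
      simpa [Pi.pow_def] using meromorphicOrderAt_pow_id_sub_const (x := (0 : ℂ)) (n := m)
    cases h : meromorphicOrderAt (cuspFunction N g) 0 with
    | top =>
      refine ⟨0, ?_⟩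
      simp [h]
    | coe k =>
      refine ⟨(1 - k).toNat, ?_⟩
      have := meromorphicOrderAt_mul (f := fun q : ℂ => q ^ (1 - k).toNat) (x := 0)
        (by fun_prop) hC
      rw [hid, h] at this
      refine lt_of_lt_of_eq ?_ this.symm
      have h2 : (0 : ℤ) < (((1 - k).toNat : ℕ) : ℤ) + k := by
        have := Int.self_le_toNat (1 - k)
        linarith
      exact_mod_cast h2
  have h1 := (tendsto_zero_of_meromorphicOrderAt_pos hm).comp
    ((Function.Periodic.qParam_tendsto hN).comp tendsto_coe_atImInfty)
  have h2 : HasLeading g (-(m / N)) 0 := by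
    rw [HasLeading, neg_neg]
    refine h1.congr fun z => ?_
    have h3 := eq_cuspFunction z hN.ne' hg.periodic
    have h4 := qPow_div_eq_qParam_zpow (h := N) m z
    simp only [Function.comp_apply]
    rw [h3, mul_comm]
    congr 1
    rw [← zpow_natCast, ← h4, Int.cast_natCast]
  refine ⟨m + 1, h2.of_lt ?_⟩
  have hN1 : (1 : ℝ) ≤ N := by exact_mod_cast NeZero.pos N
  have : (m : ℝ) / N ≤ m := div_le_self (by positivity) hN1
  push_cast
  linarith

end IsModularFunction

/-- Removal of singularities for functions of level one. -/
lemma exists_holomorphic_of_meromorphicOrderAt_nonneg {h : ℍ → ℂ}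
    (hinv : ∀ (γ : SL(2, ℤ)) (z : ℍ), h (γ • z) = h z)
    (hmer : ∀ z : ℍ, MeromorphicAt (h ∘ ofComplex) z)
    (hord : ∀ z : ℍ, 0 ≤ meromorphicOrderAt (h ∘ ofComplex) z) :
    ∃ G : ℍ → ℂ, MDiff G ∧ (∀ (γ : SL(2, ℤ)) (z : ℍ), G (γ • z) = G z) ∧
      (∀ᶠ z in codiscrete ℍ, G z = h z) ∧
      ∀ z : ℍ, AnalyticAt ℂ (h ∘ ofComplex) z → G z = h z := by
  have hM : MeromorphicOn (h ∘ ofComplex) upperHalfPlaneSet := fun z hz => hmer ⟨z, hz⟩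
  set F := toMeromorphicNFOn (h ∘ ofComplex) upperHalfPlaneSet with hF
  have hFa : AnalyticOnNhd ℂ F upperHalfPlaneSet := fun z hz => by
    rw [← (meromorphicNFOn_toMeromorphicNFOn _ _ hz).meromorphicOrderAt_nonneg_iff_analyticAt,
      meromorphicOrderAt_toMeromorphicNFOn hM hz]
    exact hord ⟨z, hz⟩
  have hFh (z : ℍ) : F =ᶠ[nhdsWithin (z : ℂ) {(z : ℂ)}ᶜ] h ∘ ofComplex :=
    hM.toMeromorphicNFOn_eq_self_on_nhdsNE z.2
  have hmap (z : ℍ) : Tendsto ((↑) : ℍ → ℂ) (nhdsWithin z {z}ᶜ) (nhdsWithin (z : ℂ) {(z : ℂ)}ᶜ) :=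
    tendsto_nhdsWithin_iff.2 ⟨(continuous_coe.tendsto z).mono_left nhdsWithin_le_nhds,
      eventually_nhdsWithin_of_forall fun w hw => fun h => hw (UpperHalfPlane.ext h)⟩
  have hFh' (z : ℍ) : ∀ᶠ w : ℍ in nhdsWithin z {z}ᶜ, F w = h w := by
    filter_upwards [(hmap z).eventually (hFh z)] with w hw
    simpa using hw
  have hG : MDiff fun z : ℍ => F z := by
    rw [UpperHalfPlane.mdifferentiable_iff]
    refine hFa.differentiableOn.congr fun z hz => ?_
    simp [ofComplex_apply_of_im_pos hz]
  refine ⟨fun z => F z, hG, fun γ z => ?_, ?_, fun z hz => ?_⟩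
  · have hd : MDiff fun w : ℍ => F (γ • w : ℍ) :=
      hG.comp (mdifferentiable_smul (g := (γ : GL (Fin 2) ℝ)) (by simp))
    have hsub : MDiff ((fun w : ℍ => F (γ • w : ℍ)) - fun w : ℍ => F w) := hd.sub hG
    have hγ : Tendsto (fun w : ℍ => γ • w) (nhdsWithin z {z}ᶜ)
        (nhdsWithin (γ • z) {γ • z}ᶜ) :=
      tendsto_nhdsWithin_iff.2 ⟨((continuous_const_smul (γ : GL (Fin 2) ℝ)).tendsto z).mono_left
        nhdsWithin_le_nhds,
        eventually_nhdsWithin_of_forall fun w hw => fun h => hw (smul_left_cancel γ h)⟩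
    have h0 := eq_zero_of_frequently hsub (τ := z) (Eventually.frequently (by
      filter_upwards [hγ.eventually (hFh' (γ • z)), hFh' z] with w h1 h2
      simp only [Pi.sub_apply]
      rw [h1, h2, hinv, sub_self]))
    exact sub_eq_zero.1 (congrFun h0 z)
  · simp only [codiscrete, Filter.codiscreteWithin, eventually_iSup, Set.mem_univ, true_imp_iff,
      ← Set.compl_eq_univ_sdiff]
    exact hFh'
  · have h1 := ((hFa z z.2).continuousAt.eventuallyEq_nhds_iff_eventuallyEq_nhdsNE
      hz.continuousAt).1 (hFh z)
    simpa using h1.eq_of_nhds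

lemma meromorphicOrderAt_comp_smul_of_invariant {h : ℍ → ℂ}
    (hinv : ∀ (γ : SL(2, ℤ)) (z : ℍ), h (γ • z) = h z) (γ : SL(2, ℤ)) (z : ℍ) :
    meromorphicOrderAt (h ∘ ofComplex) (γ • z : ℍ) = meromorphicOrderAt (h ∘ ofComplex) z := by
  have h1 := meromorphicOrderAt_comp_smul (f := h) (τ := z) (g := (γ : GL (Fin 2) ℝ))
    (by rw [← Matrix.GeneralLinearGroup.val_det_apply]; simp)
  refine h1.symm.trans ?_
  congr 1
  funext x
  exact hinv γ _

/-- Multiplication by a power of `j - j(z)` removes the pole at `z`. -/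
lemma meromorphicOrderAt_mul_sub_pow_nonneg {g : ℍ → ℂ} {z : ℍ}
    (hg : MeromorphicAt (g ∘ ofComplex) z) (R : Polynomial ℂ) :
    0 ≤ meromorphicOrderAt ((fun w => g w * ((Polynomial.X - Polynomial.C (jFun z)) ^
      poleOrderAt (g ∘ ofComplex) z * R).eval (jFun w)) ∘ ofComplex) z := by
  have hj : AnalyticAt ℂ (fun x => jFun (ofComplex x)) z := analyticAt_jFun z
  have hj1 : AnalyticAt ℂ (fun x => jFun (ofComplex x) - jFun z) z := hj.sub analyticAt_const
  have hR : AnalyticAt ℂ (fun x => R.eval (jFun (ofComplex x))) z := by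
    have := hj.aeval_polynomial R
    simpa using this
  set n := poleOrderAt (g ∘ ofComplex) z with hn
  have e : ((fun w => g w * ((Polynomial.X - Polynomial.C (jFun z)) ^ n * R).eval (jFun w)) ∘
      ofComplex) = (g ∘ ofComplex) * (((fun x => jFun (ofComplex x) - jFun z) ^ n) *
        fun x => R.eval (jFun (ofComplex x))) := by
    funext x
    simp
  rw [e, meromorphicOrderAt_mul hg ((hj1.pow n).mul hR).meromorphicAt,
    meromorphicOrderAt_mul (hj1.pow n).meromorphicAt hR.meromorphicAt,
    meromorphicOrderAt_pow hj1.meromorphicAt]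
  have h1 : 0 < meromorphicOrderAt (fun x => jFun (ofComplex x) - jFun z) z := by
    rw [← tendsto_zero_iff_meromorphicOrderAt_pos hj1.meromorphicAt]
    have := hj1.continuousAt.tendsto
    simp only [ofComplex_apply, sub_self] at this
    exact this.mono_left nhdsWithin_le_nhds
  have h2 := hR.meromorphicOrderAt_nonneg
  rw [poleOrderAt] at hn
  generalize meromorphicOrderAt (g ∘ ofComplex) z = a at *
  generalize meromorphicOrderAt (fun x => jFun (ofComplex x) - jFun z) z = b at *
  generalize meromorphicOrderAt (fun x => R.eval (jFun (ofComplex x))) z = c at *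
  cases a with
  | top => simp
  | coe a =>
  cases c with
  | top => simp
  | coe c =>
  cases b with
  | top =>
    rcases Nat.eq_zero_or_pos n with h0 | h0
    · rw [h0] at hn ⊢
      have : 0 ≤ a := by
        have := Int.self_le_toNat (-a)
        simp at hn
        omega
      have h3 : (0 : ℤ) ≤ c := by exact_mod_cast h2
      simp
      exact_mod_cast add_nonneg this h3
    · have : ((n : ℕ) : WithTop ℤ) ≠ 0 := by exact_mod_cast h0.ne'
      simp [WithTop.mul_top this]
  | coe b =>
    have h3 : (0 : ℤ) ≤ c := by exact_mod_cast h2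
    have h4 : (0 : ℤ) < b := by exact_mod_cast h1
    have h5 : -a ≤ n := by
      have := Int.self_le_toNat (-a)
      simp at hn
      omega
    have h6 : (0 : ℤ) ≤ a + (n * b + c) := by nlinarith
    exact_mod_cast h6

/-- A meromorphic modular function of level one is a rational function of `j`. -/
theorem exists_polynomials_of_invariant {N : ℕ} [NeZero N] {g : ℍ → ℂ}
    (hg : IsModularFunction N g) (hinv : ∀ (γ : SL(2, ℤ)) (z : ℍ), g (γ • z) = g z) :
    ∃ A B : Polynomial ℂ, B ≠ 0 ∧
      ∀ᶠ z in codiscrete ℍ, g z * B.eval (jFun z) = A.eval (jFun z) := by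
  obtain ⟨Y, hY⟩ := hg.exists_analyticAt_of_lt_im
  -- The compact set `K` contains all poles of `g` in the fundamental domain; the polynomial `B`
  -- clears them.
  set K : Set ℂ := Set.Icc (-(1 / 2) : ℝ) (1 / 2) ×ℂ Set.Icc (1 / 2 : ℝ) Y with hK
  have hKc : IsCompact K := isCompact_Icc.reProdIm isCompact_Icc
  have hKu (x : ℂ) (hx : x ∈ K) : 0 < x.im := by
    have := hx.2.1
    linarith
  have hgK : MeromorphicOn (g ∘ ofComplex) K := fun x hx => hg.meromorphic ⟨x, hKu x hx⟩
  set D := MeromorphicOn.divisor (g ∘ ofComplex) K with hD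
  have hfin : D.support.Finite := D.finiteSupport hKc
  set B : Polynomial ℂ := ∏ p ∈ hfin.toFinset,
    (Polynomial.X - Polynomial.C (jFun (ofComplex p))) ^ poleOrderAt (g ∘ ofComplex) p with hB
  have hB0 : B ≠ 0 := Finset.prod_ne_zero_iff.2 fun p _ =>
    pow_ne_zero _ (Polynomial.X_sub_C_ne_zero _)
  set h : ℍ → ℂ := fun z => g z * B.eval (jFun z) with hh
  have hmod : IsModularFunction N h := hg.mul ((isModularFunction_jFun N).polynomial_comp B)
  have hhinv (γ : SL(2, ℤ)) (z : ℍ) : h (γ • z) = h z := by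
    simp only [hh]
    rw [hinv, jFun_smul]
  have hBan (z : ℍ) : AnalyticAt ℂ (fun x => B.eval (jFun (ofComplex x))) z := by
    have := (analyticAt_jFun z).aeval_polynomial B
    simpa using this
  have han (z : ℍ) (hz : AnalyticAt ℂ (g ∘ ofComplex) z) : AnalyticAt ℂ (h ∘ ofComplex) z :=
    hz.mul (hBan z)
  have hord (z : ℍ) : 0 ≤ meromorphicOrderAt (h ∘ ofComplex) z := by
    obtain ⟨γ, hγ⟩ := ModularGroup.exists_smul_mem_fd z
    rw [← meromorphicOrderAt_comp_smul_of_invariant hhinv γ]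
    set w := γ • z
    rcases lt_or_ge Y w.im with hw | hw
    · exact (han w (hY w hw)).meromorphicOrderAt_nonneg
    · have hwK : (w : ℂ) ∈ K := by
        have h1 := ModularGroup.three_le_four_mul_im_sq_of_mem_fd hγ
        have h2 := abs_le.1 hγ.2
        exact ⟨⟨h2.1, h2.2⟩, by have := w.im_pos; change 1 / 2 ≤ w.im; nlinarith, hw⟩
      obtain ⟨R, hR⟩ : (Polynomial.X - Polynomial.C (jFun w)) ^ poleOrderAt (g ∘ ofComplex) w ∣
          B := by
        by_cases hw0 : D w = 0
        · have : poleOrderAt (g ∘ ofComplex) w = 0 := by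
            rw [hD, MeromorphicOn.divisor_apply hgK hwK] at hw0
            simp [poleOrderAt, hw0]
          simp [this]
        · have := Finset.dvd_prod_of_mem (fun p => (Polynomial.X -
            Polynomial.C (jFun (ofComplex p))) ^ poleOrderAt (g ∘ ofComplex) p)
            (hfin.mem_toFinset.2 hw0)
          simpa using this
      have := meromorphicOrderAt_mul_sub_pow_nonneg (hg.meromorphic w) R
      rwa [← hR] at this
  obtain ⟨G, hGd, hGinv, hGc, hGa⟩ :=
    exists_holomorphic_of_meromorphicOrderAt_nonneg hhinv hmod.meromorphic hord
  obtain ⟨m, hm⟩ := hmod.exists_hasLeading_zero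
  have hGm : HasLeading G (-m) 0 := by
    refine Tendsto.congr' ?_ hm
    have : ∀ᶠ z : ℍ in atImInfty, Y < z.im := by
      rw [atImInfty, eventually_comap]
      filter_upwards [eventually_gt_atTop Y] with y hy z hz
      rwa [hz]
    filter_upwards [this] with z hz
    rw [hGa z (han z (hY z hz))]
  obtain ⟨A, -, hA⟩ := exists_polynomial_of_invariant m hGd hGinv hGm
  refine ⟨A, B, hB0, hGc.mono fun z hz => ?_⟩
  rw [← hA, hz]

/-! ### Translates of modular functions -/

/-- The translate of `f` by (the inverse of) a representative of a coset in `SL(2, ℤ) / Γ₀(N)`. -/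
def cosetTranslate {N : ℕ} (f : ℍ → ℂ) (c : SL(2, ℤ) ⧸ Gamma0 N) (z : ℍ) : ℂ := f (c.out⁻¹ • z)

lemma cosetTranslate_mk {N : ℕ} {f : ℍ → ℂ} (hf : ∀ γ ∈ Gamma0 N, ∀ z : ℍ, f (γ • z) = f z)
    (g : SL(2, ℤ)) (z : ℍ) :
    cosetTranslate f (g : SL(2, ℤ) ⧸ Gamma0 N) z = f (g⁻¹ • z) := by
  obtain ⟨h, hh⟩ := QuotientGroup.mk_out_eq_mul (Gamma0 N) g
  rw [cosetTranslate, hh, mul_inv_rev, mul_smul, hf _ (inv_mem h.2)]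

lemma cosetTranslate_smul {N : ℕ} {f : ℍ → ℂ} (hf : ∀ γ ∈ Gamma0 N, ∀ z : ℍ, f (γ • z) = f z)
    (γ : SL(2, ℤ)) (c : SL(2, ℤ) ⧸ Gamma0 N) (z : ℍ) :
    cosetTranslate f c (γ • z) = cosetTranslate f (γ⁻¹ • c) z := by
  induction c using QuotientGroup.induction_on with
  | H g =>
    change _ = cosetTranslate f ((γ⁻¹ * g : SL(2, ℤ)) : SL(2, ℤ) ⧸ Gamma0 N) z
    rw [cosetTranslate_mk hf, cosetTranslate_mk hf, smul_smul, mul_inv_rev, inv_inv]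

lemma cosetTranslate_one {N : ℕ} {f : ℍ → ℂ} (hf : ∀ γ ∈ Gamma0 N, ∀ z : ℍ, f (γ • z) = f z)
    (z : ℍ) : cosetTranslate f ((1 : SL(2, ℤ)) : SL(2, ℤ) ⧸ Gamma0 N) z = f z := by
  rw [cosetTranslate_mk hf, inv_one, one_smul]

lemma tFun_smul {N : ℕ} [NeZero N] (γ : SL(2, ℤ)) (hγ : γ ∈ Gamma0 N) (z : ℍ) :
    tFun N (γ • z) = tFun N z := (isModularFunction_tFun N).invariant γ hγ z

lemma mdifferentiable_comp_smul {f : ℍ → ℂ} (hf : MDiff f) (γ : SL(2, ℤ)) :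
    MDiff fun z => f (γ • z) :=
  hf.comp (mdifferentiable_smul (g := (γ : GL (Fin 2) ℝ)) (by simp))

lemma mdifferentiable_tFun (N : ℕ) [NeZero N] : MDiff (tFun N) := by
  have h1 : MDiff delta := ModularFormClass.holo CuspForm.discriminant
  have h2 : MDiff (deltaN N) := by
    have h3 : deltaN N = delta ∘ fun z => scaleMat N • z := by
      funext z
      simp only [Function.comp_apply, scaleMat_smul]
      rfl
    rw [h3]
    refine h1.comp (mdifferentiable_smul (g := scaleMat N) ?_)
    rw [scaleMat_det]
    exact Nat.cast_pos.mpr (NeZero.pos N)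
  exact h2.div h1 delta_ne_zero

lemma mdifferentiable_cosetTranslate_tFun {N : ℕ} [NeZero N] (c : SL(2, ℤ) ⧸ Gamma0 N) :
    MDiff (cosetTranslate (tFun N) c) :=
  mdifferentiable_comp_smul (mdifferentiable_tFun N) _

lemma natCast_gcd_sq_div_pos {N : ℕ} [NeZero N] (x : ℤ) :
    (0 : ℝ) < (Int.gcd x N : ℝ) ^ 2 / N := by
  have hN : (0 : ℝ) < N := Nat.cast_pos.mpr (NeZero.pos N)
  have h : 0 < Int.gcd x N := Int.gcd_pos_of_ne_zero_right _ (by exact_mod_cast NeZero.ne N)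
  positivity

/-- The translates of `Δ(N·)/Δ` are `o(q⁻¹)`. -/
lemma hasLeading_cosetTranslate_tFun {N : ℕ} [NeZero N] (c : SL(2, ℤ) ⧸ Gamma0 N) :
    HasLeading (cosetTranslate (tFun N) c) (-1) 0 := by
  obtain ⟨a, -, h⟩ := hasLeading_tFun_smul N c.out⁻¹
  exact h.of_lt (by linarith [natCast_gcd_sq_div_pos (N := N) (c.out⁻¹ 1 0)])

/-- The stabilizer of `Δ(N·)/Δ` in `SL(2, ℤ)` is `Γ₀(N)`. -/
lemma mem_Gamma0_of_tFun_smul_eq {N : ℕ} [NeZero N] {γ : SL(2, ℤ)}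
    (h : ∀ z, tFun N (γ • z) = tFun N z) : γ ∈ Gamma0 N := by
  obtain ⟨a, ha, h1⟩ := hasLeading_tFun_smul N γ
  obtain ⟨b, hb, h2⟩ := hasLeading_tFun_smul N 1
  simp only [h] at h1
  simp only [one_smul] at h2
  have h3 := h1.unique h2 ha hb
  have hN : (N : ℝ) ≠ 0 := NeZero.ne _
  have h4 : (Int.gcd (γ 1 0) N : ℝ) ^ 2 = (N : ℝ) ^ 2 := by
    have : Int.gcd ((1 : SL(2, ℤ)) 1 0) N = N := by simp
    rw [this] at h3
    field_simp at h3
    linarith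
  have h5 : Int.gcd (γ 1 0) N = N := by
    have := (pow_left_inj₀ (Nat.cast_nonneg _) (Nat.cast_nonneg _) two_ne_zero).1 h4
    exact_mod_cast this
  rw [mem_Gamma0_iff_dvd, ← h5]
  exact Int.gcd_dvd_left _ _

lemma cosetTranslate_tFun_injective (N : ℕ) [NeZero N] :
    Function.Injective (cosetTranslate (N := N) (tFun N)) := by
  intro c c' h
  induction c using QuotientGroup.induction_on with
  | H g =>
  induction c' using QuotientGroup.induction_on with
  | H g' =>
    rw [QuotientGroup.eq]
    refine mem_Gamma0_of_tFun_smul_eq fun z => ?_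
    have := congrFun h (g' • z)
    rw [cosetTranslate_mk tFun_smul, cosetTranslate_mk tFun_smul, smul_smul, inv_smul_smul] at this
    exact this

lemma eventually_cosetTranslate_injective (N : ℕ) [NeZero N] (z₀ : ℍ) :
    ∀ᶠ z in nhdsWithin z₀ {z₀}ᶜ,
      Function.Injective fun c : SL(2, ℤ) ⧸ Gamma0 N => cosetTranslate (tFun N) c z := by
  have h (c c' : SL(2, ℤ) ⧸ Gamma0 N) : ∀ᶠ z in nhdsWithin z₀ {z₀}ᶜ,
      cosetTranslate (tFun N) c z = cosetTranslate (tFun N) c' z → c = c' := by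
    by_cases hc : c = c'
    · exact Eventually.of_forall fun _ _ => hc
    · by_contra hf
      refine hc (cosetTranslate_tFun_injective N (sub_eq_zero.1 (eq_zero_of_frequently
        ((mdifferentiable_cosetTranslate_tFun c).sub (mdifferentiable_cosetTranslate_tFun c'))
        (τ := z₀) ?_)))
      refine (Filter.not_eventually.1 hf).mono fun z hz => ?_
      push Not at hz
      simpa [sub_eq_zero] using hz.1
  filter_upwards [eventually_all.2 fun c => eventually_all.2 fun c' => h c c'] with z hz c c' hcc
  exact hz c c' hcc

/-! ### The conjugates of `Δ(N·)/Δ` -/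

instance (N : ℕ) [NeZero N] : Fintype (SL(2, ℤ) ⧸ Gamma0 N) := Fintype.ofFinite _

/-- The polynomial whose roots are the values at `z` of the conjugates of `Δ(N·)/Δ`. -/
def conjPoly (N : ℕ) [NeZero N] (z : ℍ) : Polynomial ℂ :=
  ∏ c : SL(2, ℤ) ⧸ Gamma0 N, (Polynomial.X - Polynomial.C (cosetTranslate (tFun N) c z))

lemma card_cosets (N : ℕ) [NeZero N] : Fintype.card (SL(2, ℤ) ⧸ Gamma0 N) = dedekindPsi N := by
  rw [← index_Gamma0 N (NeZero.ne N), Subgroup.index, Nat.card_eq_fintype_card]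

lemma dedekindPsi_pos (N : ℕ) [NeZero N] : 0 < dedekindPsi N := by
  rw [← card_cosets]
  exact Fintype.card_pos

lemma monic_conjPoly (N : ℕ) [NeZero N] (z : ℍ) : (conjPoly N z).Monic :=
  Polynomial.monic_prod_of_monic _ _ fun _ _ => Polynomial.monic_X_sub_C _

lemma natDegree_conjPoly (N : ℕ) [NeZero N] (z : ℍ) : (conjPoly N z).natDegree = dedekindPsi N := by
  rw [conjPoly, Polynomial.natDegree_prod_of_monic _ _ fun _ _ => Polynomial.monic_X_sub_C _]
  simp [← card_cosets]

lemma conjPoly_smul (N : ℕ) [NeZero N] (γ : SL(2, ℤ)) (z : ℍ) :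
    conjPoly N (γ • z) = conjPoly N z := by
  refine Fintype.prod_equiv (MulAction.toPerm γ⁻¹) _ _ fun c => ?_
  rw [cosetTranslate_smul tFun_smul]
  rfl

lemma eval_conjPoly_eq_zero_iff {N : ℕ} [NeZero N] {z : ℍ} {x : ℂ} :
    (conjPoly N z).eval x = 0 ↔ ∃ γ : SL(2, ℤ), x = tFun N (γ • z) := by
  simp only [conjPoly, Polynomial.eval_prod, Finset.prod_eq_zero_iff, Finset.mem_univ, true_and,
    Polynomial.eval_sub, Polynomial.eval_X, Polynomial.eval_C, sub_eq_zero]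
  constructor
  · rintro ⟨c, h⟩
    exact ⟨_, h⟩
  · rintro ⟨γ, h⟩
    exact ⟨(γ⁻¹ : SL(2, ℤ)), by rw [h, cosetTranslate_mk tFun_smul, inv_inv]⟩

lemma eval_tFun_conjPoly (N : ℕ) [NeZero N] (z : ℍ) : (conjPoly N z).eval (tFun N z) = 0 :=
  eval_conjPoly_eq_zero_iff.2 ⟨1, by rw [one_smul]⟩

open Polynomial in
/-- If the `r i` are holomorphic and `o(q⁻¹)`, then the coefficients of `∏ (X - r i)` in
codegree `m > 0` are holomorphic and `o(q ^ (-m))`. -/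
lemma coeff_prod_X_sub_C {ι : Type*} (s : Finset ι) {r : ι → ℍ → ℂ} (hr : ∀ i, MDiff (r i))
    (hl : ∀ i, HasLeading (r i) (-1) 0) (k : ℕ) :
    MDiff (fun z : ℍ => ((∏ i ∈ s, (X - C (r i z))).coeff k : ℂ)) ∧
      (k < s.card →
        HasLeading (fun z => (∏ i ∈ s, (X - C (r i z))).coeff k) (-(s.card - k)) 0) := by
  classical
  induction s using Finset.induction_on generalizing k with
  | empty => simpa using mdifferentiable_const
  | insert i s hi ih =>
    have hmonic (z : ℍ) : (∏ i ∈ s, (X - C (r i z))).coeff s.card = 1 := by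
      have h1 := monic_prod_of_monic s (fun i => X - C (r i z)) fun i _ => monic_X_sub_C _
      have h2 := natDegree_prod_of_monic s (fun i => X - C (r i z)) fun i _ => monic_X_sub_C _
      simp only [natDegree_X_sub_C, Finset.sum_const, smul_eq_mul, mul_one] at h2
      rw [← h2]
      exact h1
    have hmul : k < s.card + 1 → HasLeading
        (fun z => r i z * (∏ i ∈ s, (X - C (r i z))).coeff k) (-(s.card + 1 - k)) 0 := by
      intro hk
      rcases (Nat.lt_succ_iff.1 hk).lt_or_eq with hk | rfl
      · have := (hl i).mul ((ih k).2 hk)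
        rw [mul_zero] at this
        convert this using 1
        ring
      · have := (hl i).mul (hasLeading_const 1)
        simp only [hmonic]
        rw [zero_mul] at this
        convert this using 1
        ring
    simp only [Finset.prod_insert hi, Finset.card_insert_of_notMem hi, sub_mul, coeff_sub,
      coeff_C_mul]
    cases k with
    | zero =>
      simp only [coeff_X_mul_zero, zero_sub]
      refine ⟨((hr i).mul (ih 0).1).neg, fun hk => ?_⟩
      simpa using (hmul hk).smul_const (-1)
    | succ k =>
      simp only [coeff_X_mul]
      refine ⟨(ih k).1.sub ((hr i).mul (ih (k + 1)).1), fun hk => ?_⟩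
      have h1 := (ih k).2 (by omega)
      have h2 := (hmul hk).smul_const (-1)
      push_cast at h2 ⊢
      rw [add_sub_add_right_eq_sub] at h2 ⊢
      simpa [sub_eq_add_neg] using h1.add h2

lemma exists_coeff_conjPoly (N : ℕ) [NeZero N] (k : ℕ) : ∃ A : Polynomial ℂ,
    k < dedekindPsi N → A.degree < (dedekindPsi N - k : ℕ) ∧
      ∀ z, (conjPoly N z).coeff k = A.eval (jFun z) := by
  by_cases hk : k < dedekindPsi N
  · have h := coeff_prod_X_sub_C Finset.univ
      (mdifferentiable_cosetTranslate_tFun (N := N)) hasLeading_cosetTranslate_tFun k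
    rw [Finset.card_univ, card_cosets] at h
    obtain ⟨A, hA, hA'⟩ := exists_polynomial_of_invariant (dedekindPsi N - k)
      (g := fun z => (conjPoly N z).coeff k) h.1
      (fun γ z => by rw [conjPoly_smul]) (by
        rw [Nat.cast_sub hk.le]
        exact h.2 hk)
    exact ⟨A, fun _ => ⟨hA, hA'⟩⟩
  · exact ⟨0, fun h => absurd h hk⟩

/-- The coefficient of `Y ^ k` in the minimal polynomial of `Δ(N·)/Δ`, as a polynomial in `j`. Only
the values for `k < ψ(N)` are meaningful. -/
def coeffPoly (N : ℕ) [NeZero N] (k : ℕ) : Polynomial ℂ := (exists_coeff_conjPoly N k).choose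

lemma degree_coeffPoly_lt {N : ℕ} [NeZero N] {k : ℕ} (hk : k < dedekindPsi N) :
    (coeffPoly N k).degree < (dedekindPsi N - k : ℕ) :=
  ((exists_coeff_conjPoly N k).choose_spec hk).1

lemma coeff_conjPoly {N : ℕ} [NeZero N] {k : ℕ} (hk : k < dedekindPsi N) (z : ℍ) :
    (conjPoly N z).coeff k = (coeffPoly N k).eval (jFun z) :=
  ((exists_coeff_conjPoly N k).choose_spec hk).2 z

lemma conjPoly_eq (N : ℕ) [NeZero N] (z : ℍ) :
    conjPoly N z = Polynomial.X ^ dedekindPsi N + ∑ k ∈ Finset.range (dedekindPsi N),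
      Polynomial.C ((coeffPoly N k).eval (jFun z)) * Polynomial.X ^ k := by
  rw [(monic_conjPoly N z).as_sum, natDegree_conjPoly]
  congr 1
  exact Finset.sum_congr rfl fun k hk => by rw [coeff_conjPoly (Finset.mem_range.1 hk)]

/-! ### Evaluation of functions and their classes in the function field -/

/-- Evaluation of modular functions at a point of the upper half-plane. -/
def evalAt {N : ℕ} (z : ℍ) : modularFunctions N →ₐ[ℂ] ℂ :=
  (Pi.evalAlgHom ℂ (fun _ : ℍ => ℂ) z).comp (modularFunctions N).val

lemma evalAt_apply {N : ℕ} (z : ℍ) (f : modularFunctions N) : evalAt z f = (f : ℍ → ℂ) z := rfl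

/-- The class of a modular function in the function field, as an algebra homomorphism. -/
def classHom (N : ℕ) : modularFunctions N →ₐ[ℂ] FunctionField N :=
  Ideal.Quotient.mkₐ ℂ (nullFunctions N)

/-- `j` as an element of the algebra of modular functions. -/
def jModular (N : ℕ) [NeZero N] : modularFunctions N := ⟨jFun, isModularFunction_jFun N⟩

/-- `Δ(N·)/Δ` as an element of the algebra of modular functions. -/
def tModular (N : ℕ) [NeZero N] : modularFunctions N := ⟨tFun N, isModularFunction_tFun N⟩

lemma classHom_tModular (N : ℕ) [NeZero N] : classHom N (tModular N) = tElt N := rfl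

lemma classHom_eq_toFunctionField {N : ℕ} {f : ℍ → ℂ} (hf : IsModularFunction N f) :
    classHom N ⟨f, hf⟩ = toFunctionField hf := rfl

lemma classHom_eq_iff {N : ℕ} {f g : modularFunctions N} :
    classHom N f = classHom N g ↔ ∀ᶠ z in codiscrete ℍ, (f : ℍ → ℂ) z = (g : ℍ → ℂ) z := by
  refine (Ideal.Quotient.eq (I := nullFunctions N)).trans ?_
  change (∀ᶠ z in codiscrete ℍ, (f : ℍ → ℂ) z - (g : ℍ → ℂ) z = 0) ↔ _
  simp only [sub_eq_zero]

lemma classHom_eq_zero_iff {N : ℕ} {f : modularFunctions N} :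
    classHom N f = 0 ↔ ∀ᶠ z in codiscrete ℍ, (f : ℍ → ℂ) z = 0 := by
  rw [← map_zero (classHom N), classHom_eq_iff]
  rfl

lemma eventually_nhdsNE_of_codiscrete {p : ℍ → Prop} (h : ∀ᶠ z in codiscrete ℍ, p z) (z : ℍ) :
    ∀ᶠ w in nhdsWithin z {z}ᶜ, p w := by
  simp only [codiscrete, Filter.codiscreteWithin, eventually_iSup, Set.mem_univ, true_imp_iff,
    ← Set.compl_eq_univ_sdiff] at h
  exact h z

lemma eq_zero_of_eventually_codiscrete {f : ℍ → ℂ} (hf : MDiff f)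
    (h : ∀ᶠ z in codiscrete ℍ, f z = 0) : f = 0 :=
  eq_zero_of_frequently hf (eventually_nhdsNE_of_codiscrete h UpperHalfPlane.I).frequently

lemma classHom_eq_zero_iff_of_mdifferentiable {N : ℕ} {f : modularFunctions N}
    (hf : MDiff (f : ℍ → ℂ)) : classHom N f = 0 ↔ ∀ z, (f : ℍ → ℂ) z = 0 := by
  rw [classHom_eq_zero_iff]
  exact ⟨fun h => congrFun (eq_zero_of_eventually_codiscrete hf h), Eventually.of_forall⟩

lemma aeval_jModular_apply {N : ℕ} [NeZero N] (A : Polynomial ℂ) (z : ℍ) :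
    (Polynomial.aeval (jModular N) A : ℍ → ℂ) z = A.eval (jFun z) := by
  rw [← evalAt_apply, ← Polynomial.aeval_algHom_apply]
  rfl

lemma classHom_aeval_jModular {N : ℕ} [NeZero N] (A : Polynomial ℂ) :
    classHom N (Polynomial.aeval (jModular N) A) = Polynomial.aeval (jElt N) A :=
  (Polynomial.aeval_algHom_apply (classHom N) (jModular N) A).symm

lemma eq_zero_of_eval_jFun {A : Polynomial ℂ} (h : ∀ z, A.eval (jFun z) = 0) : A = 0 :=
  Polynomial.funext fun x => by
    obtain ⟨z, rfl⟩ := jFun_surjective x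
    rw [h, Polynomial.eval_zero]

/-- `j` is transcendental over `ℂ`. -/
lemma aeval_jElt_eq_zero_iff {N : ℕ} [NeZero N] {A : Polynomial ℂ} :
    Polynomial.aeval (jElt N) A = 0 ↔ A = 0 := by
  refine ⟨fun h => eq_zero_of_eval_jFun fun z => ?_, fun h => by rw [h, map_zero]⟩
  rw [← classHom_aeval_jModular, classHom_eq_zero_iff_of_mdifferentiable] at h
  · rw [← aeval_jModular_apply (N := N), h]
  · have := mdifferentiable_polynomial_comp A mdifferentiable_jFun
    convert this using 1
    funext z
    exact aeval_jModular_apply A z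

/-- Modular functions that are invariant under `SL(2, ℤ)` represent elements of `ℂ(j)`. -/
lemma classHom_mem_adjoin_jElt {N : ℕ} [NeZero N] {f : modularFunctions N}
    (hf : ∀ (γ : SL(2, ℤ)) (z : ℍ), (f : ℍ → ℂ) (γ • z) = (f : ℍ → ℂ) z) :
    classHom N f ∈ ℂ⟮jElt N⟯ := by
  obtain ⟨A, B, hB, h⟩ := exists_polynomials_of_invariant f.2 hf
  rw [IntermediateField.mem_adjoin_simple_iff]
  refine ⟨A, B, ?_⟩
  rw [eq_div_iff (mt aeval_jElt_eq_zero_iff.1 hB), ← classHom_aeval_jModular,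
    ← classHom_aeval_jModular, ← map_mul, classHom_eq_iff]
  filter_upwards [h] with z hz
  rw [aeval_jModular_apply, ← hz, ← aeval_jModular_apply (N := N)]
  rfl

lemma mdifferentiable_finsetSum {ι : Type*} (s : Finset ι) {f : ι → ℍ → ℂ}
    (hf : ∀ i, MDiff (f i)) : MDiff fun z : ℍ => (∑ i ∈ s, f i z : ℂ) := by
  classical
  induction s using Finset.induction_on with
  | empty => simpa using mdifferentiable_const
  | insert i s hi ih =>
    simp only [Finset.sum_insert hi]
    exact (hf i).add ih

/-! ### The minimal polynomial of `Δ(N·)/Δ` -/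

/-- The functions `1, t, …, t ^ (ψ(N) - 1)`, where `t = Δ(N·)/Δ`, are linearly independent over
`ℂ[j]`, since the `ψ(N)` conjugates of `t` are distinct. -/
lemma eq_zero_of_sum_eval_jFun_mul_tFun_pow {N : ℕ} [NeZero N] {D : ℕ → Polynomial ℂ}
    (h : ∀ z, ∑ i ∈ Finset.range (dedekindPsi N), (D i).eval (jFun z) * tFun N z ^ i = 0) :
    ∀ i < dedekindPsi N, D i = 0 := by
  intro i hi
  refine eq_zero_of_eval_jFun fun z => congrFun (eq_zero_of_frequently (τ := UpperHalfPlane.I)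
    (mdifferentiable_polynomial_comp (D i) mdifferentiable_jFun) ?_) z
  refine Eventually.frequently ?_
  filter_upwards [eventually_cosetTranslate_injective N UpperHalfPlane.I] with z hz
  set Q : Polynomial ℂ := ∑ i ∈ Finset.range (dedekindPsi N),
    Polynomial.C ((D i).eval (jFun z)) * Polynomial.X ^ i with hQ
  have hdeg : Q.degree < Fintype.card (SL(2, ℤ) ⧸ Gamma0 N) := by
    rw [card_cosets, hQ, Finset.sum_range]
    exact Polynomial.degree_sum_fin_lt _
  have hQ0 : Q = 0 := by
    refine Polynomial.eq_zero_of_degree_lt_of_eval_index_eq_zero Finset.univ hz.injOn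
      (by rwa [Finset.card_univ]) fun c _ => ?_
    have := h (c.out⁻¹ • z)
    rw [hQ, Polynomial.eval_finsetSum, ← this]
    refine Finset.sum_congr rfl fun k _ => ?_
    rw [jFun_smul, Polynomial.eval_mul, Polynomial.eval_C, Polynomial.eval_pow, Polynomial.eval_X]
    rfl
  have hcoeff : Q.coeff i = (D i).eval (jFun z) := by
    simp only [hQ, Polynomial.finsetSum_coeff, Polynomial.coeff_C_mul, Polynomial.coeff_X_pow,
      mul_ite, mul_one, mul_zero, Finset.sum_ite_eq, Finset.mem_range, hi, if_true]
  rw [← hcoeff, hQ0, Polynomial.coeff_zero]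

open scoped IntermediateField.algebraAdjoinAdjoin in
lemma linearIndependent_tElt_pow (N : ℕ) [NeZero N] :
    LinearIndependent ℂ⟮jElt N⟯ fun i : Fin (dedekindPsi N) => tElt N ^ (i : ℕ) := by
  rw [← LinearIndependent.iff_fractionRing (R := Algebra.adjoin ℂ {jElt N}),
    Fintype.linearIndependent_iff]
  intro g hg i
  have hA (x : Algebra.adjoin ℂ {jElt N}) : ∃ A : Polynomial ℂ, Polynomial.aeval (jElt N) A = x :=
    (Algebra.adjoin_singleton_eq_range_aeval ℂ (jElt N)).le x.2
  choose A hA using hA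
  let D (k : ℕ) : Polynomial ℂ := if h : k < dedekindPsi N then A (g ⟨k, h⟩) else 0
  have hD (k : Fin (dedekindPsi N)) : D k = A (g k) := by simp [D]
  have h0 : classHom N (∑ k ∈ Finset.range (dedekindPsi N),
      Polynomial.aeval (jModular N) (D k) * tModular N ^ k) = 0 := by
    rw [← hg, map_sum, Finset.sum_range]
    refine Finset.sum_congr rfl fun k _ => ?_
    rw [map_mul, classHom_aeval_jModular, map_pow, classHom_tModular, hD, hA]
    rfl
  have hval (z : ℍ) : ((∑ k ∈ Finset.range (dedekindPsi N),
      Polynomial.aeval (jModular N) (D k) * tModular N ^ k : modularFunctions N) : ℍ → ℂ) z =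
      ∑ k ∈ Finset.range (dedekindPsi N), (D k).eval (jFun z) * tFun N z ^ k := by
    rw [← evalAt_apply, map_sum]
    refine Finset.sum_congr rfl fun k _ => ?_
    rw [map_mul, map_pow, evalAt_apply, evalAt_apply, aeval_jModular_apply]
    rfl
  rw [classHom_eq_zero_iff_of_mdifferentiable] at h0
  · have := eq_zero_of_sum_eval_jFun_mul_tFun_pow (fun z => (hval z).symm.trans (h0 z)) i i.2
    rw [hD] at this
    have h2 := hA (g i)
    rw [this, map_zero] at h2
    exact Subtype.ext h2.symm
  · rw [funext hval]
    exact mdifferentiable_finsetSum _ fun k => (mdifferentiable_polynomial_comp (D k)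
      mdifferentiable_jFun).mul ((mdifferentiable_tFun N).pow k)

lemma minpoly_eq_X_pow_add {K L : Type*} [Field K] [Field L] [Algebra K L] {x : L} {n : ℕ}
    {a : ℕ → K} (hli : LinearIndependent K fun i : Fin n => x ^ (i : ℕ))
    (h0 : x ^ n + ∑ k ∈ Finset.range n, algebraMap K L (a k) * x ^ k = 0) :
    minpoly K x = Polynomial.X ^ n +
      ∑ k ∈ Finset.range n, Polynomial.C (a k) * Polynomial.X ^ k := by
  have hdeg : (∑ k ∈ Finset.range n, Polynomial.C (a k) * Polynomial.X ^ k).degree <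
      (n : WithBot ℕ) := by
    rw [Finset.sum_range]
    exact Polynomial.degree_sum_fin_lt _
  refine (minpoly.unique _ _ (Polynomial.monic_X_pow_add hdeg) ?_ fun q hq h0 => ?_).symm
  · simpa only [map_add, map_pow, Polynomial.aeval_X, map_sum, map_mul, Polynomial.aeval_C] using h0
  · rw [Polynomial.degree_add_eq_left_of_degree_lt (by rwa [Polynomial.degree_X_pow]),
      Polynomial.degree_X_pow]
    by_contra! hlt
    refine hq.ne_zero ?_
    have hnat : q.natDegree < n := by rwa [Polynomial.natDegree_lt_iff_degree_lt hq.ne_zero]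
    rw [Polynomial.aeval_eq_sum_range' hnat, Finset.sum_range] at h0
    have := Fintype.linearIndependent_iff.1 hli (fun i => q.coeff i) h0
    ext k
    rcases lt_or_ge k n with hk | hk
    · exact this ⟨k, hk⟩
    · rw [Polynomial.coeff_eq_zero_of_natDegree_lt (hnat.trans_le hk), Polynomial.coeff_zero]

/-- The minimal polynomial of `Δ(N·)/Δ` over `ℂ(j)`. -/
theorem minpoly_tElt (N : ℕ) [NeZero N] :
    minpoly ℂ⟮jElt N⟯ (tElt N) = Polynomial.X ^ dedekindPsi N +
      ∑ k ∈ Finset.range (dedekindPsi N), Polynomial.C (Polynomial.aeval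
        (IntermediateField.AdjoinSimple.gen ℂ (jElt N)) (coeffPoly N k)) * Polynomial.X ^ k := by
  refine minpoly_eq_X_pow_add (linearIndependent_tElt_pow N) ?_
  have h1 (A : Polynomial ℂ) : algebraMap ℂ⟮jElt N⟯ (FunctionField N) (Polynomial.aeval
      (IntermediateField.AdjoinSimple.gen ℂ (jElt N)) A) = Polynomial.aeval (jElt N) A := by
    rw [← Polynomial.aeval_algebraMap_apply, IntermediateField.AdjoinSimple.algebraMap_gen]
  simp only [h1, ← classHom_aeval_jModular, ← classHom_tModular]
  simp only [← map_pow, ← map_mul, ← map_sum, ← map_add]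
  rw [classHom_eq_zero_iff]
  refine Eventually.of_forall fun z => ?_
  have h2 := eval_tFun_conjPoly N z
  rw [conjPoly_eq] at h2
  rw [← evalAt_apply, ← h2]
  simp only [map_add, map_pow, map_sum, map_mul, evalAt_apply, aeval_jModular_apply,
    Polynomial.eval_add, Polynomial.eval_pow, Polynomial.eval_X, Polynomial.eval_finsetSum,
    Polynomial.eval_mul, Polynomial.eval_C]
  rfl

/-! ### Generators of the function field -/

/-- The algebra of functions that are meromorphic on the upper half-plane and at all cusps, without
any invariance condition. -/
def meromorphicFunctions (N : ℕ) : Subalgebra ℂ (ℍ → ℂ) where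
  carrier := {f | (∀ z : ℍ, MeromorphicAt (f ∘ ofComplex) (z : ℂ)) ∧
    ∀ γ : SL(2, ℤ), MeromorphicAt (cuspFunction N fun z => f (γ • z)) 0}
  mul_mem' {f g} hf hg := by
    refine ⟨fun z => (hf.1 z).mul (hg.1 z), fun γ => ((hf.2 γ).mul (hg.2 γ)).congr ?_⟩
    filter_upwards [cuspFunction_eventuallyEq N fun z => f (γ • z),
      cuspFunction_eventuallyEq N fun z => g (γ • z),
      cuspFunction_eventuallyEq N fun z => (f * g) (γ • z)] with q h1 h2 h3
    rw [Pi.mul_apply, h1, h2, h3, Pi.mul_apply]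
  add_mem' {f g} hf hg := by
    refine ⟨fun z => (hf.1 z).add (hg.1 z), fun γ => ((hf.2 γ).add (hg.2 γ)).congr ?_⟩
    filter_upwards [cuspFunction_eventuallyEq N fun z => f (γ • z),
      cuspFunction_eventuallyEq N fun z => g (γ • z),
      cuspFunction_eventuallyEq N fun z => (f + g) (γ • z)] with q h1 h2 h3
    rw [Pi.add_apply, h1, h2, h3, Pi.add_apply]
  algebraMap_mem' c := ⟨(IsModularFunction.const N c).meromorphic,
    (IsModularFunction.const N c).meromorphic_cusp⟩

lemma isModularFunction_of_mem_meromorphicFunctions {N : ℕ} {f : ℍ → ℂ}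
    (hf : f ∈ meromorphicFunctions N) (hinv : ∀ (γ : SL(2, ℤ)) (z : ℍ), f (γ • z) = f z) :
    IsModularFunction N f :=
  ⟨fun γ _ => hinv γ, hf.1, hf.2⟩

lemma meromorphicAt_comp_smul {f : ℍ → ℂ} (hf : ∀ z : ℍ, MeromorphicAt (f ∘ ofComplex) (z : ℂ))
    (γ : SL(2, ℤ)) (z : ℍ) : MeromorphicAt ((fun w => f (γ • w)) ∘ ofComplex) (z : ℂ) := by
  have h1 := analyticAt_smul (g := (γ : GL (Fin 2) ℝ))
    (by rw [← Matrix.GeneralLinearGroup.val_det_apply]; simp) z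
  have h2 : MeromorphicAt (f ∘ ofComplex)
      ((fun w : ℂ => (((γ : GL (Fin 2) ℝ) • ofComplex w : ℍ) : ℂ)) z) := hf _
  refine (h2.comp_analyticAt (g := fun w : ℂ => (((γ : GL (Fin 2) ℝ) • ofComplex w : ℍ) : ℂ))
    h1).congr (Eventually.of_forall fun w => ?_)
  simp only [Function.comp_apply, ofComplex_apply]
  rfl

lemma IsModularFunction.cosetTranslate_mem {N : ℕ} {f : ℍ → ℂ} (hf : IsModularFunction N f)
    (c : SL(2, ℤ) ⧸ Gamma0 N) : cosetTranslate f c ∈ meromorphicFunctions N := by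
  refine ⟨meromorphicAt_comp_smul hf.meromorphic _, fun γ => ?_⟩
  simpa only [cosetTranslate, smul_smul] using hf.meromorphic_cusp (c.out⁻¹ * γ)

open Classical in
/-- The polynomial that takes the value `f_c ∏_{c' ≠ c} (t_c - t_c')` at `t_c`, where `f_c` and
`t_c` are the conjugates of `f` and of `t = Δ(N·)/Δ` (Lagrange interpolation without
denominators). -/
def lagrangePoly (N : ℕ) [NeZero N] (f : ℍ → ℂ) (z : ℍ) : Polynomial ℂ :=
  ∑ c : SL(2, ℤ) ⧸ Gamma0 N, Polynomial.C (cosetTranslate f c z) *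
    ∏ c' ∈ Finset.univ.erase c, (Polynomial.X - Polynomial.C (cosetTranslate (tFun N) c' z))

open Classical in
lemma lagrangePoly_smul {N : ℕ} [NeZero N] {f : ℍ → ℂ} (hf : IsModularFunction N f)
    (γ : SL(2, ℤ)) (z : ℍ) : lagrangePoly N f (γ • z) = lagrangePoly N f z := by
  simp only [lagrangePoly, cosetTranslate_smul hf.invariant, cosetTranslate_smul tFun_smul]
  refine Eq.trans ?_ (Equiv.sum_comp
    (MulAction.toPerm (α := SL(2, ℤ)) (β := SL(2, ℤ) ⧸ Gamma0 N) γ⁻¹) _)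
  refine Finset.sum_congr rfl fun c _ => congrArg _ ?_
  refine Finset.prod_equiv (MulAction.toPerm γ⁻¹) (fun c' => ?_) fun c' _ => rfl
  simp only [Finset.mem_erase, Finset.mem_univ, and_true, ne_eq, EmbeddingLike.apply_eq_iff_eq]

/-- The coefficients of `lagrangePoly` are modular functions of level one. -/
lemma exists_coeff_lagrangePoly {N : ℕ} [NeZero N] {f : ℍ → ℂ} (hf : IsModularFunction N f) :
    (∃ n, ∀ z, (lagrangePoly N f z).natDegree < n) ∧
      ∀ k, IsModularFunction N fun z => (lagrangePoly N f z).coeff k := by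
  classical
  let P : Polynomial (meromorphicFunctions N) := ∑ c : SL(2, ℤ) ⧸ Gamma0 N,
    Polynomial.C ⟨_, hf.cosetTranslate_mem c⟩ * ∏ c' ∈ Finset.univ.erase c,
      (Polynomial.X - Polynomial.C ⟨_, (isModularFunction_tFun N).cosetTranslate_mem c'⟩)
  let ev (z : ℍ) : meromorphicFunctions N →+* ℂ :=
    ((Pi.evalAlgHom ℂ (fun _ : ℍ => ℂ) z).comp (meromorphicFunctions N).val).toRingHom
  have hP (z : ℍ) : lagrangePoly N f z = P.map (ev z) := by
    simp only [P, lagrangePoly, Polynomial.map_sum, Polynomial.map_mul, Polynomial.map_prod,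
      Polynomial.map_sub, Polynomial.map_X, Polynomial.map_C]
    rfl
  refine ⟨⟨P.natDegree + 1, fun z => ?_⟩, fun k => ?_⟩
  · rw [hP, Nat.lt_succ_iff]
    exact Polynomial.natDegree_map_le
  · refine isModularFunction_of_mem_meromorphicFunctions ?_ fun γ z => by
      rw [lagrangePoly_smul hf]
    convert (P.coeff k).2 using 1
    funext z
    rw [hP, Polynomial.coeff_map]
    rfl

open Classical in
lemma eval_tFun_lagrangePoly {N : ℕ} [NeZero N] {f : ℍ → ℂ} (hf : IsModularFunction N f) (z : ℍ) :
    (lagrangePoly N f z).eval (tFun N z) = f z *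
      ∏ c ∈ Finset.univ.erase ((1 : SL(2, ℤ)) : SL(2, ℤ) ⧸ Gamma0 N),
        (tFun N z - cosetTranslate (tFun N) c z) := by
  rw [lagrangePoly, Polynomial.eval_finsetSum,
    Finset.sum_eq_single ((1 : SL(2, ℤ)) : SL(2, ℤ) ⧸ Gamma0 N)]
  · simp only [Polynomial.eval_mul, Polynomial.eval_C, Polynomial.eval_prod, Polynomial.eval_sub,
      Polynomial.eval_X, cosetTranslate_one hf.invariant]
  · intro c _ hc
    rw [Polynomial.eval_mul, Polynomial.eval_prod,
      Finset.prod_eq_zero (i := ((1 : SL(2, ℤ)) : SL(2, ℤ) ⧸ Gamma0 N)), mul_zero]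
    · simpa using hc.symm
    · simp [cosetTranslate_one tFun_smul]
  · simp

lemma exists_mem_adjoin_of_isModularFunction {N : ℕ} [NeZero N] {f : ℍ → ℂ}
    (hf : IsModularFunction N f) : ∃ g : modularFunctions N,
      (∀ z, (g : ℍ → ℂ) z = (lagrangePoly N f z).eval (tFun N z)) ∧
        classHom N g ∈ IntermediateField.adjoin ℂ {jElt N, tElt N} := by
  obtain ⟨⟨n, hn⟩, hcoeff⟩ := exists_coeff_lagrangePoly hf
  refine ⟨∑ k ∈ Finset.range n, ⟨_, hcoeff k⟩ * tModular N ^ k, fun z => ?_, ?_⟩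
  · rw [Polynomial.eval_eq_sum_range' (hn z), ← evalAt_apply, map_sum]
    refine Finset.sum_congr rfl fun k _ => ?_
    rw [map_mul, map_pow]
    rfl
  · rw [map_sum]
    refine sum_mem fun k _ => ?_
    rw [map_mul, map_pow, classHom_tModular]
    refine mul_mem ?_ (pow_mem (IntermediateField.mem_adjoin_pair_right ℂ (jElt N) (tElt N)) k)
    refine IntermediateField.adjoin.mono ℂ {jElt N} {jElt N, tElt N} (by simp) ?_
    exact classHom_mem_adjoin_jElt fun γ z => by simp only [lagrangePoly_smul hf]

/-- `j` and `Δ(N·)/Δ` generate the function field of `X₀(N)`. -/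
theorem adjoin_jElt_tElt (N : ℕ) [NeZero N] :
    IntermediateField.adjoin ℂ {jElt N, tElt N} = ⊤ := by
  classical
  rw [eq_top_iff]
  rintro x -
  obtain ⟨⟨f, hf⟩, rfl⟩ := Ideal.Quotient.mk_surjective x
  obtain ⟨g, hg, hgm⟩ := exists_mem_adjoin_of_isModularFunction hf
  obtain ⟨d, hd, hdm⟩ := exists_mem_adjoin_of_isModularFunction (IsModularFunction.const N 1)
  have hd0 : classHom N d ≠ 0 := by
    rw [Ne, classHom_eq_zero_iff]
    intro h
    obtain ⟨z, hz, hinj⟩ := ((eventually_nhdsNE_of_codiscrete h UpperHalfPlane.I).and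
      (eventually_cosetTranslate_injective N UpperHalfPlane.I)).exists
    rw [hd, eval_tFun_lagrangePoly (IsModularFunction.const N 1), one_mul,
      Finset.prod_eq_zero_iff] at hz
    obtain ⟨c, hc, hz⟩ := hz
    rw [← cosetTranslate_one tFun_smul z, sub_eq_zero] at hz
    exact (Finset.mem_erase.1 hc).1 (hinj hz.symm)
  have h : classHom N ⟨f, hf⟩ * classHom N d = classHom N g := by
    rw [← map_mul, classHom_eq_iff]
    refine Eventually.of_forall fun z => ?_
    rw [hg, eval_tFun_lagrangePoly hf]
    change f z * (d : ℍ → ℂ) z = _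
    rw [hd, eval_tFun_lagrangePoly (IsModularFunction.const N 1), one_mul]
  rw [← eq_div_iff hd0] at h
  change classHom N ⟨f, hf⟩ ∈ _
  rw [h]
  exact div_mem hgm hdm

theorem mapDegree_eq_one (N : ℕ) [NeZero N] : mapDegree N = 1 := by
  rw [mapDegree, adjoin_jElt_tElt, IntermediateField.finrank_top]

/-! ### Homogeneous polynomials and holomorphic functions -/

lemma _root_.MvPolynomial.IsHomogeneous.aeval_mul {σ K R : Type*} [Fintype σ] [CommSemiring K]
    [CommSemiring R] [Algebra K R] {p : MvPolynomial σ K} {n : ℕ} (hp : p.IsHomogeneous n) (a : R)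
    (v : σ → R) : MvPolynomial.aeval (fun i => a * v i) p = a ^ n * MvPolynomial.aeval v p := by
  rw [MvPolynomial.aeval_def, MvPolynomial.aeval_def, MvPolynomial.eval₂_eq',
    MvPolynomial.eval₂_eq', Finset.mul_sum]
  refine Finset.sum_congr rfl fun d hd => ?_
  have h := hp.degree_eq_sum_deg_support hd
  rw [h, Finset.sum_subset (Finset.subset_univ _) fun i _ hi => by simpa using hi]
  simp only [mul_pow, Finset.prod_mul_distrib, Finset.prod_pow_eq_pow_sum]
  ring

lemma _root_.MvPolynomial.IsHomogeneous.eval_mul {σ K : Type*} [Fintype σ] [CommSemiring K]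
    {p : MvPolynomial σ K} {n : ℕ} (hp : p.IsHomogeneous n) (a : K) (v : σ → K) :
    MvPolynomial.eval (fun i => a * v i) p = a ^ n * MvPolynomial.eval v p :=
  hp.aeval_mul a v

lemma mdifferentiable_mvPolynomial_eval {σ : Type*} (p : MvPolynomial σ ℂ) {v : ℍ → σ → ℂ}
    (hv : ∀ i, MDiff fun z => v z i) : MDiff fun z => MvPolynomial.eval (v z) p := by
  induction p using MvPolynomial.induction_on with
  | C a => simpa using mdifferentiable_const
  | add p q hp hq =>
    simp only [map_add]
    exact hp.add hq
  | mul_X p i hp =>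
    simp only [map_mul, MvPolynomial.eval_X]
    exact hp.mul (hv i)

lemma mem_projZeroLocus_iff {F : MvPolynomial (Fin 3) ℂ} {n : ℕ} (hF : F.IsHomogeneous n)
    {v : Fin 3 → ℂ} (hv : v ≠ 0) :
    Projectivization.mk ℂ v hv ∈ projZeroLocus F ↔ MvPolynomial.eval v F = 0 := by
  obtain ⟨a, ha⟩ := Projectivization.exists_smul_eq_mk_rep ℂ v hv
  change MvPolynomial.eval (Projectivization.mk ℂ v hv).rep F = 0 ↔ _
  rw [← ha]
  have := hF.eval_mul (a : ℂ) v
  change MvPolynomial.eval (fun i => (a : ℂ) * v i) F = 0 ↔ _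
  rw [this]
  simp

/-! ### The equation of the image curve -/

/-- The homogeneous polynomial that defines the image curve: the homogenization of the minimal
polynomial of `Δ(N·)/Δ`. -/
def curvePoly (N : ℕ) [NeZero N] : MvPolynomial (Fin 3) ℂ :=
  MvPolynomial.X 2 ^ dedekindPsi N + ∑ k ∈ Finset.range (dedekindPsi N),
    (∑ i ∈ Finset.range (dedekindPsi N - k), MvPolynomial.C ((coeffPoly N k).coeff i) *
      MvPolynomial.X 0 ^ (dedekindPsi N - k - i) * MvPolynomial.X 1 ^ i) * MvPolynomial.X 2 ^ k

lemma isHomogeneous_curvePoly (N : ℕ) [NeZero N] :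
    (curvePoly N).IsHomogeneous (dedekindPsi N) := by
  refine (MvPolynomial.isHomogeneous_X_pow 2 _).add (.sum _ _ _ fun k hk => ?_)
  have hk' := Finset.mem_range.1 hk
  have h : MvPolynomial.IsHomogeneous (∑ i ∈ Finset.range (dedekindPsi N - k),
      MvPolynomial.C ((coeffPoly N k).coeff i) * MvPolynomial.X 0 ^ (dedekindPsi N - k - i) *
        MvPolynomial.X 1 ^ i : MvPolynomial (Fin 3) ℂ) (dedekindPsi N - k) := by
    refine .sum _ _ _ fun i hi => ?_
    have hi' := Finset.mem_range.1 hi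
    have := (MvPolynomial.isHomogeneous_C_mul_X_pow ((coeffPoly N k).coeff i) (0 : Fin 3)
      (dedekindPsi N - k - i)).mul (MvPolynomial.isHomogeneous_X_pow (R := ℂ) (1 : Fin 3) i)
    rwa [Nat.sub_add_cancel hi'.le] at this
  have := h.mul (MvPolynomial.isHomogeneous_X_pow (R := ℂ) (2 : Fin 3) k)
  rwa [Nat.sub_add_cancel hk'.le] at this

/-- The affine equation of the curve. -/
lemma aeval_curvePoly (N : ℕ) [NeZero N] {R : Type*} [CommRing R] [Algebra ℂ R] (x y : R) :
    MvPolynomial.aeval ![1, x, y] (curvePoly N) = y ^ dedekindPsi N +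
      ∑ k ∈ Finset.range (dedekindPsi N), Polynomial.aeval x (coeffPoly N k) * y ^ k := by
  simp only [curvePoly, map_add, map_pow, map_sum, map_mul, MvPolynomial.aeval_X,
    MvPolynomial.aeval_C, Matrix.cons_val_zero, Matrix.cons_val_one, Matrix.cons_val, one_pow,
    mul_one]
  congr 1
  refine Finset.sum_congr rfl fun k hk => ?_
  have hk' := Finset.mem_range.1 hk
  have hdeg : (coeffPoly N k).natDegree < dedekindPsi N - k := by
    rcases eq_or_ne (coeffPoly N k) 0 with h | h
    · rw [h, Polynomial.natDegree_zero]
      omega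
    · rw [Polynomial.natDegree_lt_iff_degree_lt h]
      exact degree_coeffPoly_lt hk'
  rw [Polynomial.aeval_eq_sum_range' hdeg]
  simp only [Algebra.smul_def]

lemma eval_curvePoly (N : ℕ) [NeZero N] (a y : ℂ) (z : ℍ) :
    MvPolynomial.eval ![a, a * jFun z, a * y] (curvePoly N) =
      a ^ dedekindPsi N * (conjPoly N z).eval y := by
  have h1 : ![a, a * jFun z, a * y] = fun i => a * ![1, jFun z, y] i := by
    ext i
    fin_cases i <;> simp
  have h2 : MvPolynomial.eval ![1, jFun z, y] (curvePoly N) = _ := aeval_curvePoly N (jFun z) y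
  rw [h1, (isHomogeneous_curvePoly N).eval_mul, h2, conjPoly_eq]
  simp [Polynomial.eval_finsetSum]

lemma eval_curvePoly_of_zero (N : ℕ) [NeZero N] {v : Fin 3 → ℂ} (h : v 0 = 0) :
    MvPolynomial.eval v (curvePoly N) = v 2 ^ dedekindPsi N := by
  simp only [curvePoly, map_add, map_pow, map_sum, map_mul, MvPolynomial.eval_X,
    MvPolynomial.eval_C, h]
  refine add_eq_left.2 (Finset.sum_eq_zero fun k _ => ?_)
  rw [Finset.sum_eq_zero, zero_mul]
  intro i hi
  have := Finset.mem_range.1 hi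
  rw [zero_pow (by omega), mul_zero, zero_mul]

lemma aeval_polynomial_C {K : Type*} [CommRing K] [Algebra ℂ K] (x : K) (A : Polynomial ℂ) :
    Polynomial.aeval (Polynomial.C x) A = Polynomial.C (Polynomial.aeval x A) :=
  Polynomial.aeval_algHom_apply Polynomial.CAlgHom x A

lemma aeval_curvePoly_eq_minpoly (N : ℕ) [NeZero N] : MvPolynomial.aeval
    ![1, Polynomial.C (IntermediateField.AdjoinSimple.gen ℂ (jElt N)), Polynomial.X]
      (curvePoly N) = minpoly ℂ⟮jElt N⟯ (tElt N) := by
  rw [aeval_curvePoly, minpoly_tElt]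
  congr 1
  refine Finset.sum_congr rfl fun k _ => ?_
  congr 1
  exact aeval_polynomial_C _ _

/-! ### The points of the image curve -/

lemma formVec_eq (N : ℕ) [NeZero N] (z : ℍ) :
    formVec N z = ![delta z, delta z * jFun z, delta z * tFun N z] := by
  rw [formVec, jFun, tFun, mul_div_cancel₀ _ (delta_ne_zero z), mul_div_cancel₀ _ (delta_ne_zero z)]

lemma tendsto_tFun_smul_mul_delta (N : ℕ) [NeZero N] (γ : SL(2, ℤ)) :
    Tendsto (fun z => tFun N (γ • z) * delta z) atImInfty (nhds 0) := by
  obtain ⟨c, -, h⟩ := hasLeading_tFun_smul N γ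
  have := (h.mul hasLeading_delta).of_lt
    (show 0 < _ by linarith [natCast_gcd_sq_div_pos (N := N) (γ 1 0)])
  exact hasLeading_zero_iff.1 this

lemma tendsto_delta : Tendsto delta atImInfty (nhds 0) :=
  hasLeading_zero_iff.1 (hasLeading_delta.of_lt one_pos)

lemma deltaN_slash (N : ℕ) [NeZero N] (γ : SL(2, ℤ)) :
    deltaN N ∣[(12 : ℤ)] γ = fun z => tFun N (γ • z) * delta z := by
  funext z
  have h := slash_smul (k := 12) (deltaN N) γ z
  have h0 := denom_ne_zero (γ : GL (Fin 2) ℝ) z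
  have h1 := delta_ne_zero z
  rw [tFun, h, delta_smul]
  field_simp
  rfl

lemma cuspVec_zero (N : ℕ) [NeZero N] (γ : SL(2, ℤ)) : cuspVec N γ 0 = 0 := by
  change limUnder atImInfty (delta ∣[(12 : ℤ)] γ) = 0
  have h : delta ∣[(12 : ℤ)] γ = delta := discriminant_slash γ
  rw [h]
  exact tendsto_delta.limUnder_eq

lemma cuspVec_two (N : ℕ) [NeZero N] (γ : SL(2, ℤ)) : cuspVec N γ 2 = 0 := by
  change limUnder atImInfty (deltaN N ∣[(12 : ℤ)] γ) = 0
  rw [deltaN_slash]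
  exact (tendsto_tFun_smul_mul_delta N γ).limUnder_eq

lemma mk_formVec_mem_imageCurve (N : ℕ) [NeZero N] (z : ℍ) :
    Projectivization.mk ℂ (formVec N z) (formVec_ne_zero N z) ∈ imageCurve N :=
  ⟨Sum.inl (Quotient.mk _ z), rfl⟩

/-- The points of the image curve, in homogeneous coordinates: those that come from the upper
half-plane, and the point `(0 : 1 : 0)`, which is the image of all cusps. -/
lemma mk_mem_imageCurve_iff {N : ℕ} [NeZero N] {v : Fin 3 → ℂ} (hv : v ≠ 0) :
    Projectivization.mk ℂ v hv ∈ imageCurve N ↔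
      (∃ a ≠ 0, ∃ z, v = ![a, a * jFun z, a * tFun N z]) ∨ v 0 = 0 ∧ v 2 = 0 := by
  constructor
  · rintro ⟨x | o, hx⟩
    · induction x using Quotient.inductionOn with
      | h z =>
        replace hx : Projectivization.mk ℂ (formVec N z) (formVec_ne_zero N z) =
          Projectivization.mk ℂ v hv := hx
        obtain ⟨a, ha⟩ := (Projectivization.mk_eq_mk_iff' ℂ _ _ _ _).1 hx.symm
        have ha0 : a ≠ 0 := by
          rintro rfl
          exact hv (by rw [← ha, zero_smul])
        refine .inl ⟨a * delta z, mul_ne_zero ha0 (delta_ne_zero z), z, ?_⟩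
        rw [← ha, formVec_eq]
        ext i
        fin_cases i <;> simp [mul_assoc]
    · replace hx : Projectivization.mk ℂ (cuspVec N _) (cuspVec_ne_zero N _) =
          Projectivization.mk ℂ v hv := hx
      obtain ⟨a, ha⟩ := (Projectivization.mk_eq_mk_iff' ℂ _ _ _ _).1 hx.symm
      right
      rw [← ha]
      simp [cuspVec_zero, cuspVec_two]
  · rintro (⟨a, ha, z, rfl⟩ | ⟨h0, h2⟩)
    · convert mk_formVec_mem_imageCurve N z using 1
      rw [Projectivization.mk_eq_mk_iff']
      refine ⟨a / delta z, ?_⟩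
      have := delta_ne_zero z
      rw [formVec_eq]
      ext i
      fin_cases i <;> simp <;> field_simp
    · obtain ⟨o, -⟩ := existsUnique_isCoprime_cuspMatrix N
      refine ⟨Sum.inr o, ?_⟩
      change Projectivization.mk ℂ (cuspVec N _) (cuspVec_ne_zero N _) = _
      rw [Projectivization.mk_eq_mk_iff']
      have h1 : v 1 ≠ 0 := fun h => hv (by ext i; fin_cases i <;> simp [h0, h, h2])
      refine ⟨cuspVec N (cuspMatrix N o) 1 / v 1, ?_⟩
      ext i
      fin_cases i <;> simp [h0, h1, h2, cuspVec_zero, cuspVec_two]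

theorem imageCurve_eq (N : ℕ) [NeZero N] : imageCurve N = projZeroLocus (curvePoly N) := by
  ext x
  induction x using Projectivization.ind with
  | h v hv =>
    rw [mem_projZeroLocus_iff (isHomogeneous_curvePoly N), mk_mem_imageCurve_iff]
    constructor
    · rintro (⟨a, -, z, rfl⟩ | ⟨h0, h2⟩)
      · rw [eval_curvePoly, eval_tFun_conjPoly, mul_zero]
      · rw [eval_curvePoly_of_zero N h0, h2, zero_pow (dedekindPsi_pos N).ne']
    · intro h
      by_cases h0 : v 0 = 0
      · rw [eval_curvePoly_of_zero N h0] at h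
        exact .inr ⟨h0, eq_zero_of_pow_eq_zero h⟩
      · obtain ⟨z, hz⟩ := jFun_surjective (v 1 / v 0)
        have hv' : v = ![v 0, v 0 * jFun z, v 0 * (v 2 / v 0)] := by
          rw [hz]
          ext i
          fin_cases i <;> simp <;> field_simp
        rw [hv', eval_curvePoly, mul_eq_zero, or_iff_right (pow_ne_zero _ h0),
          eval_conjPoly_eq_zero_iff] at h
        obtain ⟨γ, hγ⟩ := h
        refine .inl ⟨v 0, h0, γ • z, ?_⟩
        rwa [jFun_smul, ← hγ]

/-! ### The homogeneous ideal of the image curve -/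

/-- A polynomial vanishes on the curve if it vanishes at the points that come from the upper
half-plane: for the point `(0 : 1 : 0)`, this follows by continuity at the cusp `∞`. -/
lemma mem_projIdeal_imageCurve_iff {N : ℕ} [NeZero N] {p : MvPolynomial (Fin 3) ℂ} :
    p ∈ projIdeal (imageCurve N) ↔
      ∀ a ≠ 0, ∀ z, MvPolynomial.eval ![a, a * jFun z, a * tFun N z] p = 0 := by
  constructor
  · intro h a ha z
    have hv : ![a, a * jFun z, a * tFun N z] ≠ 0 := fun h => ha (congrFun h 0)
    exact h _ hv ((mk_mem_imageCurve_iff hv).2 (.inl ⟨a, ha, z, rfl⟩))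
  · intro h v hv hx
    obtain ⟨a, ha, z, rfl⟩ | ⟨h0, h2⟩ := (mk_mem_imageCurve_iff hv).1 hx
    · exact h a ha z
    · have h1 : v 1 ≠ 0 := fun h => hv (by ext i; fin_cases i <;> simp [h0, h, h2])
      have hlim : Tendsto (fun z => ![v 1 * delta z, v 1 * delta z * jFun z,
          v 1 * delta z * tFun N z]) atImInfty (nhds v) := by
        rw [tendsto_pi_nhds]
        intro i
        fin_cases i
        · have := tendsto_delta.const_mul (v 1)
          simpa [h0] using this
        · have := (hasLeading_zero_iff.1 hasLeading_eisCube).const_mul (v 1)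
          rw [mul_one] at this
          refine this.congr fun z => ?_
          change _ = v 1 * delta z * jFun z
          rw [jFun, mul_assoc, mul_div_cancel₀ _ (delta_ne_zero z)]
        · have := (tendsto_tFun_smul_mul_delta N 1).const_mul (v 1)
          rw [mul_zero] at this
          refine (this.congr fun z => ?_).trans_eq (by rw [← h2]; rfl)
          change _ = v 1 * delta z * tFun N z
          rw [one_smul]
          ring
      have h3 := ((MvPolynomial.continuous_eval p).tendsto v).comp hlim
      refine tendsto_nhds_unique h3 (tendsto_const_nhds.congr fun z => ?_)
      exact (h _ (mul_ne_zero h1 (delta_ne_zero z)) z).symm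

lemma mdifferentiable_eval_formVec {N : ℕ} [NeZero N] (a : ℂ) (p : MvPolynomial (Fin 3) ℂ) :
    MDiff fun z => MvPolynomial.eval ![a, a * jFun z, a * tFun N z] p := by
  refine mdifferentiable_mvPolynomial_eval p fun i => ?_
  fin_cases i
  · exact mdifferentiable_const
  · exact mdifferentiable_const.mul mdifferentiable_jFun
  · exact mdifferentiable_const.mul (mdifferentiable_tFun N)

/-- A polynomial that does not vanish at some point of a line through the origin has only finitely
many zeros on this line. -/
lemma eventually_eval_ne_zero {N : ℕ} [NeZero N] {p : MvPolynomial (Fin 3) ℂ} {a : ℂ} {z : ℍ}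
    (h : MvPolynomial.eval ![a, a * jFun z, a * tFun N z] p ≠ 0) :
    ∀ᶠ b in cofinite, MvPolynomial.eval ![b, b * jFun z, b * tFun N z] p ≠ 0 := by
  let Q : Polynomial ℂ := MvPolynomial.aeval ![Polynomial.X, Polynomial.X * Polynomial.C (jFun z),
    Polynomial.X * Polynomial.C (tFun N z)] p
  have hQ (b : ℂ) : Q.eval b = MvPolynomial.eval ![b, b * jFun z, b * tFun N z] p := by
    have h1 : Q.eval b = MvPolynomial.eval _ p :=
      MvPolynomial.comp_aeval_apply _ (Polynomial.aeval b) p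
    rw [h1]
    congr 2
    ext i
    fin_cases i <;> simp [mul_comm b]
  have hQ0 : Q ≠ 0 := by
    intro h0
    rw [← hQ, h0, Polynomial.eval_zero] at h
    exact h rfl
  simp only [← hQ]
  refine (Polynomial.finite_setOfPred_isRoot hQ0).subset fun b hb => ?_
  simpa using hb

/-- If a product of polynomials vanishes on the curve, then for each `a ≠ 0` one of the factors
vanishes at `(a, a j(z), a t(z))` for all `z`, by the identity theorem; and a factor that is not in
the ideal does so for finitely many `a` only. -/
instance (N : ℕ) [NeZero N] : (projIdeal (imageCurve N)).IsPrime := by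
  refine Ideal.isPrime_iff.2 ⟨fun h => ?_, fun {p q} hpq => ?_⟩
  · rw [Ideal.eq_top_iff_one, mem_projIdeal_imageCurve_iff] at h
    simpa using h 1 one_ne_zero UpperHalfPlane.I
  · by_contra! hcon
    simp only [mem_projIdeal_imageCurve_iff] at hcon
    push Not at hcon
    obtain ⟨⟨a, -, z, hp⟩, ⟨b, -, w, hq⟩⟩ := hcon
    have hfin : ∀ᶠ c : ℂ in cofinite, c ≠ 0 := eventually_cofinite_ne 0
    obtain ⟨c, ⟨h1, h2⟩, h0⟩ :=
      (((eventually_eval_ne_zero hp).and (eventually_eval_ne_zero hq)).and hfin).exists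
    rcases (UpperHalfPlane.mul_eq_zero_iff (mdifferentiable_eval_formVec c p)
      (mdifferentiable_eval_formVec c q)).1 (by
        funext x
        have := mem_projIdeal_imageCurve_iff.1 hpq c h0 x
        rwa [map_mul] at this) with h | h
    · exact h1 (congrFun h z)
    · exact h2 (congrFun h w)

/-- Polynomials in three variables as polynomials in the last one. The rotation of the variables
turns the last one into the first one, which `finSuccEquiv` singles out. -/
def lastVarEquiv : MvPolynomial (Fin 3) ℂ ≃ₐ[ℂ] Polynomial (MvPolynomial (Fin 2) ℂ) :=
  (MvPolynomial.renameEquiv ℂ (finRotate 3)).trans (MvPolynomial.finSuccEquiv ℂ 2)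

lemma eval_lastVarEquiv (p : MvPolynomial (Fin 3) ℂ) (x y w : ℂ) :
    MvPolynomial.eval ![x, y, w] p =
      ((lastVarEquiv p).map (MvPolynomial.eval ![x, y])).eval w := by
  have h : (lastVarEquiv p) =
    MvPolynomial.finSuccEquiv ℂ 2 (MvPolynomial.rename (finRotate 3) p) := rfl
  rw [h, ← MvPolynomial.eval_eq_eval_mv_eval', MvPolynomial.eval_rename]
  congr 2
  ext i
  fin_cases i <;> rfl

lemma lastVarEquiv_X_zero : lastVarEquiv (MvPolynomial.X 0) = Polynomial.C (MvPolynomial.X 0) := by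
  have h : lastVarEquiv (MvPolynomial.X 0) =
    MvPolynomial.finSuccEquiv ℂ 2 (MvPolynomial.rename (finRotate 3) (MvPolynomial.X 0)) := rfl
  rw [h, MvPolynomial.rename_X]
  exact MvPolynomial.finSuccEquiv_X_succ (j := 0)

lemma lastVarEquiv_X_one : lastVarEquiv (MvPolynomial.X 1) = Polynomial.C (MvPolynomial.X 1) := by
  have h : lastVarEquiv (MvPolynomial.X 1) =
    MvPolynomial.finSuccEquiv ℂ 2 (MvPolynomial.rename (finRotate 3) (MvPolynomial.X 1)) := rfl
  rw [h, MvPolynomial.rename_X]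
  exact MvPolynomial.finSuccEquiv_X_succ (j := 1)

lemma lastVarEquiv_X_two : lastVarEquiv (MvPolynomial.X 2) = Polynomial.X := by
  have h : lastVarEquiv (MvPolynomial.X 2) =
    MvPolynomial.finSuccEquiv ℂ 2 (MvPolynomial.rename (finRotate 3) (MvPolynomial.X 2)) := rfl
  rw [h, MvPolynomial.rename_X]
  exact MvPolynomial.finSuccEquiv_X_zero

lemma lastVarEquiv_C (a : ℂ) :
    lastVarEquiv (MvPolynomial.C a) = Polynomial.C (MvPolynomial.C a) := by
  have := lastVarEquiv.commutes a
  exact this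

/-- The equation of the curve is monic of degree `ψ(N)` in the last variable. -/
lemma exists_lastVarEquiv_curvePoly (N : ℕ) [NeZero N] :
    (lastVarEquiv (curvePoly N)).Monic ∧ (lastVarEquiv (curvePoly N)).degree = dedekindPsi N := by
  obtain ⟨a, ha⟩ : ∃ a : ℕ → MvPolynomial (Fin 2) ℂ, lastVarEquiv (curvePoly N) =
      Polynomial.X ^ dedekindPsi N +
        ∑ k ∈ Finset.range (dedekindPsi N), Polynomial.C (a k) * Polynomial.X ^ k := by
    refine ⟨fun k => ∑ i ∈ Finset.range (dedekindPsi N - k),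
      MvPolynomial.C ((coeffPoly N k).coeff i) * MvPolynomial.X 0 ^ (dedekindPsi N - k - i) *
        MvPolynomial.X 1 ^ i, ?_⟩
    simp only [curvePoly, map_add, map_pow, map_sum, map_mul, lastVarEquiv_X_zero,
      lastVarEquiv_X_one, lastVarEquiv_X_two, lastVarEquiv_C]
  have hdeg : (∑ k ∈ Finset.range (dedekindPsi N), Polynomial.C (a k) *
      Polynomial.X ^ k).degree < (dedekindPsi N : WithBot ℕ) := by
    rw [Finset.sum_range]
    exact Polynomial.degree_sum_fin_lt _
  rw [ha]
  refine ⟨Polynomial.monic_X_pow_add hdeg, ?_⟩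
  rw [Polynomial.degree_add_eq_left_of_degree_lt (by rwa [Polynomial.degree_X_pow]),
    Polynomial.degree_X_pow]

/-- A polynomial of degree less than `ψ(N)` in the last variable that vanishes on the curve is
zero. -/
lemma eq_zero_of_mem_projIdeal_of_degree_lt {N : ℕ} [NeZero N] {p : MvPolynomial (Fin 3) ℂ}
    (hp : p ∈ projIdeal (imageCurve N)) (hdeg : (lastVarEquiv p).degree < dedekindPsi N) :
    p = 0 := by
  rw [← lastVarEquiv.map_eq_zero_iff]
  set r := lastVarEquiv p with hr
  ext1 k
  rw [Polynomial.coeff_zero]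
  rcases lt_or_ge k (dedekindPsi N) with hk | hk
  swap
  · exact Polynomial.coeff_eq_zero_of_degree_lt (hdeg.trans_le (by exact_mod_cast hk))
  have key (a x : ℂ) (ha : a ≠ 0) : MvPolynomial.eval ![a, a * x] (r.coeff k) = 0 := by
    let D (i : ℕ) : Polynomial ℂ := Polynomial.C (a ^ i) * MvPolynomial.aeval
      ![Polynomial.C a, Polynomial.C a * Polynomial.X] (r.coeff i)
    have hD (i : ℕ) (x : ℂ) :
        (D i).eval x = a ^ i * MvPolynomial.eval ![a, a * x] (r.coeff i) := by
      have h1 : (MvPolynomial.aeval ![Polynomial.C a, Polynomial.C a * Polynomial.X]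
          (r.coeff i)).eval x = MvPolynomial.eval _ (r.coeff i) :=
        MvPolynomial.comp_aeval_apply _ (Polynomial.aeval x) _
      rw [Polynomial.eval_mul, Polynomial.eval_C, h1]
      congr 3
      ext i
      fin_cases i <;> simp
    have h0 := eq_zero_of_sum_eval_jFun_mul_tFun_pow (N := N) (D := D) (fun z => by
      have h1 := mem_projIdeal_imageCurve_iff.1 hp a ha z
      have hdeg' : (r.map (MvPolynomial.eval ![a, a * jFun z])).natDegree < dedekindPsi N := by
        refine Polynomial.natDegree_map_le.trans_lt ?_
        rcases eq_or_ne r 0 with h | h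
        · rw [h, Polynomial.natDegree_zero]
          exact dedekindPsi_pos N
        · rwa [Polynomial.natDegree_lt_iff_degree_lt h]
      rw [eval_lastVarEquiv, ← hr, Polynomial.eval_eq_sum_range' hdeg'] at h1
      rw [← h1]
      refine Finset.sum_congr rfl fun i _ => ?_
      rw [hD, Polynomial.coeff_map]
      ring) k hk
    have h2 := hD k x
    rw [h0, Polynomial.eval_zero, eq_comm, mul_eq_zero, or_iff_right (pow_ne_zero _ ha)] at h2
    exact h2
  -- The factor `X 0` takes care of the excluded points with first coordinate zero.
  have h3 : MvPolynomial.X 0 * r.coeff k = 0 := by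
    refine MvPolynomial.funext fun v => ?_
    rw [map_mul, MvPolynomial.eval_X, map_zero]
    by_cases h0 : v 0 = 0
    · rw [h0, zero_mul]
    · have h4 := key (v 0) (v 1 / v 0) h0
      have h5 : ![v 0, v 0 * (v 1 / v 0)] = v := by
        ext i
        fin_cases i
        · rfl
        · exact mul_div_cancel₀ _ h0
      rw [h5] at h4
      rw [h4, mul_zero]
  exact (mul_eq_zero.1 h3).resolve_left (MvPolynomial.X_ne_zero 0)

lemma curvePoly_mem_projIdeal (N : ℕ) [NeZero N] : curvePoly N ∈ projIdeal (imageCurve N) := by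
  rw [mem_projIdeal_imageCurve_iff]
  intro a _ z
  rw [eval_curvePoly, eval_tFun_conjPoly, mul_zero]

theorem projIdeal_imageCurve (N : ℕ) [NeZero N] :
    projIdeal (imageCurve N) = Ideal.span {curvePoly N} := by
  refine le_antisymm (fun p hp => ?_) ?_
  · obtain ⟨hm, hd⟩ := exists_lastVarEquiv_curvePoly N
    have h1 := Polynomial.modByMonic_add_div (lastVarEquiv p) (lastVarEquiv (curvePoly N))
    set r := lastVarEquiv p %ₘ lastVarEquiv (curvePoly N) with hr
    set q := lastVarEquiv p /ₘ lastVarEquiv (curvePoly N) with hq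
    have h2 : p = lastVarEquiv.symm r + curvePoly N * lastVarEquiv.symm q := by
      apply lastVarEquiv.injective
      rw [map_add, map_mul, lastVarEquiv.apply_symm_apply, lastVarEquiv.apply_symm_apply, h1]
    have h3 : lastVarEquiv.symm r = 0 := by
      refine eq_zero_of_mem_projIdeal_of_degree_lt (N := N) ?_ ?_
      · rw [eq_sub_of_add_eq h2.symm]
        exact sub_mem hp (Ideal.mul_mem_right _ _ (curvePoly_mem_projIdeal N))
      · rw [lastVarEquiv.apply_symm_apply, ← hd]
        exact Polynomial.degree_modByMonic_lt _ hm
    rw [h2, h3, zero_add]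
    exact Ideal.mul_mem_right _ _ (Ideal.mem_span_singleton_self _)
  · rw [Ideal.span_le, Set.singleton_subset_iff]
    exact curvePoly_mem_projIdeal N

theorem irreducible_curvePoly (N : ℕ) [NeZero N] : Irreducible (curvePoly N) := by
  have h0 : curvePoly N ≠ 0 := by
    intro h
    have := (exists_lastVarEquiv_curvePoly N).1.ne_zero
    rw [h, map_zero] at this
    exact this rfl
  refine Prime.irreducible ((Ideal.span_singleton_prime h0).1 ?_)
  rw [← projIdeal_imageCurve]
  infer_instance

/-! ### Rational functions on the image curve -/

/-- The value of a polynomial in homogeneous coordinates at `(1 : j : Δ(N·)/Δ)`, as a modular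
function. -/
def modularEval (N : ℕ) [NeZero N] : MvPolynomial (Fin 3) ℂ →ₐ[ℂ] modularFunctions N :=
  MvPolynomial.aeval ![1, jModular N, tModular N]

/-- The value of a polynomial in homogeneous coordinates at `(1 : j : Δ(N·)/Δ)`, as an element of
the function field. -/
def fieldEval (N : ℕ) [NeZero N] : MvPolynomial (Fin 3) ℂ →ₐ[ℂ] FunctionField N :=
  (classHom N).comp (modularEval N)

lemma modularEval_apply {N : ℕ} [NeZero N] (p : MvPolynomial (Fin 3) ℂ) (z : ℍ) :
    (modularEval N p : ℍ → ℂ) z = MvPolynomial.eval ![1, jFun z, tFun N z] p := by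
  have h : (modularEval N p : ℍ → ℂ) z = MvPolynomial.eval _ p :=
    MvPolynomial.comp_aeval_apply _ (evalAt z) p
  rw [h]
  congr 2
  ext i
  fin_cases i <;> rfl

lemma fieldEval_X_zero (N : ℕ) [NeZero N] : fieldEval N (MvPolynomial.X 0) = 1 := by
  rw [fieldEval, AlgHom.comp_apply, modularEval, MvPolynomial.aeval_X]
  exact map_one _

lemma fieldEval_X_one (N : ℕ) [NeZero N] : fieldEval N (MvPolynomial.X 1) = jElt N := by
  rw [fieldEval, AlgHom.comp_apply, modularEval, MvPolynomial.aeval_X]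
  rfl

lemma fieldEval_X_two (N : ℕ) [NeZero N] : fieldEval N (MvPolynomial.X 2) = tElt N := by
  rw [fieldEval, AlgHom.comp_apply, modularEval, MvPolynomial.aeval_X]
  rfl

lemma eval_eq_pow_mul_modularEval {N : ℕ} [NeZero N] {p : MvPolynomial (Fin 3) ℂ} {n : ℕ}
    (hp : p.IsHomogeneous n) (a : ℂ) (z : ℍ) :
    MvPolynomial.eval ![a, a * jFun z, a * tFun N z] p = a ^ n * (modularEval N p : ℍ → ℂ) z := by
  rw [modularEval_apply, ← hp.eval_mul]
  congr 2
  ext i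
  fin_cases i <;> simp

/-- A form vanishes on the curve if and only if it vanishes at the generic point. -/
lemma fieldEval_eq_zero_iff {N : ℕ} [NeZero N] {p : MvPolynomial (Fin 3) ℂ} {n : ℕ}
    (hp : p.IsHomogeneous n) : fieldEval N p = 0 ↔ p ∈ projIdeal (imageCurve N) := by
  rw [fieldEval, AlgHom.comp_apply, classHom_eq_zero_iff_of_mdifferentiable,
    mem_projIdeal_imageCurve_iff]
  · constructor
    · intro h a _ z
      rw [eval_eq_pow_mul_modularEval hp, h, mul_zero]
    · intro h z
      have := h 1 one_ne_zero z
      rwa [eval_eq_pow_mul_modularEval hp, one_pow, one_mul] at this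
  · have := mdifferentiable_eval_formVec (N := N) 1 p
    convert this using 1
    funext z
    rw [eval_eq_pow_mul_modularEval hp, one_pow, one_mul]

instance (N : ℕ) [NeZero N] : IsDomain (CoordRing (imageCurve N)) :=
  Ideal.Quotient.isDomain _

lemma mk_mem_nonZeroDivisors_iff {N : ℕ} [NeZero N] {q : MvPolynomial (Fin 3) ℂ} {n : ℕ}
    (hq : q.IsHomogeneous n) : Ideal.Quotient.mk (projIdeal (imageCurve N)) q ∈
      nonZeroDivisors (CoordRing (imageCurve N)) ↔ fieldEval N q ≠ 0 := by
  rw [mem_nonZeroDivisors_iff_ne_zero, Ne, Ideal.Quotient.eq_zero_iff_mem, Ne,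
    fieldEval_eq_zero_iff hq]

/-- Quotients of forms of the same degree are determined by their values at the generic point. -/
lemma IsQuotient.fieldEval_div_eq {N : ℕ} [NeZero N]
    {r : FractionRing (CoordRing (imageCurve N))} {p q p' q' : MvPolynomial (Fin 3) ℂ}
    (h : IsQuotient (imageCurve N) r p q) (h' : IsQuotient (imageCurve N) r p' q') :
    fieldEval N p / fieldEval N q = fieldEval N p' / fieldEval N q' := by
  obtain ⟨⟨n, hp, hq⟩, h1, h2⟩ := h
  obtain ⟨⟨n', hp', hq'⟩, h1', h2'⟩ := h'
  rw [mk_mem_nonZeroDivisors_iff hq] at h1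
  rw [mk_mem_nonZeroDivisors_iff hq'] at h1'
  rw [div_eq_div_iff h1 h1', ← sub_eq_zero, ← map_mul, ← map_mul, ← map_sub,
    fieldEval_eq_zero_iff (n := n + n') ((hp.mul hq').sub (by rw [add_comm]; exact hp'.mul hq)),
    ← Ideal.Quotient.eq_zero_iff_mem, map_sub, sub_eq_zero]
  apply IsFractionRing.injective (CoordRing (imageCurve N))
    (FractionRing (CoordRing (imageCurve N)))
  rw [map_mul, map_mul, map_mul, map_mul, ← h2, ← h2']
  ring

lemma IsQuotient.mul {S : Set (ℙ ℂ (Fin 3 → ℂ))} {r r' : FractionRing (CoordRing S)}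
    {p q p' q' : MvPolynomial (Fin 3) ℂ} (h : IsQuotient S r p q) (h' : IsQuotient S r' p' q') :
    IsQuotient S (r * r') (p * p') (q * q') := by
  obtain ⟨⟨n, hp, hq⟩, h1, h2⟩ := h
  obtain ⟨⟨n', hp', hq'⟩, h1', h2'⟩ := h'
  refine ⟨⟨n + n', hp.mul hp', hq.mul hq'⟩, ?_, ?_⟩
  · rw [map_mul]
    exact mul_mem h1 h1'
  · simp only [map_mul]
    rw [← h2, ← h2']
    ring

lemma IsQuotient.add {S : Set (ℙ ℂ (Fin 3 → ℂ))} {r r' : FractionRing (CoordRing S)}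
    {p q p' q' : MvPolynomial (Fin 3) ℂ} (h : IsQuotient S r p q) (h' : IsQuotient S r' p' q') :
    IsQuotient S (r + r') (p * q' + q * p') (q * q') := by
  obtain ⟨⟨n, hp, hq⟩, h1, h2⟩ := h
  obtain ⟨⟨n', hp', hq'⟩, h1', h2'⟩ := h'
  refine ⟨⟨n + n', (hp.mul hq').add (hq.mul hp'), hq.mul hq'⟩, ?_, ?_⟩
  · rw [map_mul]
    exact mul_mem h1 h1'
  · simp only [map_mul, map_add]
    rw [← h2, ← h2']
    ring

lemma isQuotient_algebraMap (S : Set (ℙ ℂ (Fin 3 → ℂ))) (c : ℂ) :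
    IsQuotient S (algebraMap ℂ _ c) (MvPolynomial.C c) 1 := by
  refine ⟨⟨0, MvPolynomial.isHomogeneous_C _ _, MvPolynomial.isHomogeneous_one _ _⟩, ?_, ?_⟩
  · rw [map_one]
    exact one_mem _
  · rw [map_one, map_one, mul_one]
    rfl

lemma exists_isQuotient {N : ℕ} [NeZero N] {p q : MvPolynomial (Fin 3) ℂ} {n : ℕ}
    (hp : p.IsHomogeneous n) (hq : q.IsHomogeneous n) (h : fieldEval N q ≠ 0) :
    ∃ r : rationalFunctions (imageCurve N), IsQuotient (imageCurve N) r p q := by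
  have h1 := (mk_mem_nonZeroDivisors_iff hq).2 h
  have h2 : IsQuotient (imageCurve N)
      (algebraMap (CoordRing (imageCurve N)) (FractionRing (CoordRing (imageCurve N)))
        (Ideal.Quotient.mk (projIdeal (imageCurve N)) p) /
        algebraMap (CoordRing (imageCurve N)) (FractionRing (CoordRing (imageCurve N)))
        (Ideal.Quotient.mk (projIdeal (imageCurve N)) q)) p q := by
    refine ⟨⟨n, hp, hq⟩, h1, div_mul_cancel₀ _ ?_⟩
    exact IsFractionRing.to_map_ne_zero_of_mem_nonZeroDivisors h1
  exact ⟨⟨_, p, q, h2⟩, h2⟩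

/-- The pullback of rational functions on the curve to modular functions. -/
def pullbackFun (N : ℕ) [NeZero N] (r : rationalFunctions (imageCurve N)) : FunctionField N :=
  fieldEval N r.2.choose / fieldEval N r.2.choose_spec.choose

lemma pullbackFun_eq {N : ℕ} [NeZero N] {r : rationalFunctions (imageCurve N)}
    {p q : MvPolynomial (Fin 3) ℂ} (h : IsQuotient (imageCurve N) r p q) :
    pullbackFun N r = fieldEval N p / fieldEval N q :=
  IsQuotient.fieldEval_div_eq r.2.choose_spec.choose_spec h

lemma IsQuotient.fieldEval_ne_zero {N : ℕ} [NeZero N]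
    {r : FractionRing (CoordRing (imageCurve N))} {p q : MvPolynomial (Fin 3) ℂ}
    (h : IsQuotient (imageCurve N) r p q) : fieldEval N q ≠ 0 := by
  obtain ⟨⟨n, -, hq⟩, h1, -⟩ := h
  exact (mk_mem_nonZeroDivisors_iff hq).1 h1

/-- The pullback of rational functions, as an algebra homomorphism. -/
def pullbackHom (N : ℕ) [NeZero N] : rationalFunctions (imageCurve N) →ₐ[ℂ] FunctionField N :=
  { toFun := pullbackFun N
    map_one' := by
      have h := isQuotient_algebraMap (imageCurve N) 1
      rw [map_one] at h
      rw [pullbackFun_eq (r := 1) h, map_one, map_one, div_one]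
    map_zero' := by
      have h := isQuotient_algebraMap (imageCurve N) 0
      rw [map_zero] at h
      rw [pullbackFun_eq (r := 0) h, map_zero, map_zero, zero_div]
    map_mul' := by
      rintro ⟨r, p, q, h⟩ ⟨r', p', q', h'⟩
      rw [pullbackFun_eq (r := ⟨r, p, q, h⟩) h, pullbackFun_eq (r := ⟨r', p', q', h'⟩) h',
        pullbackFun_eq (r := ⟨r, p, q, h⟩ * ⟨r', p', q', h'⟩) (h.mul h'), map_mul, map_mul,
        div_mul_div_comm]
    map_add' := by
      rintro ⟨r, p, q, h⟩ ⟨r', p', q', h'⟩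
      rw [pullbackFun_eq (r := ⟨r, p, q, h⟩) h, pullbackFun_eq (r := ⟨r', p', q', h'⟩) h',
        pullbackFun_eq (r := ⟨r, p, q, h⟩ + ⟨r', p', q', h'⟩) (h.add h'), map_add, map_mul,
        map_mul, map_mul, div_add_div _ _ h.fieldEval_ne_zero h'.fieldEval_ne_zero]
    commutes' c := by
      have h := isQuotient_algebraMap (imageCurve N) c
      rw [pullbackFun_eq (r := algebraMap ℂ _ c) h, map_one, div_one]
      exact (fieldEval N).commutes c }

lemma pullbackHom_injective (N : ℕ) [NeZero N] : Function.Injective (pullbackHom N) := by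
  rw [injective_iff_map_eq_zero]
  rintro ⟨r, p, q, h⟩ h0
  replace h0 : pullbackFun N ⟨r, p, q, h⟩ = 0 := h0
  rw [pullbackFun_eq (r := ⟨r, p, q, h⟩) h, div_eq_zero_iff, or_iff_left h.fieldEval_ne_zero] at h0
  obtain ⟨⟨n, hp, hq⟩, h1, h2⟩ := h
  rw [fieldEval_eq_zero_iff hp, ← Ideal.Quotient.eq_zero_iff_mem] at h0
  rw [h0, map_zero, mul_eq_zero] at h2
  exact Subtype.ext (h2.resolve_right (IsFractionRing.to_map_ne_zero_of_mem_nonZeroDivisors h1))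

lemma div_mem_range_pullbackHom {N : ℕ} [NeZero N] {p q : MvPolynomial (Fin 3) ℂ} {n : ℕ}
    (hp : p.IsHomogeneous n) (hq : q.IsHomogeneous n) (h : fieldEval N q ≠ 0) :
    fieldEval N p / fieldEval N q ∈ (pullbackHom N).range := by
  obtain ⟨r, hr⟩ := exists_isQuotient hp hq h
  exact ⟨r, pullbackFun_eq hr⟩

lemma pullbackHom_surjective (N : ℕ) [NeZero N] : Function.Surjective (pullbackHom N) := by
  let K : IntermediateField ℂ (FunctionField N) := (pullbackHom N).range.toIntermediateField
    (by
      rintro _ ⟨⟨r, p, q, h⟩, rfl⟩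
      change (pullbackFun N ⟨r, p, q, h⟩)⁻¹ ∈ _
      rw [pullbackFun_eq (r := ⟨r, p, q, h⟩) h, inv_div]
      by_cases h0 : fieldEval N p = 0
      · rw [h0, div_zero]
        exact zero_mem _
      · obtain ⟨⟨n, hp, hq⟩, -, -⟩ := h
        exact div_mem_range_pullbackHom hq hp h0)
  have h0 : fieldEval N (MvPolynomial.X 0) ≠ 0 := by
    rw [fieldEval_X_zero]
    exact one_ne_zero
  have hj : jElt N ∈ K := by
    have := div_mem_range_pullbackHom (MvPolynomial.isHomogeneous_X ℂ 1)
      (MvPolynomial.isHomogeneous_X ℂ 0) h0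
    rwa [fieldEval_X_zero, fieldEval_X_one, div_one] at this
  have ht : tElt N ∈ K := by
    have := div_mem_range_pullbackHom (MvPolynomial.isHomogeneous_X ℂ 2)
      (MvPolynomial.isHomogeneous_X ℂ 0) h0
    rwa [fieldEval_X_zero, fieldEval_X_two, div_one] at this
  intro x
  have hx : x ∈ IntermediateField.adjoin ℂ {jElt N, tElt N} := by
    rw [adjoin_jElt_tElt]
    exact IntermediateField.mem_top
  have hle : IntermediateField.adjoin ℂ {jElt N, tElt N} ≤ K := by
    rw [IntermediateField.adjoin_le_iff]
    rintro y (rfl | rfl)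
    exacts [hj, ht]
  exact hle hx

lemma toFunctionField_inv {N : ℕ} {f : ℍ → ℂ} (hf : IsModularFunction N f) :
    toFunctionField hf.inv = (toFunctionField hf)⁻¹ := by
  by_cases h : ∀ᶠ z in codiscrete ℍ, f z = 0
  · have h1 : toFunctionField hf = 0 := classHom_eq_zero_iff.2 h
    have h2 : toFunctionField hf.inv = 0 := classHom_eq_zero_iff.2 (h.mono fun z hz => by
      change (f z)⁻¹ = 0
      rw [hz, inv_zero])
    rw [h1, h2, inv_zero]
  · refine eq_inv_of_mul_eq_one_left ?_
    rw [← classHom_eq_toFunctionField, ← classHom_eq_toFunctionField, ← map_mul,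
      ← map_one (classHom N), classHom_eq_iff]
    filter_upwards [eventually_ne_zero hf.meromorphic h] with z hz
    exact inv_mul_cancel₀ hz

theorem isPullback_pullbackHom (N : ℕ) [NeZero N] : IsPullback N (pullbackHom N) := by
  intro r p q h
  obtain ⟨n, hp, hq⟩ := h.1
  have hpz (p : MvPolynomial (Fin 3) ℂ) (hp : p.IsHomogeneous n) (z : ℍ) :
      MvPolynomial.eval (formVec N z) p = delta z ^ n * (modularEval N p : ℍ → ℂ) z := by
    rw [formVec_eq, eval_eq_pow_mul_modularEval hp]
  have hfun : (fun z => MvPolynomial.eval (formVec N z) p / MvPolynomial.eval (formVec N z) q) =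
      (modularEval N p : ℍ → ℂ) * (modularEval N q : ℍ → ℂ)⁻¹ := by
    funext z
    rw [hpz p hp, hpz q hq, mul_div_mul_left _ _ (pow_ne_zero _ (delta_ne_zero z)), div_eq_mul_inv]
    rfl
  have hmod := (modularEval N p).2.mul (modularEval N q).2.inv
  refine ⟨hfun ▸ hmod, ?_⟩
  have h1 : toFunctionField (hfun ▸ hmod : IsModularFunction N fun z =>
      MvPolynomial.eval (formVec N z) p / MvPolynomial.eval (formVec N z) q) =
      toFunctionField hmod := by
    congr 1
  rw [h1]
  have h2 : toFunctionField hmod =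
      toFunctionField (modularEval N p).2 * toFunctionField (modularEval N q).2.inv := rfl
  rw [h2, toFunctionField_inv, ← div_eq_mul_inv]
  exact pullbackFun_eq h

theorem isBirationalOntoImage (N : ℕ) [NeZero N] : IsBirationalOntoImage N :=
  ⟨AlgEquiv.ofBijective (pullbackHom N) ⟨pullbackHom_injective N, pullbackHom_surjective N⟩,
    isPullback_pullbackHom N⟩

/-! ### Divisors of poles -/

lemma poleOrderAt_eq_zero_of_mdifferentiable {f : ℍ → ℂ} (hf : MDiff f) (z : ℍ) :
    poleOrderAt (f ∘ ofComplex) z = 0 := by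
  have h := ((UpperHalfPlane.mdifferentiable_iff.mp hf).analyticOnNhd
    isOpen_upperHalfPlaneSet _ z.2).meromorphicOrderAt_nonneg
  rw [poleOrderAt, Int.toNat_eq_zero, neg_nonpos]
  cases h' : meromorphicOrderAt (f ∘ ofComplex) z with
  | top => simp
  | coe n =>
    erw [h'] at h
    exact_mod_cast h

/-- For a function without poles in the upper half-plane, only the cusps contribute. -/
lemma poleDegree_eq_sum {N : ℕ} [NeZero N] [Fintype (CuspOrbits (Gam0 N))] {f : ℍ → ℂ}
    (hf : MDiff f) : poleDegree N f = ∑ o : CuspOrbits (Gam0 N), poleOrderAt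
      (cuspFunction (cuspWidth N (cuspMatrix N o)) fun z => f (cuspMatrix N o • z)) 0 := by
  rw [poleDegree, ← finsum_mem_univ, finsum_mem_inter_support_eq _ _ (Set.range Sum.inr),
    finsum_mem_range Sum.inr_injective, finsum_eq_sum_of_fintype]
  · rfl
  · ext x
    rcases x with x | o
    · have : poleOrder N f (Sum.inl x) = 0 := by
        change poleOrderAt (f ∘ ofComplex) (x.out : ℍ) / _ = 0
        rw [poleOrderAt_eq_zero_of_mdifferentiable hf, Nat.zero_div]
      simp [this]
    · simp

lemma poleOrderAt_cusp {N : ℕ} [NeZero N] {f : ℍ → ℂ} (hf : MDiff f)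
    (hinv : ∀ γ ∈ Gamma0 N, ∀ z : ℍ, f (γ • z) = f z) (γ : SL(2, ℤ)) {n : ℕ} {c : ℂ} (hc : c ≠ 0)
    (hl : HasLeading (fun z => f (γ • z)) (-(n / cuspWidth N γ)) c) :
    poleOrderAt (cuspFunction (cuspWidth N γ) fun z => f (γ • z)) 0 = n := by
  refine poleOrderAt_cuspFunction (Nat.cast_pos.2 (cuspWidth_pos N γ))
    (periodic_comp_ofComplex _ fun z => ?_) (mdifferentiable_comp_smul hf γ) hc hl
  have := hinv _ (mul_T_cuspWidth_mem N γ) (γ • z)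
  rwa [smul_smul, inv_mul_cancel_right, mul_smul] at this

theorem poleDegree_jFun (N : ℕ) [NeZero N] : poleDegree N jFun = dedekindPsi N := by
  have : Fintype (CuspOrbits (Gam0 N)) := Fintype.ofFinite _
  rw [poleDegree_eq_sum mdifferentiable_jFun, ← sum_cuspWidth N]
  refine Finset.sum_congr rfl fun o _ => ?_
  refine poleOrderAt_cusp mdifferentiable_jFun (fun γ _ => jFun_smul γ) _ one_ne_zero ?_
  have h : (cuspWidth N (cuspMatrix N o) : ℝ) ≠ 0 := by exact_mod_cast (cuspWidth_pos N _).ne'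
  simp only [jFun_smul]
  rw [div_self h]
  exact hasLeading_jFun

lemma mdifferentiable_f2Fun (N : ℕ) [NeZero N] : MDiff (f2Fun N) :=
  (mdifferentiable_jFun.pow _).add ((mdifferentiable_tFun N).pow _)

lemma f2Fun_smul {N : ℕ} [NeZero N] (γ : SL(2, ℤ)) (hγ : γ ∈ Gamma0 N) (z : ℍ) :
    f2Fun N (γ • z) = f2Fun N z := by
  rw [f2Fun, jFun_smul, tFun_smul γ hγ, f2Fun]

/-- At the cusp `γ ∞`, the function `j ^ (N - 2)` has a pole of order `N - 2` times the width, and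
`(Δ(N·)/Δ) ^ (N - 1)` has a pole of smaller order, except at the cusp of width `N`, where its order
is `(N - 1) ^ 2 = (N - 2) N + 1`. -/
lemma exists_hasLeading_f2Fun_smul {N : ℕ} [NeZero N] (hN : 2 ≤ N) (γ : SL(2, ℤ))
    [Decidable (IsCoprime (γ 1 0) (N : ℤ))] :
    ∃ c ≠ 0, HasLeading (fun z => f2Fun N (γ • z)) (-((((N - 2) * cuspWidth N γ +
      if IsCoprime (γ 1 0) (N : ℤ) then 1 else 0 : ℕ) : ℝ) / cuspWidth N γ)) c := by
  have hw : (cuspWidth N γ : ℝ) ≠ 0 := by exact_mod_cast (cuspWidth_pos N _).ne'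
  have hN0 : (0 : ℝ) < N := by exact_mod_cast NeZero.pos N
  have hN2 : (2 : ℝ) ≤ N := by exact_mod_cast hN
  obtain ⟨c, hc, ht⟩ := hasLeading_tFun_smul N γ
  replace ht := ht.pow (N - 1)
  have hj := hasLeading_jFun.pow (N - 2)
  rw [Nat.cast_sub hN, Nat.cast_ofNat, one_pow] at hj
  rw [Nat.cast_sub (by omega), Nat.cast_one] at ht
  simp only [f2Fun, jFun_smul]
  split_ifs with hγ
  · have hg : Int.gcd (γ 1 0) N = 1 := Int.isCoprime_iff_gcd_eq_one.1 hγ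
    rw [hg] at ht
    refine ⟨_, pow_ne_zero (N - 1) hc, ?_⟩
    have hexp : ((N : ℝ) - 1) * ((1 : ℕ) ^ 2 / N - 1) =
        -((((N - 2) * cuspWidth N γ + 1 : ℕ) : ℝ) / cuspWidth N γ) := by
      rw [cuspWidth_of_isCoprime hγ, Nat.cast_add, Nat.cast_mul, Nat.cast_sub hN]
      push_cast
      field_simp
      ring
    rw [← hexp]
    have := (hj.of_lt (β := ((N : ℝ) - 1) * ((1 : ℕ) ^ 2 / N - 1)) ?_).add ht
    · rwa [zero_add] at this
    · rw [← sub_pos]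
      have : ((N : ℝ) - 2) * -1 - (N - 1) * ((1 : ℕ) ^ 2 / N - 1) = 1 / N := by
        push_cast
        field_simp
        ring
      rw [this]
      positivity
  · have hg : 2 ≤ Int.gcd (γ 1 0) N := by
      have h1 : Int.gcd (γ 1 0) N ≠ 1 := fun h => hγ (Int.isCoprime_iff_gcd_eq_one.2 h)
      have h0 : 0 < Int.gcd (γ 1 0) N :=
        Int.gcd_pos_of_ne_zero_right _ (by exact_mod_cast NeZero.ne N)
      omega
    refine ⟨1, one_ne_zero, ?_⟩
    have hexp : ((N : ℝ) - 2) * -1 =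
        -((((N - 2) * cuspWidth N γ + 0 : ℕ) : ℝ) / cuspWidth N γ) := by
      rw [Nat.cast_add, Nat.cast_mul, Nat.cast_sub hN]
      push_cast
      field_simp
      ring
    rw [← hexp]
    have := hj.add (ht.of_lt (β := ((N : ℝ) - 2) * -1) ?_)
    · rwa [add_zero] at this
    · have hg' : (2 : ℝ) ≤ Int.gcd (γ 1 0) N := by exact_mod_cast hg
      have h4 : (4 : ℝ) / N ≤ (Int.gcd (γ 1 0) N : ℝ) ^ 2 / N := by
        gcongr
        nlinarith
      have h5 : 1 < ((N : ℝ) - 1) * (4 / N) := by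
        rw [← mul_div_assoc, one_lt_div hN0]
        linarith
      nlinarith

theorem poleDegree_f2Fun (N : ℕ) [NeZero N] (hN : 2 ≤ N) :
    poleDegree N (f2Fun N) = (N - 2) * dedekindPsi N + 1 := by
  classical
  have : Fintype (CuspOrbits (Gam0 N)) := Fintype.ofFinite _
  obtain ⟨o₀, ho₀, huniq⟩ := existsUnique_isCoprime_cuspMatrix N
  have hiff (o : CuspOrbits (Gam0 N)) : IsCoprime (cuspMatrix N o 1 0) (N : ℤ) ↔ o₀ = o :=
    ⟨fun h => (huniq o h).symm, fun h => h ▸ ho₀⟩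
  rw [poleDegree_eq_sum (mdifferentiable_f2Fun N), ← sum_cuspWidth N, Finset.mul_sum]
  have hone : (1 : ℕ) = ∑ o : CuspOrbits (Gam0 N),
      if IsCoprime (cuspMatrix N o 1 0) (N : ℤ) then 1 else 0 := by
    simp only [hiff, Finset.sum_ite_eq, Finset.mem_univ, if_true]
  rw [hone, ← Finset.sum_add_distrib]
  refine Finset.sum_congr rfl fun o _ => ?_
  obtain ⟨c, hc, h⟩ := exists_hasLeading_f2Fun_smul hN (cuspMatrix N o)
  exact poleOrderAt_cusp (mdifferentiable_f2Fun N) f2Fun_smul _ hc h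

end X0Model

end

theorem theorem1 (N : ℕ) [NeZero N] (hN : 2 ≤ N) :
    X0Model.IsBirationalOntoImage N ∧
    X0Model.mapDegree N = 1 ∧
    (∃ F : MvPolynomial (Fin 3) ℂ,
      Irreducible F ∧
      F.IsHomogeneous (X0Model.dedekindPsi N) ∧
      X0Model.imageCurve N = X0Model.projZeroLocus F ∧
      X0Model.projIdeal (X0Model.imageCurve N) = Ideal.span {F} ∧
      MvPolynomial.aeval
          ![1, Polynomial.C (IntermediateField.AdjoinSimple.gen ℂ (X0Model.jElt N)), Polynomial.X] F =
        minpoly ℂ⟮X0Model.jElt N⟯ (X0Model.tElt N)) ∧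
    X0Model.poleDegree N X0Model.jFun = X0Model.dedekindPsi N ∧
    X0Model.poleDegree N (X0Model.f2Fun N) = (N - 2) * X0Model.dedekindPsi N + 1 ∧
    Nat.Coprime (X0Model.poleDegree N X0Model.jFun) (X0Model.poleDegree N (X0Model.f2Fun N)) := by
  refine ⟨X0Model.isBirationalOntoImage N, X0Model.mapDegree_eq_one N,
    ⟨X0Model.curvePoly N, X0Model.irreducible_curvePoly N, X0Model.isHomogeneous_curvePoly N,
      X0Model.imageCurve_eq N, X0Model.projIdeal_imageCurve N,
      X0Model.aeval_curvePoly_eq_minpoly N⟩,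
    X0Model.poleDegree_jFun N, X0Model.poleDegree_f2Fun N hN, ?_⟩
  rw [X0Model.poleDegree_jFun, X0Model.poleDegree_f2Fun N hN]
  simp
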